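/- Let $p\ge 1$ be real, $d\ge 1$, and let $W_p$ be the $p$-Wasserstein distance on $\mathbb R^d$ with the Euclidean norm. For a Markov kernel $\kappa$ on $\mathbb R^d$ put $$\mathcal E_p(\kappa;\mu,\nu)=\Bigl[\bigl(\textstyle\iint\|x-y\|^p\,d\kappa_x(y)\,d\mu(x)\bigr)^{1/p}-W_p(\mu,\nu)\Bigr]_+ + W_p(\kappa_\sharp\mu,\nu).$$ Call $\mu$ $1$-sub-Gaussian if $\mathbb E_\mu[\exp(\|X\|^2)]\le 2$. Let $n\ge 3$, let $X_1,\dots,X_n$ be i.i.d. from $\mu$ and $Y_1,\dots,Y_n$ i.i.d. from $\nu$, with empirical measures $\hat\mu_n,\hat\nu_n$. **Rounding estimator.** Given an accuracy $\delta\ge 0$ and a (countable Borel) partition $\mathcal P$ of $\mathbb R^d$ with centers $c_P\in P$, let $r_{\mathcal P}$ send each $x\in P$ to $c_P$. Step 1: put $\mu'_n=(r_{\mathcal P})_\sharp\hat\mu_n$. Step 2: compute any kernel $\bar\kappa_n$ from the centers to $\operatorname{supp}\hat\nu_n$ with $(\bar\kappa_n)_\sharp\mu_n'=\hat\nu_n$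 and $\iint\|x-y\|^p\,d\bar\kappa_n(y|x)\,d\mu'_n(x)\le W_p(\mu'_n,\hat\nu_n)^p+\delta$. Step 3: return $\hat\kappa_n=\bar\kappa_n\circ r_{\mathcal P}$. **Theorem.** The partition and the tuning parameters below depend only on $p,d,n$, and not on $\mu,\nu$. 1. Let $\mathcal P$ be the regular partition into cubes of side length $r$, with any centers. For suitably tuned $r$ and $\delta$, all $1$-sub-Gaussian $\mu,\nu$ satisfy $\mathbb E[\mathcal E_p(\hat\kappa_n;\mu,\nu)]=\widetilde O_{p,d}\bigl(n^{-1/(d+2p)}\bigr)$, that is, the expectation is at most $A(\log n)^k n^{-1/(d+2p)}$ with $A,k$ depending only on $p,d$. 2. For another (in general non-uniform) partition $\mathcal P$, the same bound holds for all $\mu$ with $\mathbb E_\mu[\|X\|^{2p}]\le 1$ and all $1$-sub-Gaussian $\nu$. 3. In both cases Step 2 can be carried out by a single call of a solver for entropic optimal transport, that is, by computing a coupling $\pi$ of $\mu'_n$ and $\hat\nu_n$ that minimizes $\iint\|x-y\|^p\,d\pi+\tau\,\mathsf{KL}(\pi\,\|\,\mu_n'\otimes\hat\nu_n)$, for a suitable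 $\tau>0$, up to an error of at most $\delta$, and whose conditional kernel is admissible in Step 2. For all samples this call takes time at most $K\,(C_\infty+d)\,n^{2+\varepsilon(d)}$ on a real random-access machine (with arithmetic, $\exp$, $\log$ and comparisons at unit cost), where $C_\infty=\max_{i,j}\|X_i-Y_j\|^p$ is the largest transport cost between sample points, $K$ depends only on $p$, and $\varepsilon$ depends only on $p$ and satisfies $\varepsilon(d)\to 0$ as $d\to\infty$. Step 2 dominates the computation: the rounding in Step 1 (for a suitable choice of the centers) takes time $O_p(d\,n\log n)$ if the integer part of a real number is a unit-cost operation there, and Step 3 is only a composition. -/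

import Mathlib

open MeasureTheory ProbabilityTheory Filter Topology
open scoped ENNReal

universe u

noncomputable section

namespace RoundingOT

/-! ### Optimal transport in Euclidean space -/

/-- `ℝ^d` with the Euclidean norm. -/
abbrev E (d : ℕ) : Type := EuclideanSpace ℝ (Fin d)

/-- The couplings of `μ` and `ν`. -/
def couplings {d : ℕ} (μ ν : Measure (E d)) : Set (Measure (E d × E d)) :=
  {π | π.fst = μ ∧ π.snd = ν}

/-- The transport cost `∬ ‖x - y‖^p dπ(x, y)` of a coupling. -/
def couplingCost {d : ℕ} (p : ℝ) (π : Measure (E d × E d)) : ℝ≥0∞ :=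
  ∫⁻ z, ENNReal.ofReal (‖z.1 - z.2‖ ^ p) ∂π

/-- The `p`-Wasserstein distance `W_p(μ, ν)`. -/
def wasserstein {d : ℕ} (p : ℝ) (μ ν : Measure (E d)) : ℝ≥0∞ :=
  (⨅ π ∈ couplings μ ν, couplingCost p π) ^ (1 / p)

/-- The transport cost `∬ ‖x - y‖^p dκ_x(y) dμ(x)` of a kernel. -/
def kernelCost {d : ℕ} (p : ℝ) (κ : Kernel (E d) (E d)) (μ : Measure (E d)) : ℝ≥0∞ :=
  ∫⁻ x, ∫⁻ y, ENNReal.ofReal (‖x - y‖ ^ p) ∂(κ x) ∂μ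

/-- The transportation error `𝓔_p(κ; μ, ν)`: optimality gap plus feasibility gap. Subtraction in
`ℝ≥0∞` is truncated at zero, as in the positive part `[·]₊`. -/
def transportError {d : ℕ} (p : ℝ) (κ : Kernel (E d) (E d)) (μ ν : Measure (E d)) : ℝ≥0∞ :=
  ((kernelCost p κ μ) ^ (1 / p) - wasserstein p μ ν) + wasserstein p (κ ∘ₘ μ) ν

/-- The objective of the entropic optimal transport problem at temperature `τ`. -/
def entropicCost {d : ℕ} (p τ : ℝ) (μ ν : Measure (E d)) (π : Measure (E d × E d)) : ℝ≥0∞ :=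
  couplingCost p π + ENNReal.ofReal τ * InformationTheory.klDiv π (μ.prod ν)

/-- The optimal value `S_{p,τ}(μ, ν)` of the entropic optimal transport problem. -/
def entropicValue {d : ℕ} (p τ : ℝ) (μ ν : Measure (E d)) : ℝ≥0∞ :=
  ⨅ π ∈ couplings μ ν, entropicCost p τ μ ν π

/-! ### Tail conditions, samples, expectations -/

/-- `μ` is `σ²`-sub-Gaussian: `E_μ[exp(‖X‖² / σ²)] ≤ 2` (the argument `s` is `σ²`). -/
def IsSubGaussian {d : ℕ} (s : ℝ) (μ : Measure (E d)) : Prop :=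
  ∫⁻ x, ENNReal.ofReal (Real.exp (‖x‖ ^ 2 / s)) ∂μ ≤ 2

/-- `E_μ[‖X‖^q] ≤ 1`. -/
def HasUnitMoment {d : ℕ} (q : ℝ) (μ : Measure (E d)) : Prop :=
  ∫⁻ x, ENNReal.ofReal (‖x‖ ^ q) ∂μ ≤ 1

/-- The empirical measure `(1/n) ∑ δ_{x_i}`. -/
def empirical {d n : ℕ} (x : Fin n → E d) : Measure (E d) :=
  (n : ℝ≥0∞)⁻¹ • ∑ i, Measure.dirac (x i)

/-- `X₁, …, X_n` are i.i.d. with law `μ` under `P`. -/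
structure IsIIDSample {Ω : Type u} [MeasurableSpace Ω] {d n : ℕ} (X : Fin n → Ω → E d)
    (μ : Measure (E d)) (P : Measure Ω) : Prop where
  measurable : ∀ i, Measurable (X i)
  map_eq : ∀ i, P.map (X i) = μ
  indep : iIndepFun X P

/-- The upper expectation: the infimum of the expectations of the measurable majorants of `f`. It
is the expectation if `f` is measurable, and needs no measurability of `f`. -/
def upperExpectation {Ω : Type u} [MeasurableSpace Ω] (P : Measure Ω) (f : Ω → ℝ≥0∞) : ℝ≥0∞ :=
  ⨅ (g : Ω → ℝ≥0∞) (_ : Measurable g) (_ : f ≤ g), ∫⁻ ω, g ω ∂P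

theorem upperExpectation_of_measurable {Ω : Type u} [MeasurableSpace Ω] (P : Measure Ω)
    {f : Ω → ℝ≥0∞} (hf : Measurable f) : upperExpectation P f = ∫⁻ ω, f ω ∂P :=
  le_antisymm (iInf_le_of_le f (iInf_le_of_le hf (iInf_le_of_le le_rfl le_rfl)))
    (le_iInf fun _ => le_iInf fun _ => le_iInf fun h => lintegral_mono h)

/-! ### Partitions and rounding -/

/-- A countable Borel partition of `ℝ^d` with a center `c_P ∈ P` for every cell `P`. -/
structure CenteredPartition (d : ℕ) where
  cells : Set (Set (E d))
  isPartition : Setoid.IsPartition cells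
  countable : cells.Countable
  measurableSet : ∀ P ∈ cells, MeasurableSet P
  center : Set (E d) → E d
  center_mem : ∀ P ∈ cells, center P ∈ P

namespace CenteredPartition

variable {d : ℕ}

/-- The cell of the partition that contains `x`. -/
def cellOf (Q : CenteredPartition d) (x : E d) : Set (E d) :=
  (Q.isPartition.2 x).choose

theorem cellOf_mem (Q : CenteredPartition d) (x : E d) : Q.cellOf x ∈ Q.cells :=
  (Q.isPartition.2 x).choose_spec.1.1

theorem mem_cellOf (Q : CenteredPartition d) (x : E d) : x ∈ Q.cellOf x :=
  (Q.isPartition.2 x).choose_spec.1.2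

theorem eq_cellOf (Q : CenteredPartition d) {x : E d} {P : Set (E d)} (hP : P ∈ Q.cells)
    (hx : x ∈ P) : P = Q.cellOf x :=
  (Q.isPartition.2 x).choose_spec.2 P ⟨hP, hx⟩

/-- The rounding map: every point goes to the center of its cell. -/
def round (Q : CenteredPartition d) (x : E d) : E d := Q.center (Q.cellOf x)

theorem measurable_round (Q : CenteredPartition d) : Measurable Q.round := by
  intro A _
  have h : Q.round ⁻¹' A = ⋃ P ∈ {P ∈ Q.cells | Q.center P ∈ A}, P := by
    ext x
    simp only [Set.mem_preimage, Set.mem_iUnion, Set.mem_ofPred_eq, exists_prop]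
    constructor
    · intro hx
      exact ⟨Q.cellOf x, ⟨Q.cellOf_mem x, hx⟩, Q.mem_cellOf x⟩
    · rintro ⟨P, ⟨hP, hA⟩, hx⟩
      rw [Q.eq_cellOf hP hx] at hA
      exact hA
  rw [h]
  exact MeasurableSet.biUnion (Q.countable.mono fun P hP => hP.1)
    fun P hP => Q.measurableSet P hP.1

/-- The set `C_P` of centers. -/
def centers (Q : CenteredPartition d) : Set (E d) := Q.center '' Q.cells

end CenteredPartition

/-- The cells of the regular partition of `ℝ^d` into half-open cubes of side length `r`. -/
def cubeCells (d : ℕ) (r : ℝ) : Set (Set (E d)) :=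
  Set.range fun k : Fin d → ℤ => {x : E d | ∀ i, r * k i ≤ x i ∧ x i < r * (k i + 1)}

/-! ### The rounding estimator -/

/-- `κ` is an admissible preliminary kernel: a Markov kernel from the centers to the support
`{y₁, …, y_n}` of the empirical target that pushes the rounded empirical source onto the empirical
target, with transport cost within `δ` of optimal. (Off the centers, `κ` is irrelevant.) -/
structure IsPreliminaryKernel {d n : ℕ} (p δ : ℝ) (Q : CenteredPartition d)
    (x y : Fin n → E d) (κ : Kernel (E d) (E d)) : Prop where
  markov : IsMarkovKernel κ
  support : ∀ c ∈ Q.centers, κ c (Set.range y)ᶜ = 0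
  pushforward : κ ∘ₘ (empirical x).map Q.round = empirical y
  nearOptimal : kernelCost p κ ((empirical x).map Q.round) ≤
    (wasserstein p ((empirical x).map Q.round) (empirical y)) ^ p + ENNReal.ofReal δ

/-- `κ` is a possible output of the rounding estimator on the samples `x`, `y`: the composition of
an admissible preliminary kernel with the rounding map. -/
def IsRoundingEstimate {d n : ℕ} (p δ : ℝ) (Q : CenteredPartition d)
    (x y : Fin n → E d) (κ : Kernel (E d) (E d)) : Prop :=
  ∃ κ₀ : Kernel (E d) (E d), IsPreliminaryKernel p δ Q x y κ₀ ∧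
    κ = κ₀.comap Q.round Q.measurable_round

/-- The estimator with partition `Q` and accuracy `δ` has risk at most `B` on the class of pairs
`(μ, ν)` with `μ ∈ M` and `ν ∈ N`, from `n` samples of each, whichever admissible preliminary
kernel is taken. The two samples need not be independent of each other. -/
def RiskAtMost {d : ℕ} (n : ℕ) (p δ : ℝ) (Q : CenteredPartition d)
    (M N : Measure (E d) → Prop) (B : ℝ) : Prop :=
  ∀ (μ ν : Measure (E d)) (_ : IsProbabilityMeasure μ) (_ : IsProbabilityMeasure ν),
    M μ → N ν →
  ∀ (Ω : Type u) (_ : MeasurableSpace Ω) (P : Measure Ω) (_ : IsProbabilityMeasure P)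
    (X Y : Fin n → Ω → E d), IsIIDSample X μ P → IsIIDSample Y ν P →
  ∀ κ : Ω → Kernel (E d) (E d),
    (∀ ω, IsRoundingEstimate p δ Q (fun i => X i ω) (fun j => Y j ω) (κ ω)) →
    upperExpectation P (fun ω => transportError p (κ ω) μ ν) ≤ ENNReal.ofReal B

/-! ### The machine model

A real random-access machine, programmed in a while language. It has a memory of natural numbers
(addition, truncated subtraction, comparison) and a memory of real numbers (field operations, `exp`,
`log`, comparison); both can be addressed indirectly. The integer part of a real number is a
separate operation, so that programs without it can be singled out. Every operation of every
expression that is evaluated costs one step. -/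

structure MachineState where
  nat : ℕ → ℕ
  real : ℕ → ℝ

/-- Expressions with natural values; `mem a` reads the cell whose address is the value of `a`. -/
inductive NExpr
  | const (k : ℕ)
  | mem (a : NExpr)
  | plus (a b : NExpr)
  | minus (a b : NExpr)

namespace NExpr

def eval (s : MachineState) : NExpr → ℕ
  | const k => k
  | mem a => s.nat (a.eval s)
  | plus a b => a.eval s + b.eval s
  | minus a b => a.eval s - b.eval s

def cost : NExpr → ℕ
  | const _ => 1
  | mem a => a.cost + 1
  | plus a b => a.cost + b.cost + 1
  | minus a b => a.cost + b.cost + 1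

end NExpr

/-- Expressions with real values. -/
inductive RExpr
  | ofNat (a : NExpr)
  | mem (a : NExpr)
  | plus (a b : RExpr)
  | minus (a b : RExpr)
  | times (a b : RExpr)
  | divide (a b : RExpr)
  | exp (a : RExpr)
  | log (a : RExpr)
  | floor (a : RExpr)

namespace RExpr

def eval (s : MachineState) : RExpr → ℝ
  | ofNat a => (a.eval s : ℝ)
  | mem a => s.real (a.eval s)
  | plus a b => a.eval s + b.eval s
  | minus a b => a.eval s - b.eval s
  | times a b => a.eval s * b.eval s
  | divide a b => a.eval s / b.eval s
  | exp a => Real.exp (a.eval s)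
  | log a => Real.log (a.eval s)
  | floor a => (⌊a.eval s⌋ : ℝ)

def cost : RExpr → ℕ
  | ofNat a => a.cost + 1
  | mem a => a.cost + 1
  | plus a b => a.cost + b.cost + 1
  | minus a b => a.cost + b.cost + 1
  | times a b => a.cost + b.cost + 1
  | divide a b => a.cost + b.cost + 1
  | exp a => a.cost + 1
  | log a => a.cost + 1
  | floor a => a.cost + 1

def FloorFree : RExpr → Prop
  | ofNat _ => True
  | mem _ => True
  | plus a b => a.FloorFree ∧ b.FloorFree
  | minus a b => a.FloorFree ∧ b.FloorFree
  | times a b => a.FloorFree ∧ b.FloorFree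
  | divide a b => a.FloorFree ∧ b.FloorFree
  | exp a => a.FloorFree
  | log a => a.FloorFree
  | floor _ => False

end RExpr

/-- The tests of the machine: comparisons of two expressions. -/
inductive Test
  | natLe (a b : NExpr)
  | realLe (a b : RExpr)

namespace Test

def Holds (s : MachineState) : Test → Prop
  | natLe a b => a.eval s ≤ b.eval s
  | realLe a b => a.eval s ≤ b.eval s

def cost : Test → ℕ
  | natLe a b => a.cost + b.cost + 1
  | realLe a b => a.cost + b.cost + 1

def FloorFree : Test → Prop
  | natLe _ _ => True
  | realLe a b => a.FloorFree ∧ b.FloorFree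

end Test

/-- Programs: assignments to memory cells, composition, conditionals and loops. -/
inductive Program
  | skip
  | setNat (address : NExpr) (value : NExpr)
  | setReal (address : NExpr) (value : RExpr)
  | seq (c₁ c₂ : Program)
  | ite (b : Test) (c₁ c₂ : Program)
  | loop (b : Test) (c : Program)

/-- The program never takes the integer part of a real number. -/
def Program.FloorFree : Program → Prop
  | skip => True
  | setNat _ _ => True
  | setReal _ e => e.FloorFree
  | seq c₁ c₂ => c₁.FloorFree ∧ c₂.FloorFree
  | ite b c₁ c₂ => b.FloorFree ∧ c₁.FloorFree ∧ c₂.FloorFree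
  | loop b c => b.FloorFree ∧ c.FloorFree

/-- `Runs c s t s'`: started in state `s`, the program `c` halts after `t` steps in state `s'`. -/
inductive Runs : Program → MachineState → ℕ → MachineState → Prop
  | skip (s : MachineState) : Runs .skip s 1 s
  | setNat (a e : NExpr) (s : MachineState) :
      Runs (.setNat a e) s (a.cost + e.cost + 1)
        { s with nat := Function.update s.nat (a.eval s) (e.eval s) }
  | setReal (a : NExpr) (e : RExpr) (s : MachineState) :
      Runs (.setReal a e) s (a.cost + e.cost + 1)
        { s with real := Function.update s.real (a.eval s) (e.eval s) }
  | seq {c₁ c₂ : Program} {s s₁ s₂ : MachineState} {t₁ t₂ : ℕ}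
      (h₁ : Runs c₁ s t₁ s₁) (h₂ : Runs c₂ s₁ t₂ s₂) : Runs (.seq c₁ c₂) s (t₁ + t₂) s₂
  | iteTrue {b : Test} {c₁ c₂ : Program} {s s₁ : MachineState} {t : ℕ}
      (hb : b.Holds s) (h : Runs c₁ s t s₁) : Runs (.ite b c₁ c₂) s (b.cost + t) s₁
  | iteFalse {b : Test} {c₁ c₂ : Program} {s s₁ : MachineState} {t : ℕ}
      (hb : ¬ b.Holds s) (h : Runs c₂ s t s₁) : Runs (.ite b c₁ c₂) s (b.cost + t) s₁
  | loopDone {b : Test} {c : Program} {s : MachineState}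
      (hb : ¬ b.Holds s) : Runs (.loop b c) s b.cost s
  | loopStep {b : Test} {c : Program} {s s₁ s₂ : MachineState} {t₁ t₂ : ℕ}
      (hb : b.Holds s) (h₁ : Runs c s t₁ s₁) (h₂ : Runs (.loop b c) s₁ t₂ s₂) :
      Runs (.loop b c) s (b.cost + t₁ + t₂) s₂

/-! ### Running the estimator on the machine -/

/-- The tuning parameters of the estimator: trimming radius `R`, side length `r`, accuracy `δ` of
the preliminary kernel, and temperature `τ` of the entropic problem. -/
structure Tuning where
  R : ℝ
  r : ℝ
  δ : ℝ
  τ : ℝ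

def Tuning.Valid (θ : Tuning) : Prop := 0 < θ.R ∧ 0 < θ.r ∧ 0 ≤ θ.δ ∧ 0 < θ.τ

/-- The state `s` holds `n`, `d`, the parameters and two `n`-tuples of points of `ℝ^d`. All other
cells may contain anything. -/
structure HoldsData {d n : ℕ} (p : ℝ) (θ : Tuning) (x y : Fin n → E d) (s : MachineState) :
    Prop where
  size : s.nat 0 = n
  dim : s.nat 1 = d
  exponent : s.real 0 = p
  accuracy : s.real 1 = θ.δ
  temperature : s.real 2 = θ.τ
  side : s.real 3 = θ.r
  radius : s.real 4 = θ.R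
  source : ∀ (i : Fin n) (k : Fin d), s.real (64 + i * d + k) = x i k
  target : ∀ (j : Fin n) (k : Fin d), s.real (64 + n * d + j * d + k) = y j k

/-- The measure `∑ π_ij δ_(z_i, y_j)` of a matrix with nonnegative entries. -/
def matrixMeasure {d n : ℕ} (π : Fin n → Fin n → ℝ) (z y : Fin n → E d) : Measure (E d × E d) :=
  ∑ i, ∑ j, ENNReal.ofReal (π i j) • Measure.dirac (z i, y j)

/-- The state `s` holds the `n × n` matrix `π`, behind the data. -/
def HoldsMatrix (d : ℕ) {n : ℕ} (π : Fin n → Fin n → ℝ) (s : MachineState) : Prop :=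
  ∀ i j : Fin n, s.real (64 + 2 * (n * d) + i * n + j) = π i j

/-- The largest cost `C_∞ = max_{i,j} ‖x_i - y_j‖^p` between sample points. -/
def maxCost {d n : ℕ} (p : ℝ) (x y : Fin n → E d) : ℝ :=
  ⨆ ij : Fin n × Fin n, ‖x ij.1 - y ij.2‖ ^ p

/-- The first step on the machine: `c` replaces every source sample by its rounding, within `T`
steps, whatever the samples are. -/
def RoundsWithin {d : ℕ} (n : ℕ) (p : ℝ) (θ : Tuning) (Q : CenteredPartition d)
    (c : Program) (T : ℝ) : Prop :=
  ∀ (x y : Fin n → E d) (s : MachineState), HoldsData p θ x y s →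
    ∃ (t : ℕ) (s' : MachineState), Runs c s t s' ∧ (t : ℝ) ≤ T ∧
      HoldsData p θ (fun i => Q.round (x i)) y s'

/-- The second step on the machine, as a single call of a solver `c` for entropic optimal transport:
given the rounded source samples and the target samples, whatever these are, `c` computes within
`T x y` steps a matrix `π` whose measure is a coupling of the two empirical measures, is optimal up
to `δ` for the entropic problem at temperature `τ`, and has an admissible preliminary kernel as its
conditional kernel. -/
def SolvesWithin {d : ℕ} (n : ℕ) (p : ℝ) (θ : Tuning) (Q : CenteredPartition d)
    (c : Program) (T : (Fin n → E d) → (Fin n → E d) → ℝ) : Prop :=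
  ∀ (x y : Fin n → E d) (s : MachineState), HoldsData p θ (fun i => Q.round (x i)) y s →
    ∃ (t : ℕ) (s' : MachineState) (π : Fin n → Fin n → ℝ),
      Runs c s t s' ∧ (t : ℝ) ≤ T x y ∧ HoldsMatrix d π s' ∧ (∀ i j, 0 ≤ π i j) ∧
      matrixMeasure π (fun i => Q.round (x i)) y ∈
        couplings ((empirical x).map Q.round) (empirical y) ∧
      entropicCost p θ.τ ((empirical x).map Q.round) (empirical y)
          (matrixMeasure π (fun i => Q.round (x i)) y) ≤
        entropicValue p θ.τ ((empirical x).map Q.round) (empirical y) + ENNReal.ofReal θ.δ ∧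
      ∃ κ : Kernel (E d) (E d), IsPreliminaryKernel p θ.δ Q x y κ ∧
        (empirical x).map Q.round ⊗ₘ κ = matrixMeasure π (fun i => Q.round (x i)) y

end RoundingOT

end

/-!
# Rounding estimators of optimal transport kernels

*Statistics.* The kernel of the estimator factors through the rounding map, so its cost on `μ` and
the image of `μ` only depend on the masses that `μ` gives to the cells. If `μ` and the empirical
measure `μ_n` gave the same mass to every cell, then the estimate would push `μ` onto the empirical
target, at nearly the optimal cost. In general the errors are controlled by the rounding error, by
the accuracy `δ`, by `W_p(ν, ν_n)`, and by the deviation of `μ_n` from `μ` on the cells, weighted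
with the `p`-th power of the norms of the center and of the target samples (`transportError_le`).
The deviation of `ν_n` from `ν`, for a partition into cubes, also bounds `W_p(ν, ν_n)`
(`wasserstein_empirical_le`). Behind both is the remark that the common part of two measures need
not be moved, so that only the difference of their masses has to be paid for
(`wasserstein_rpow_le_of_common_part`). A cell of mass `m` deviates by at most `√(m / n)` on
average; summed by Cauchy-Schwarz over the `N` cells that meet a ball of radius `R` this is of order
`√(N / n)`, and the cells outside the ball are estimated by the tail of `μ`. With rounding error
`q = n ^ (-1 / (d + 2 p))` one has `N ≈ q ^ (-d)` up to logarithms, and `√(q ^ (-d) / n) = q ^ p`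
balances the two errors (`rate_balance`, `exists_riskAtMost`).

For sub-Gaussian measures the radius is logarithmic, and cubes of side of order `q` do. If only the
moment of order `2 p` is bounded, the radius has to be `1 / q`, which is too large for cubes. There
the rounding error may grow in proportion to the norm, and so the coordinates are put on the scale
`arsinh t`, on which the radius is again logarithmic. Beyond `1 / q` the scale is linear, so that no
point is moved by more than a constant (`truncScale`).

*Computation.* A coupling of two empirical measures of size `n` that is given by an assignment has
relative entropy at most `log n`. At temperature `δ / (2 log n)` an assignment which is optimal up
to `δ / 2` among all couplings is therefore optimal up to `δ` for the entropic problem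
(`assignment_solves`). Such an assignment is found by Bertsekas' auction with increment `δ / 2`: the
prices at the end are a dual solution that certifies optimality (`couplingCost_assignment_le`).
While a target is free its price is zero, which bounds all the prices by the largest cost `C`; so
there are at most `n (2 C / δ + 1)` bids of time `O(n)` each. As `δ = q ^ p = n ^ (-p / (d + 2 p))`,
and as rounding changes `C` at most to `O(C + 1)`, the time is of order
`(C + d) n ^ (2 + p / (d + 2 p))` (`solvesWithin_solver`). The programs are verified by a
calculus of postconditions and time bounds (`Program.Halts`).
-/

namespace RoundingOT

section

/-! ### The Wasserstein distance -/

variable {d : ℕ}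

theorem ofReal_norm_rpow {p : ℝ} (hp : 0 ≤ p) (x : E d) :
    ENNReal.ofReal (‖x‖ ^ p) = ‖x‖ₑ ^ p := by
  rw [← ENNReal.ofReal_rpow_of_nonneg (norm_nonneg x) hp, ofReal_norm]

theorem couplingCost_eq {p : ℝ} (hp : 0 ≤ p) (π : Measure (E d × E d)) :
    couplingCost p π = ∫⁻ z, ‖z.1 - z.2‖ₑ ^ p ∂π := by
  simp only [couplingCost, ofReal_norm_rpow hp]

theorem kernelCost_eq {p : ℝ} (hp : 0 ≤ p) (κ : Kernel (E d) (E d)) (μ : Measure (E d)) :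
    kernelCost p κ μ = ∫⁻ x, ∫⁻ y, ‖x - y‖ₑ ^ p ∂(κ x) ∂μ := by
  simp only [kernelCost, ofReal_norm_rpow hp]

theorem wasserstein_eq_iInf {p : ℝ} (hp : 0 < p) (μ ν : Measure (E d)) :
    wasserstein p μ ν = ⨅ π ∈ couplings μ ν, (couplingCost p π) ^ (1 / p) := by
  have h : 0 < 1 / p := by positivity
  exact (ENNReal.orderIsoRpow (1 / p) h).map_iInf₂
    (fun π (_ : π ∈ couplings μ ν) => couplingCost p π)

theorem wasserstein_le_of_mem {p : ℝ} (hp : 0 < p) {μ ν : Measure (E d)}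
    {π : Measure (E d × E d)} (hπ : π ∈ couplings μ ν) :
    wasserstein p μ ν ≤ (couplingCost p π) ^ (1 / p) := by
  rw [wasserstein_eq_iInf hp]
  exact iInf₂_le π hπ

theorem wasserstein_rpow_le {p : ℝ} (hp : 0 < p) {μ ν : Measure (E d)}
    {π : Measure (E d × E d)} (hπ : π ∈ couplings μ ν) :
    wasserstein p μ ν ^ p ≤ couplingCost p π := by
  calc wasserstein p μ ν ^ p ≤ ((couplingCost p π) ^ (1 / p)) ^ p :=
        ENNReal.rpow_le_rpow (wasserstein_le_of_mem hp hπ) hp.le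
    _ = couplingCost p π := by
        rw [← ENNReal.rpow_mul, one_div_mul_cancel hp.ne', ENNReal.rpow_one]

theorem measurable_cost (p : ℝ) : Measurable fun z : E d × E d => ‖z.1 - z.2‖ₑ ^ p := by
  fun_prop

theorem wasserstein_comm {p : ℝ} (hp : 0 < p) (μ ν : Measure (E d)) :
    wasserstein p μ ν = wasserstein p ν μ := by
  have key : ∀ μ ν : Measure (E d), wasserstein p μ ν ≤ wasserstein p ν μ := by
    intro μ ν
    rw [wasserstein_eq_iInf hp ν μ]
    refine le_iInf₂ fun π hπ => ?_
    have hc : π.map Prod.swap ∈ couplings μ ν := by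
      refine ⟨?_, ?_⟩
      · rw [Measure.fst_map_swap]; exact hπ.2
      · rw [Measure.snd_map_swap]; exact hπ.1
    refine (wasserstein_le_of_mem hp hc).trans_eq ?_
    congr 1
    rw [couplingCost_eq hp.le, couplingCost_eq hp.le,
      lintegral_map (measurable_cost p) measurable_swap]
    refine lintegral_congr fun z => ?_
    rw [Prod.fst_swap, Prod.snd_swap, ← enorm_neg, neg_sub]
  exact le_antisymm (key μ ν) (key ν μ)

/-- Two couplings with a common marginal are glued along it by disintegrating the second one. -/
theorem exists_glued_coupling {p : ℝ} (hp : 1 ≤ p) {μ ν ρ : Measure (E d)}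
    [IsFiniteMeasure μ] [IsFiniteMeasure ν]
    {π₁ π₂ : Measure (E d × E d)} (h₁ : π₁ ∈ couplings μ ν) (h₂ : π₂ ∈ couplings ν ρ) :
    ∃ π ∈ couplings μ ρ, (couplingCost p π) ^ (1 / p) ≤
      (couplingCost p π₁) ^ (1 / p) + (couplingCost p π₂) ^ (1 / p) := by
  have hp0 : 0 < p := by linarith
  obtain ⟨h₁f, h₁s⟩ := h₁
  obtain ⟨h₂f, h₂s⟩ := h₂
  have : IsFiniteMeasure π₁ := ⟨by
    rw [← Measure.fst_univ, h₁f]; exact measure_lt_top _ _⟩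
  have : IsFiniteMeasure π₂ := ⟨by
    rw [← Measure.fst_univ, h₂f]; exact measure_lt_top _ _⟩
  set κ := π₂.condKernel
  have hκ : ν ⊗ₘ κ = π₂ := by rw [← h₂f]; exact π₂.disintegrate κ
  set Γ : Measure ((E d × E d) × E d) := π₁ ⊗ₘ (κ.comap Prod.snd measurable_snd)
  have hΓ₁ : Γ.map Prod.fst = π₁ := by
    change Γ.fst = π₁
    exact Measure.fst_compProd _ _
  have hΓ₂ : Γ.map (fun z => (z.1.2, z.2)) = π₂ := by
    refine Measure.ext fun s hs => ?_
    rw [Measure.map_apply (by fun_prop) hs, Measure.compProd_apply (hs.preimage (by fun_prop)),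
      ← hκ, Measure.compProd_apply hs, ← h₁s, Measure.snd,
      lintegral_map (Kernel.measurable_kernel_prodMk_left hs) measurable_snd]
    rfl
  have hm : Measurable fun z : (E d × E d) × E d => (z.1.1, z.2) := by fun_prop
  refine ⟨Γ.map (fun z => (z.1.1, z.2)), ⟨?_, ?_⟩, ?_⟩
  · rw [Measure.fst, Measure.map_map measurable_fst hm, ← h₁f, Measure.fst, ← hΓ₁,
      Measure.map_map measurable_fst measurable_fst]
    rfl
  · rw [Measure.snd, Measure.map_map measurable_snd hm, ← h₂s, Measure.snd, ← hΓ₂,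
      Measure.map_map measurable_snd (by fun_prop)]
    rfl
  · rw [couplingCost_eq hp0.le, couplingCost_eq hp0.le, couplingCost_eq hp0.le,
      lintegral_map (measurable_cost p) hm]
    have e₁ : ∫⁻ z, ‖z.1 - z.2‖ₑ ^ p ∂π₁ = ∫⁻ z, ‖z.1.1 - z.1.2‖ₑ ^ p ∂Γ := by
      rw [← hΓ₁, lintegral_map (measurable_cost p) measurable_fst]
    have e₂ : ∫⁻ z, ‖z.1 - z.2‖ₑ ^ p ∂π₂ = ∫⁻ z, ‖z.1.2 - z.2‖ₑ ^ p ∂Γ := by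
      rw [← hΓ₂, lintegral_map (measurable_cost p) (by fun_prop)]
    rw [e₁, e₂]
    refine le_trans ?_ (ENNReal.lintegral_Lp_add_le (by fun_prop) (by fun_prop) hp)
    gcongr with z
    simp only [Pi.add_apply]
    calc ‖z.1.1 - z.2‖ₑ = ‖(z.1.1 - z.1.2) + (z.1.2 - z.2)‖ₑ := by congr 1; abel
      _ ≤ _ := enorm_add_le _ _

theorem wasserstein_triangle {p : ℝ} (hp : 1 ≤ p) (μ ν ρ : Measure (E d))
    [IsFiniteMeasure μ] [IsFiniteMeasure ν] :
    wasserstein p μ ρ ≤ wasserstein p μ ν + wasserstein p ν ρ := by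
  have hp0 : 0 < p := by linarith
  rw [wasserstein_eq_iInf hp0 μ ν, wasserstein_eq_iInf hp0 ν ρ]
  simp only [iInf_subtype', ENNReal.iInf_add, ENNReal.add_iInf]
  refine le_iInf fun π₂ => le_iInf fun π₁ => ?_
  obtain ⟨π, hπ, hle⟩ := exists_glued_coupling hp π₁.2 π₂.2
  exact (wasserstein_le_of_mem hp0 hπ).trans hle

/-- Transporting `μ` along a map `f`. -/
theorem wasserstein_map_le {p : ℝ} (hp : 0 < p) (μ : Measure (E d)) {f : E d → E d}
    (hf : Measurable f) :
    wasserstein p μ (μ.map f) ≤ (∫⁻ x, ‖x - f x‖ₑ ^ p ∂μ) ^ (1 / p) := by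
  have hm : Measurable fun x => (x, f x) := measurable_id.prodMk hf
  have hc : μ.map (fun x => (x, f x)) ∈ couplings μ (μ.map f) := by
    refine ⟨?_, ?_⟩
    · rw [Measure.fst, Measure.map_map measurable_fst hm]
      exact Measure.map_id
    · rw [Measure.snd, Measure.map_map measurable_snd hm]
      rfl
  refine (wasserstein_le_of_mem hp hc).trans_eq ?_
  rw [couplingCost_eq hp.le, lintegral_map (measurable_cost p) hm]

/-- Two measures that share the part `γ` are close: the common part stays in place, and the
remainders are coupled independently. -/
theorem wasserstein_rpow_le_of_common_part {p : ℝ} (hp : 1 ≤ p) (γ α β : Measure (E d))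
    [IsFiniteMeasure γ] [IsFiniteMeasure α] [IsFiniteMeasure β]
    (hm : α Set.univ = β Set.univ) :
    wasserstein p (γ + α) (γ + β) ^ p ≤
      2 ^ (p - 1) * (∫⁻ x, ‖x‖ₑ ^ p ∂α + ∫⁻ x, ‖x‖ₑ ^ p ∂β) := by
  have hp0 : 0 < p := by linarith
  set m := α Set.univ with hmdef
  have hmtop : m ≠ ∞ := measure_ne_top _ _
  have hd : Measurable fun x : E d => (x, x) := measurable_id.prodMk measurable_id
  have hmap : ∀ α : Measure (E d), α Set.univ = m → m⁻¹ • (m • α) = α := by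
    intro α hα
    rcases eq_or_ne m 0 with h0 | h0
    · have : α = 0 := Measure.measure_univ_eq_zero.1 (hα.trans h0)
      simp [this]
    · rw [smul_smul, ENNReal.inv_mul_cancel h0 hmtop, one_smul]
  have hc : γ.map (fun x => (x, x)) + m⁻¹ • α.prod β ∈ couplings (γ + α) (γ + β) := by
    refine ⟨?_, ?_⟩
    · rw [Measure.fst_add, Measure.fst, Measure.map_map measurable_fst hd, Measure.fst,
        Measure.map_smul, Measure.map_fst_prod, ← hm, hmap α rfl]
      congr 1
      exact Measure.map_id
    · rw [Measure.snd_add, Measure.snd, Measure.map_map measurable_snd hd, Measure.snd,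
        Measure.map_smul, Measure.map_snd_prod, ← hmdef, hmap β hm.symm]
      congr 1
      exact Measure.map_id
  refine (wasserstein_rpow_le hp0 hc).trans ?_
  rw [couplingCost_eq hp0.le, lintegral_add_measure, lintegral_map (measurable_cost p) hd,
    lintegral_smul_measure]
  simp only [sub_self, enorm_zero, ENNReal.zero_rpow_of_pos hp0, lintegral_zero, zero_add,
    smul_eq_mul]
  have h2 : ∫⁻ z, ‖z.1 - z.2‖ₑ ^ p ∂(α.prod β) ≤
      m * (2 ^ (p - 1) * (∫⁻ x, ‖x‖ₑ ^ p ∂α + ∫⁻ x, ‖x‖ₑ ^ p ∂β)) := by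
    calc ∫⁻ z, ‖z.1 - z.2‖ₑ ^ p ∂(α.prod β)
        ≤ ∫⁻ z, 2 ^ (p - 1) * (‖z.1‖ₑ ^ p + ‖z.2‖ₑ ^ p) ∂(α.prod β) := by
          refine lintegral_mono fun z => ?_
          exact (ENNReal.rpow_le_rpow enorm_sub_le hp0.le).trans
            (ENNReal.rpow_add_le_mul_rpow_add_rpow _ _ hp)
      _ = 2 ^ (p - 1) * (∫⁻ z, ‖z.1‖ₑ ^ p ∂(α.prod β) + ∫⁻ z, ‖z.2‖ₑ ^ p ∂(α.prod β)) := by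
          rw [lintegral_const_mul _ (by fun_prop), lintegral_add_left (by fun_prop)]
      _ = _ := by
          have e₁ : ∫⁻ z, ‖z.1‖ₑ ^ p ∂(α.prod β) = m * ∫⁻ x, ‖x‖ₑ ^ p ∂α := by
            rw [← lintegral_map (f := fun x : E d => ‖x‖ₑ ^ p) (by fun_prop) measurable_fst,
              Measure.map_fst_prod, lintegral_smul_measure, ← hm, smul_eq_mul]
          have e₂ : ∫⁻ z, ‖z.2‖ₑ ^ p ∂(α.prod β) = m * ∫⁻ x, ‖x‖ₑ ^ p ∂β := by
            rw [← lintegral_map (f := fun x : E d => ‖x‖ₑ ^ p) (by fun_prop) measurable_snd,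
              Measure.map_snd_prod, lintegral_smul_measure, smul_eq_mul]
          rw [e₁, e₂]; ring
  calc _ ≤ m⁻¹ * (m * (2 ^ (p - 1) * (∫⁻ x, ‖x‖ₑ ^ p ∂α + ∫⁻ x, ‖x‖ₑ ^ p ∂β))) := by gcongr
    _ ≤ _ := by
      rw [← mul_assoc]
      exact (mul_le_mul_left (ENNReal.inv_mul_le_one _) _).trans_eq (one_mul _)

end

section

/-! ### Rounded measures and the error of the estimator for given samples -/

namespace CenteredPartition

variable {d : ℕ} (Q : CenteredPartition d)

instance : Countable Q.cells := Q.countable.to_subtype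

theorem round_eq_center {P : Set (E d)} (hP : P ∈ Q.cells) {x : E d} (hx : x ∈ P) :
    Q.round x = Q.center P := by
  rw [round, ← Q.eq_cellOf hP hx]

theorem round_mem_cellOf (x : E d) : Q.round x ∈ Q.cellOf x :=
  Q.center_mem _ (Q.cellOf_mem x)

theorem pairwise_disjoint_cells :
    Pairwise (Function.onFun Disjoint fun P : Q.cells => (P : Set (E d))) := by
  intro P P' h
  refine Set.disjoint_left.2 fun x hx hx' => h ?_
  exact Subtype.ext ((Q.eq_cellOf P.2 hx).trans (Q.eq_cellOf P'.2 hx').symm)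

theorem iUnion_cells : ⋃ P : Q.cells, (P : Set (E d)) = Set.univ :=
  Set.eq_univ_of_forall fun x => Set.mem_iUnion.2 ⟨⟨_, Q.cellOf_mem x⟩, Q.mem_cellOf x⟩

theorem lintegral_eq_tsum (μ : Measure (E d)) (f : E d → ℝ≥0∞) :
    ∫⁻ x, f x ∂μ = ∑' P : Q.cells, ∫⁻ x in P, f x ∂μ := by
  rw [← lintegral_iUnion (fun P : Q.cells => Q.measurableSet P P.2) Q.pairwise_disjoint_cells,
    Q.iUnion_cells, Measure.restrict_univ]

theorem setLIntegral_comp_round (μ : Measure (E d)) (f : E d → ℝ≥0∞) (P : Q.cells) :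
    ∫⁻ x in P, f (Q.round x) ∂μ = μ P * f (Q.center P) := by
  rw [setLIntegral_congr_fun (Q.measurableSet P P.2)
    (fun x hx => by rw [Q.round_eq_center P.2 hx] : Set.EqOn _ (fun _ => f (Q.center P)) _),
    setLIntegral_const, mul_comm]

theorem lintegral_comp_round (μ : Measure (E d)) (f : E d → ℝ≥0∞) :
    ∫⁻ x, f (Q.round x) ∂μ = ∑' P : Q.cells, μ P * f (Q.center P) := by
  rw [Q.lintegral_eq_tsum]
  simp_rw [Q.setLIntegral_comp_round]

/-- The measure with mass `a P` at the center of each cell `P`. -/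
noncomputable def atCenters (a : Q.cells → ℝ≥0∞) : Measure (E d) :=
  Measure.sum fun P => a P • Measure.dirac (Q.center P)

theorem lintegral_atCenters (a : Q.cells → ℝ≥0∞) (f : E d → ℝ≥0∞) :
    ∫⁻ x, f x ∂(Q.atCenters a) = ∑' P, a P * f (Q.center P) := by
  simp [atCenters, lintegral_sum_measure]

theorem atCenters_add (a b : Q.cells → ℝ≥0∞) :
    Q.atCenters a + Q.atCenters b = Q.atCenters (a + b) := by
  simp [atCenters, Measure.sum_add_sum, add_smul]

theorem map_round (μ : Measure (E d)) : μ.map Q.round = Q.atCenters fun P => μ P := by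
  refine Measure.ext_of_lintegral _ fun f hf => ?_
  rw [lintegral_map hf Q.measurable_round, lintegral_atCenters, lintegral_comp_round]

/-- The common part of the roundings of `μ` and `μ'`. -/
noncomputable def shared (μ μ' : Measure (E d)) : Measure (E d) :=
  Q.atCenters fun P => min (μ P) (μ' P)

/-- The part of the rounding of `μ` that exceeds the rounding of `μ'`. -/
noncomputable def excess (μ μ' : Measure (E d)) : Measure (E d) :=
  Q.atCenters fun P => μ P - μ' P

theorem shared_comm (μ μ' : Measure (E d)) : Q.shared μ μ' = Q.shared μ' μ := by
  simp only [shared, min_comm]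

theorem map_round_eq_add (μ μ' : Measure (E d)) :
    μ.map Q.round = Q.shared μ μ' + Q.excess μ μ' := by
  rw [map_round, shared, excess, atCenters_add]
  congr 1
  funext P
  rw [Pi.add_apply, add_comm, tsub_add_min]

theorem shared_le (μ μ' : Measure (E d)) : Q.shared μ μ' ≤ μ.map Q.round := by
  rw [Q.map_round_eq_add μ μ']
  exact Measure.le_add_right le_rfl

theorem excess_le (μ μ' : Measure (E d)) : Q.excess μ μ' ≤ μ.map Q.round := by
  rw [Q.map_round_eq_add μ μ']
  exact Measure.le_add_left le_rfl

instance (μ μ' : Measure (E d)) [IsFiniteMeasure μ] : IsFiniteMeasure (Q.shared μ μ') :=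
  isFiniteMeasure_of_le _ (Q.shared_le μ μ')

instance (μ μ' : Measure (E d)) [IsFiniteMeasure μ] : IsFiniteMeasure (Q.excess μ μ') :=
  isFiniteMeasure_of_le _ (Q.excess_le μ μ')

theorem excess_univ (μ μ' : Measure (E d)) [IsProbabilityMeasure μ] [IsProbabilityMeasure μ'] :
    Q.excess μ μ' Set.univ = Q.excess μ' μ Set.univ := by
  have h (μ μ' : Measure (E d)) [IsProbabilityMeasure μ] :
      Q.shared μ μ' Set.univ + Q.excess μ μ' Set.univ = 1 := by
    rw [← Measure.add_apply, ← map_round_eq_add, Measure.map_apply Q.measurable_round .univ]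
    simp
  have h₁ := h μ μ'
  rw [← h μ' μ, Q.shared_comm μ' μ] at h₁
  exact (ENNReal.add_right_inj (measure_ne_top _ _)).1 h₁

/-- The weighted total variation `∑_P |μ(P) - μ'(P)| w(c_P)` between the roundings of two
measures. -/
noncomputable def deviation (μ μ' : Measure (E d)) (w : E d → ℝ≥0∞) : ℝ≥0∞ :=
  ∑' P : Q.cells, ((μ P - μ' P) + (μ' P - μ P)) * w (Q.center P)

theorem lintegral_excess_add (μ μ' : Measure (E d)) (w : E d → ℝ≥0∞) :
    ∫⁻ x, w x ∂(Q.excess μ μ') + ∫⁻ x, w x ∂(Q.excess μ' μ) = Q.deviation μ μ' w := by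
  simp only [excess, lintegral_atCenters, deviation, ← ENNReal.tsum_add, add_mul]

theorem deviation_mono (μ μ' : Measure (E d)) {w w' : E d → ℝ≥0∞} (h : ∀ c, w c ≤ w' c) :
    Q.deviation μ μ' w ≤ Q.deviation μ μ' w' :=
  ENNReal.tsum_le_tsum fun _ => by gcongr; exact h _

theorem wasserstein_map_round_le {p : ℝ} (hp : 1 ≤ p) (μ μ' : Measure (E d))
    [IsProbabilityMeasure μ] [IsProbabilityMeasure μ'] :
    wasserstein p (μ.map Q.round) (μ'.map Q.round) ^ p ≤
      2 ^ (p - 1) * Q.deviation μ μ' fun c => ‖c‖ₑ ^ p := by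
  rw [Q.map_round_eq_add μ μ', Q.map_round_eq_add μ' μ, Q.shared_comm μ' μ,
    ← lintegral_excess_add]
  exact wasserstein_rpow_le_of_common_part hp _ _ _ (Q.excess_univ μ μ')

end CenteredPartition

theorem isProbabilityMeasure_empirical {d n : ℕ} (hn : n ≠ 0) (x : Fin n → E d) :
    IsProbabilityMeasure (empirical x) := by
  refine ⟨?_⟩
  simp [empirical]
  exact ENNReal.inv_mul_cancel (by simpa using hn) (by simp)

variable {d : ℕ}

theorem rpow_one_div_le_of_le_rpow {p : ℝ} (hp : 0 < p) {a b : ℝ≥0∞} (h : a ^ p ≤ b) :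
    a ≤ b ^ (1 / p) := by
  rw [one_div]
  exact (ENNReal.le_rpow_inv_iff hp).2 h

theorem add_rpow_one_div_le {p : ℝ} (hp : 1 ≤ p) (a b : ℝ≥0∞) :
    (a + b) ^ (1 / p) ≤ a ^ (1 / p) + b ^ (1 / p) :=
  ENNReal.rpow_add_le_add_rpow _ _ (by positivity) (by rw [div_le_one (by linarith)]; exact hp)

theorem rpow_rpow_one_div {p : ℝ} (hp : 0 < p) (a : ℝ≥0∞) : (a ^ p) ^ (1 / p) = a := by
  rw [← ENNReal.rpow_mul, mul_one_div_cancel hp.ne', ENNReal.rpow_one]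

/-- Rounding first costs at most the rounding error. -/
theorem kernelCost_comap_round_le {p : ℝ} (hp : 1 ≤ p) (Q : CenteredPartition d)
    (κ : Kernel (E d) (E d)) [IsMarkovKernel κ] (μ : Measure (E d)) [IsProbabilityMeasure μ] :
    (kernelCost p (κ.comap Q.round Q.measurable_round) μ) ^ (1 / p) ≤
      (∫⁻ x, ‖x - Q.round x‖ₑ ^ p ∂μ) ^ (1 / p) +
        (kernelCost p κ (μ.map Q.round)) ^ (1 / p) := by
  have hp0 : 0 < p := by linarith
  have hr := Q.measurable_round
  set κ' := κ.comap Q.round Q.measurable_round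
  have e₀ : kernelCost p κ' μ = ∫⁻ z, ‖z.1 - z.2‖ₑ ^ p ∂(μ ⊗ₘ κ') := by
    rw [kernelCost_eq hp0.le, Measure.lintegral_compProd (measurable_cost p)]
  have e₁ : ∫⁻ x, ‖x - Q.round x‖ₑ ^ p ∂μ = ∫⁻ z, ‖z.1 - Q.round z.1‖ₑ ^ p ∂(μ ⊗ₘ κ') := by
    rw [Measure.lintegral_compProd (f := fun z : E d × E d => ‖z.1 - Q.round z.1‖ₑ ^ p)
      (by fun_prop)]
    simp
  have e₂ : kernelCost p κ (μ.map Q.round) =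
      ∫⁻ z, ‖Q.round z.1 - z.2‖ₑ ^ p ∂(μ ⊗ₘ κ') := by
    rw [kernelCost_eq hp0.le, Measure.lintegral_compProd (by fun_prop), lintegral_map _ hr]
    · rfl
    · exact Measurable.lintegral_kernel_prod_right' (κ := κ) (measurable_cost p)
  rw [e₀, e₁, e₂]
  refine le_trans ?_ (ENNReal.lintegral_Lp_add_le (by fun_prop) (by fun_prop) hp)
  gcongr with z
  simp only [Pi.add_apply]
  calc ‖z.1 - z.2‖ₑ = ‖(z.1 - Q.round z.1) + (Q.round z.1 - z.2)‖ₑ := by congr 1; abel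
    _ ≤ _ := enorm_add_le _ _

theorem comap_round_comp (Q : CenteredPartition d) (κ : Kernel (E d) (E d))
    (μ : Measure (E d)) :
    κ.comap Q.round Q.measurable_round ∘ₘ μ = κ ∘ₘ (μ.map Q.round) := by
  refine Measure.ext fun s hs => ?_
  rw [Measure.bind_apply hs (Kernel.aemeasurable _), Measure.bind_apply hs (Kernel.aemeasurable _),
    lintegral_map (κ.measurable_coe hs) Q.measurable_round]
  rfl

section deterministic

variable {n : ℕ} {p δ : ℝ} {Q : CenteredPartition d} {x y : Fin n → E d}
  {κ : Kernel (E d) (E d)} {M : ℝ≥0∞}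

theorem IsPreliminaryKernel.lintegral_le (h : IsPreliminaryKernel p δ Q x y κ)
    {f : E d → ℝ≥0∞} {b : ℝ≥0∞} (hf : ∀ j, f (y j) ≤ b) {c : E d} (hc : c ∈ Q.centers) :
    ∫⁻ z, f z ∂(κ c) ≤ b := by
  have := h.markov
  have hae : ∀ᵐ z ∂(κ c), f z ≤ b := by
    have h0 : ∀ᵐ z ∂(κ c), z ∈ Set.range y := h.support c hc
    filter_upwards [h0]
    rintro z ⟨j, rfl⟩
    exact hf j
  calc ∫⁻ z, f z ∂(κ c) ≤ ∫⁻ _, b ∂(κ c) := lintegral_mono_ae hae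
    _ = b := by simp

theorem lintegral_atCenters_mono (a : Q.cells → ℝ≥0∞) {f g : E d → ℝ≥0∞}
    (h : ∀ c ∈ Q.centers, f c ≤ g c) :
    ∫⁻ c, f c ∂(Q.atCenters a) ≤ ∫⁻ c, g c ∂(Q.atCenters a) := by
  rw [Q.lintegral_atCenters, Q.lintegral_atCenters]
  exact ENNReal.tsum_le_tsum fun P => by
    gcongr
    exact h _ ⟨P, P.2, rfl⟩

/-- The error of the estimate for given samples: the rounding error, the accuracy, the weighted
total variation between the rounded source and its empirical version, and the distance of the
target from its empirical version. -/
theorem transportError_le (hp : 1 ≤ p) (hn : n ≠ 0) (μ ν : Measure (E d))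
    [IsProbabilityMeasure μ] [IsProbabilityMeasure ν]
    (hκ : IsRoundingEstimate p δ Q x y κ) (hM : ∀ j, ‖y j‖ₑ ^ p ≤ M) :
    transportError p κ μ ν ≤
      2 * (∫⁻ x, ‖x - Q.round x‖ₑ ^ p ∂μ) ^ (1 / p) + ENNReal.ofReal δ ^ (1 / p) +
      3 * (2 ^ (p - 1) * Q.deviation μ (empirical x) fun c => ‖c‖ₑ ^ p + M) ^ (1 / p) +
      2 * wasserstein p (empirical y) ν := by
  obtain ⟨κ₀, h₀, rfl⟩ := hκ
  have hp0 : 0 < p := by linarith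
  have := h₀.markov
  have := isProbabilityMeasure_empirical hn x
  have := isProbabilityMeasure_empirical hn y
  have hr := Q.measurable_round
  have : IsProbabilityMeasure (μ.map Q.round) := Measure.isProbabilityMeasure_map hr.aemeasurable
  have : IsProbabilityMeasure ((empirical x).map Q.round) :=
    Measure.isProbabilityMeasure_map hr.aemeasurable
  set μn := empirical x
  set νn := empirical y
  set D := 2 ^ (p - 1) * Q.deviation μ μn fun c => ‖c‖ₑ ^ p + M with hD
  set ρ := (∫⁻ x, ‖x - Q.round x‖ₑ ^ p ∂μ) ^ (1 / p) with hρ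
  -- the transport cost from the rounded source
  have hcost : kernelCost p κ₀ (μ.map Q.round) ≤ kernelCost p κ₀ (μn.map Q.round) + D := by
    rw [kernelCost_eq hp0.le, kernelCost_eq hp0.le, Q.map_round_eq_add μ μn,
      lintegral_add_measure]
    refine add_le_add (lintegral_mono' (Q.shared_comm μ μn ▸ Q.shared_le μn μ) le_rfl) ?_
    refine (lintegral_atCenters_mono (Q := Q) (g := fun c => 2 ^ (p - 1) * (‖c‖ₑ ^ p + M)) _
      fun c hc => ?_).trans ?_
    · refine h₀.lintegral_le (fun j => ?_) hc
      refine (ENNReal.rpow_le_rpow enorm_sub_le hp0.le).trans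
        ((ENNReal.rpow_add_le_mul_rpow_add_rpow _ _ hp).trans ?_)
      gcongr
      exact hM j
    · rw [lintegral_const_mul _ (by fun_prop), hD]
      gcongr
      rw [← Q.lintegral_excess_add]
      exact le_self_add
  -- the target that the estimate reaches
  have hfeas : wasserstein p (κ₀ ∘ₘ (μ.map Q.round)) νn ≤ D ^ (1 / p) := by
    refine rpow_one_div_le_of_le_rpow hp0 ?_
    have hpush : νn = κ₀ ∘ₘ (Q.shared μ μn) + κ₀ ∘ₘ (Q.excess μn μ) := by
      have h₁ : κ₀ ∘ₘ (μn.map Q.round) = νn := h₀.pushforward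
      rw [← h₁, Q.map_round_eq_add μn μ, Q.shared_comm μn μ]
      simp
    have hpush' : κ₀ ∘ₘ (μ.map Q.round) = κ₀ ∘ₘ (Q.shared μ μn) + κ₀ ∘ₘ (Q.excess μ μn) := by
      rw [Q.map_round_eq_add μ μn]
      simp
    have hint (μ₁ μ₂ : Measure (E d)) : ∫⁻ z, ‖z‖ₑ ^ p ∂(κ₀ ∘ₘ (Q.excess μ₁ μ₂)) ≤
        ∫⁻ c, (‖c‖ₑ ^ p + M) ∂(Q.excess μ₁ μ₂) := by
      rw [Measure.lintegral_bind (Kernel.aemeasurable _) (by fun_prop)]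
      refine lintegral_atCenters_mono _ fun c hc => ?_
      exact h₀.lintegral_le (fun j => (hM j).trans le_add_self) hc
    rw [hpush', hpush]
    refine (wasserstein_rpow_le_of_common_part hp _ _ _ ?_).trans ?_
    · simpa [Measure.bind_apply MeasurableSet.univ (Kernel.aemeasurable _)] using
        Q.excess_univ μ μn
    · rw [hD, ← Q.lintegral_excess_add]
      exact mul_le_mul_right (add_le_add (hint _ _) (hint _ _)) _
  have hround : wasserstein p μ (μ.map Q.round) ≤ ρ := wasserstein_map_le hp0 μ hr
  have hdev : wasserstein p (μn.map Q.round) (μ.map Q.round) ≤ D ^ (1 / p) := by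
    refine rpow_one_div_le_of_le_rpow hp0 ?_
    rw [wasserstein_comm hp0]
    refine (Q.wasserstein_map_round_le hp μ μn).trans ?_
    rw [hD]
    gcongr
    exact Q.deviation_mono _ _ fun c => le_self_add
  have hW : wasserstein p (μn.map Q.round) νn ≤
      D ^ (1 / p) + (ρ + (wasserstein p μ ν + wasserstein p νn ν)) := by
    refine (wasserstein_triangle hp _ (μ.map Q.round) _).trans (add_le_add hdev ?_)
    refine (wasserstein_triangle hp _ μ _).trans (add_le_add ?_ ?_)
    · rwa [wasserstein_comm hp0]
    · refine (wasserstein_triangle hp _ ν _).trans (add_le_add le_rfl ?_)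
      rw [wasserstein_comm hp0]
  have hgap : (kernelCost p (κ₀.comap Q.round Q.measurable_round) μ) ^ (1 / p) ≤
      (2 * ρ + ENNReal.ofReal δ ^ (1 / p) + 2 * D ^ (1 / p) + wasserstein p νn ν) +
        wasserstein p μ ν := by
    calc _ ≤ ρ + (kernelCost p κ₀ (μ.map Q.round)) ^ (1 / p) :=
          kernelCost_comap_round_le hp Q κ₀ μ
      _ ≤ ρ + ((wasserstein p (μn.map Q.round) νn ^ p + ENNReal.ofReal δ) + D) ^ (1 / p) := by
          gcongr
          exact hcost.trans (add_le_add h₀.nearOptimal le_rfl)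
      _ ≤ ρ + ((wasserstein p (μn.map Q.round) νn ^ p) ^ (1 / p) +
            ENNReal.ofReal δ ^ (1 / p) + D ^ (1 / p)) := by
          gcongr
          exact (add_rpow_one_div_le hp _ _).trans
            (add_le_add (add_rpow_one_div_le hp _ _) le_rfl)
      _ ≤ ρ + ((D ^ (1 / p) + (ρ + (wasserstein p μ ν + wasserstein p νn ν))) +
            ENNReal.ofReal δ ^ (1 / p) + D ^ (1 / p)) := by
          rw [rpow_rpow_one_div hp0]
          gcongr
      _ = _ := by ring
  calc transportError p (κ₀.comap Q.round Q.measurable_round) μ ν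
      ≤ (2 * ρ + ENNReal.ofReal δ ^ (1 / p) + 2 * D ^ (1 / p) + wasserstein p νn ν) +
        (D ^ (1 / p) + wasserstein p νn ν) := by
        rw [transportError, comap_round_comp]
        refine add_le_add (tsub_le_iff_right.2 hgap) ?_
        exact (wasserstein_triangle hp _ νn _).trans (add_le_add hfeas le_rfl)
    _ = _ := by ring

/-- The distance of a measure from its empirical version, by rounding both. -/
theorem wasserstein_empirical_le (hp : 1 ≤ p) (hn : n ≠ 0) (Q : CenteredPartition d)
    (ν : Measure (E d)) [IsProbabilityMeasure ν] (y : Fin n → E d) :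
    wasserstein p (empirical y) ν ≤
      (∫⁻ x, ‖x - Q.round x‖ₑ ^ p ∂(empirical y)) ^ (1 / p) +
      (∫⁻ x, ‖x - Q.round x‖ₑ ^ p ∂ν) ^ (1 / p) +
      (2 ^ (p - 1) * Q.deviation ν (empirical y) fun c => ‖c‖ₑ ^ p) ^ (1 / p) := by
  have hp0 : 0 < p := by linarith
  have := isProbabilityMeasure_empirical hn y
  have hr := Q.measurable_round
  have : IsProbabilityMeasure (ν.map Q.round) := Measure.isProbabilityMeasure_map hr.aemeasurable
  have : IsProbabilityMeasure ((empirical y).map Q.round) :=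
    Measure.isProbabilityMeasure_map hr.aemeasurable
  refine (wasserstein_triangle hp _ ((empirical y).map Q.round) _).trans ?_
  rw [add_assoc]
  refine add_le_add (wasserstein_map_le hp0 _ hr) ?_
  refine (wasserstein_triangle hp _ (ν.map Q.round) _).trans ?_
  rw [add_comm]
  refine add_le_add ?_ ?_
  · rw [wasserstein_comm hp0]
    exact wasserstein_map_le hp0 _ hr
  · rw [wasserstein_comm hp0]
    exact rpow_one_div_le_of_le_rpow hp0 (Q.wasserstein_map_round_le hp ν _)

end deterministic

end

section

/-! ### The expected deviation of an empirical measure -/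

/-- Jensen's inequality for the `p`-th root. -/
theorem lintegral_rpow_one_div_le {Ω : Type*} [MeasurableSpace Ω] (P : Measure Ω)
    [IsProbabilityMeasure P] {f : Ω → ℝ≥0∞} (hf : Measurable f) {p : ℝ} (hp : 1 ≤ p) :
    ∫⁻ ω, f ω ^ (1 / p) ∂P ≤ (∫⁻ ω, f ω ∂P) ^ (1 / p) := by
  have hp0 : 0 < p := by linarith
  have h := eLpNorm'_le_eLpNorm'_of_exponent_le zero_lt_one hp P
    (hf.pow_const (1 / p)).aestronglyMeasurable
  have e : ∀ ω, (f ω ^ (1 / p)) ^ p = f ω := fun ω => by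
    rw [← ENNReal.rpow_mul, one_div_mul_cancel hp0.ne', ENNReal.rpow_one]
  simpa only [eLpNorm', enorm_eq_self, ENNReal.rpow_one, div_one, e] using h

theorem tsub_add_tsub_eq_enorm {a b : ℝ} (ha : 0 ≤ a) (hb : 0 ≤ b) :
    (ENNReal.ofReal a - ENNReal.ofReal b) + (ENNReal.ofReal b - ENNReal.ofReal a) =
      ‖b - a‖ₑ := by
  rw [← ENNReal.ofReal_sub _ hb, ← ENNReal.ofReal_sub _ ha]
  rcases le_total a b with h | h
  · rw [ENNReal.ofReal_of_nonpos (by linarith : a - b ≤ 0), zero_add,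
      Real.enorm_eq_ofReal (by linarith)]
  · rw [ENNReal.ofReal_of_nonpos (by linarith : b - a ≤ 0), add_zero, ← enorm_neg, neg_sub,
      Real.enorm_eq_ofReal (by linarith)]

section sample

variable {Ω : Type u} [MeasurableSpace Ω] {P : Measure Ω} {d n : ℕ}
  {X : Fin n → Ω → E d} {μ : Measure (E d)}

theorem lintegral_empirical (x : Fin n → E d) (f : E d → ℝ≥0∞) :
    ∫⁻ z, f z ∂(empirical x) = (n : ℝ≥0∞)⁻¹ * ∑ i, f (x i) := by
  simp [empirical]

theorem empirical_apply_eq_ofReal (x : Fin n → E d) {A : Set (E d)} (hA : MeasurableSet A) :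
    empirical x A = ENNReal.ofReal ((n : ℝ)⁻¹ * ∑ i, A.indicator 1 (x i)) := by
  rcases eq_or_ne n 0 with rfl | hn
  · simp [empirical]
  have h : ∀ i, (0 : ℝ) ≤ A.indicator 1 (x i) := fun i => Set.indicator_nonneg (by simp) _
  rw [ENNReal.ofReal_mul (by positivity), ENNReal.ofReal_inv_of_pos (by positivity),
    ENNReal.ofReal_natCast, ENNReal.ofReal_sum_of_nonneg fun i _ => h i]
  simp only [empirical, Measure.smul_apply, Measure.finsetSum_apply, Measure.dirac_apply' _ hA,
    smul_eq_mul]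
  congr 1
  refine Finset.sum_congr rfl fun i _ => ?_
  by_cases hi : x i ∈ A <;> simp [hi]

theorem IsIIDSample.measurable_empirical (hX : IsIIDSample X μ P) {A : Set (E d)}
    (hA : MeasurableSet A) : Measurable fun ω => empirical (fun i => X i ω) A := by
  have := hX.measurable
  simp only [empirical, Measure.smul_apply, Measure.finsetSum_apply, Measure.dirac_apply' _ hA,
    smul_eq_mul]
  refine Measurable.const_mul (Finset.measurable_fun_sum _ fun i _ => ?_) _
  exact (measurable_one.indicator hA).comp (this i)

theorem IsIIDSample.measurable_abs_sub (hX : IsIIDSample X μ P) {A : Set (E d)}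
    (hA : MeasurableSet A) : Measurable fun ω =>
      (μ A - empirical (fun i => X i ω) A) + (empirical (fun i => X i ω) A - μ A) := by
  have := hX.measurable_empirical hA
  fun_prop

theorem IsIIDSample.lintegral_comp (hX : IsIIDSample X μ P) {f : E d → ℝ≥0∞}
    (hf : Measurable f) (i : Fin n) : ∫⁻ ω, f (X i ω) ∂P = ∫⁻ x, f x ∂μ := by
  rw [← hX.map_eq i, lintegral_map hf (hX.measurable i)]

theorem IsIIDSample.lintegral_empirical_apply (hn : n ≠ 0) (hX : IsIIDSample X μ P)
    {A : Set (E d)} (hA : MeasurableSet A) :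
    ∫⁻ ω, empirical (fun i => X i ω) A ∂P = μ A := by
  simp only [empirical, Measure.smul_apply, Measure.finsetSum_apply, Measure.dirac_apply' _ hA,
    smul_eq_mul]
  have hm : ∀ i, Measurable fun ω => (A.indicator 1 (X i ω) : ℝ≥0∞) := fun i =>
    (measurable_one.indicator hA).comp (hX.measurable i)
  rw [lintegral_const_mul _ (Finset.measurable_fun_sum _ fun i _ => hm i),
    lintegral_finsetSum _ fun i _ => hm i]
  have : ∀ i, ∫⁻ ω, (A.indicator 1 (X i ω) : ℝ≥0∞) ∂P = μ A := fun i => by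
    rw [hX.lintegral_comp (f := A.indicator 1) (measurable_one.indicator hA) i,
      lintegral_indicator_one hA]
  simp only [this, Finset.sum_const, Finset.card_univ, Fintype.card_fin, nsmul_eq_mul]
  rw [← mul_assoc, ENNReal.inv_mul_cancel (by simpa using hn) (by simp), one_mul]

/-- The mean absolute deviation of an empirical frequency is at most its standard deviation. -/
theorem IsIIDSample.lintegral_deviation_le_sqrt [IsProbabilityMeasure P]
    (hn : n ≠ 0) (hX : IsIIDSample X μ P)
    [IsProbabilityMeasure μ] {A : Set (E d)} (hA : MeasurableSet A) :
    ∫⁻ ω, ((μ A - empirical (fun i => X i ω) A) + (empirical (fun i => X i ω) A - μ A)) ∂P ≤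
      (μ A / n) ^ (1 / 2 : ℝ) := by
  have hn0 : (0 : ℝ) < n := by positivity
  set f : Fin n → Ω → ℝ := fun i => A.indicator 1 ∘ X i with hf
  have hind : Measurable (A.indicator 1 : E d → ℝ) := measurable_one.indicator hA
  have hfm : ∀ i, Measurable (f i) := fun i => hind.comp (hX.measurable i)
  have hfb : ∀ i ω, ‖f i ω‖ ≤ 1 := fun i ω => by
    by_cases h : X i ω ∈ A <;> simp [f, h]
  have hL : ∀ i, MemLp (f i) 2 P := fun i =>
    MemLp.of_bound (hfm i).aestronglyMeasurable 1 (ae_of_all _ (hfb i))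
  have hE : ∀ i, ∫ ω, f i ω ∂P = μ.real A := fun i => by
    have := integral_map (μ := P) (φ := X i) (hX.measurable i).aemeasurable
      (f := (A.indicator 1 : E d → ℝ)) hind.aestronglyMeasurable
    rw [hX.map_eq, integral_indicator_one hA] at this
    exact this.symm
  have hind2 : iIndepFun f P := hX.indep.comp (fun _ => A.indicator 1) fun _ => hind
  have hV : ∀ i, Var[f i; P] ≤ μ.real A := fun i => by
    refine (variance_le_expectation_sq (hfm i).aestronglyMeasurable).trans_eq ?_
    rw [← hE i]
    refine integral_congr_ae (ae_of_all _ fun ω => ?_)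
    by_cases h : X i ω ∈ A <;> simp [f, h]
  set S : Ω → ℝ := fun ω => (n : ℝ)⁻¹ * (∑ i, f i) ω with hS
  have hSL : MemLp S 2 P := (memLp_finsetSum' _ fun i _ => hL i).const_mul _
  have hSm : Measurable S := by
    simp only [S, Finset.sum_apply]
    exact (Finset.measurable_fun_sum _ fun i _ => hfm i).const_mul _
  have hSE : ∫ ω, S ω ∂P = μ.real A := by
    simp only [S, integral_const_mul, Finset.sum_apply]
    rw [integral_finsetSum _ fun i _ => (hL i).integrable (by norm_num)]
    simp only [hE, Finset.sum_const, Finset.card_univ, Fintype.card_fin, nsmul_eq_mul]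
    field_simp
  have hSV : Var[S; P] ≤ μ.real A / n := by
    rw [hS, variance_const_mul, IndepFun.variance_sum (fun i _ => hL i)
      fun i _ j _ hij => hind2.indepFun hij]
    calc (n : ℝ)⁻¹ ^ 2 * ∑ i, Var[f i; P] ≤ (n : ℝ)⁻¹ ^ 2 * ∑ _i : Fin n, μ.real A := by
          gcongr with i
          exact hV i
      _ = μ.real A / n := by
          simp only [Finset.sum_const, Finset.card_univ, Fintype.card_fin, nsmul_eq_mul]
          field_simp
  have hint : ∀ ω, (μ A - empirical (fun i => X i ω) A) +
      (empirical (fun i => X i ω) A - μ A) = ‖S ω - ∫ ω, S ω ∂P‖ₑ := fun ω => by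
    have e : empirical (fun i => X i ω) A = ENNReal.ofReal (S ω) := by
      rw [empirical_apply_eq_ofReal _ hA]
      simp [S, f]
    rw [e, ← ofReal_measureReal (measure_ne_top μ A), hSE]
    refine tsub_add_tsub_eq_enorm measureReal_nonneg ?_
    refine mul_nonneg (by positivity) ?_
    rw [Finset.sum_apply]
    exact Finset.sum_nonneg fun i _ => Set.indicator_nonneg (by simp) _
  simp only [hint]
  calc ∫⁻ ω, ‖S ω - ∫ ω, S ω ∂P‖ₑ ∂P
      = ∫⁻ ω, (‖S ω - ∫ ω, S ω ∂P‖ₑ ^ 2) ^ (1 / 2 : ℝ) ∂P := by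
        refine lintegral_congr fun ω => ?_
        rw [← ENNReal.rpow_natCast, ← ENNReal.rpow_mul]
        norm_num
    _ ≤ (∫⁻ ω, ‖S ω - ∫ ω, S ω ∂P‖ₑ ^ 2 ∂P) ^ (1 / 2 : ℝ) :=
        lintegral_rpow_one_div_le P (by fun_prop) (by norm_num)
    _ = (ENNReal.ofReal Var[S; P]) ^ (1 / 2 : ℝ) := by rw [hSL.ofReal_variance_eq]; rfl
    _ ≤ (ENNReal.ofReal (μ.real A / n)) ^ (1 / 2 : ℝ) := by gcongr
    _ = (μ A / n) ^ (1 / 2 : ℝ) := by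
        rw [ENNReal.ofReal_div_of_pos hn0, ofReal_measureReal (measure_ne_top μ A),
          ENNReal.ofReal_natCast]

theorem IsIIDSample.lintegral_deviation_le_two_mul [IsProbabilityMeasure P]
    (hn : n ≠ 0) (hX : IsIIDSample X μ P)
    {A : Set (E d)} (hA : MeasurableSet A) :
    ∫⁻ ω, ((μ A - empirical (fun i => X i ω) A) + (empirical (fun i => X i ω) A - μ A)) ∂P ≤
      2 * μ A := by
  calc _ ≤ ∫⁻ ω, (μ A + empirical (fun i => X i ω) A) ∂P := by
        gcongr <;> exact tsub_le_self
    _ = 2 * μ A := by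
        rw [lintegral_add_left measurable_const, lintegral_const, measure_univ, mul_one,
          hX.lintegral_empirical_apply hn hA, two_mul]

theorem IsIIDSample.measurable_deviation (hX : IsIIDSample X μ P) (Q : CenteredPartition d)
    (w : E d → ℝ≥0∞) : Measurable fun ω => Q.deviation μ (empirical fun i => X i ω) w := by
  refine Measurable.tsum fun C => ?_
  exact (hX.measurable_abs_sub (Q.measurableSet C C.2)).mul_const _

/-- The expected weighted deviation over a partition. The finitely many cells in `F` are treated
by the Cauchy-Schwarz inequality, the others, which lie outside the ball of radius `R`, by the
tail of `μ`. -/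
theorem IsIIDSample.lintegral_partition_deviation_le [IsProbabilityMeasure P]
    (hn : n ≠ 0) (hX : IsIIDSample X μ P)
    [IsProbabilityMeasure μ] (Q : CenteredPartition d) {w : E d → ℝ≥0∞}
    (hw : Measurable w) (F : Finset Q.cells) {R : ℝ}
    (hF : ∀ C : Q.cells, C ∉ F → ∀ x ∈ (C : Set (E d)), R < ‖x‖) :
    ∫⁻ ω, Q.deviation μ (empirical fun i => X i ω) w ∂P ≤
      (F.card / n * ∫⁻ x, w (Q.round x) ^ 2 ∂μ) ^ (1 / 2 : ℝ) +
        2 * ∫⁻ x in {x | R < ‖x‖}, w (Q.round x) ∂μ := by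
  classical
  have hwr : Measurable fun x => w (Q.round x) := hw.comp Q.measurable_round
  have hRm : MeasurableSet {x : E d | R < ‖x‖} := measurableSet_lt measurable_const measurable_norm
  have hterm : ∀ C : Q.cells,
      ∫⁻ ω, ((μ C - empirical (fun i => X i ω) C) + (empirical (fun i => X i ω) C - μ C)) *
        w (Q.center C) ∂P ≤
      (if C ∈ F then (μ C / n) ^ (1 / 2 : ℝ) * w (Q.center C) else 0) +
        2 * ∫⁻ x in C, {x | R < ‖x‖}.indicator (fun x => w (Q.round x)) x ∂μ := by
    intro C
    have hC := Q.measurableSet C C.2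
    rw [lintegral_mul_const _ (hX.measurable_abs_sub hC)]
    by_cases hCF : C ∈ F
    · rw [if_pos hCF]
      exact (mul_le_mul_left (hX.lintegral_deviation_le_sqrt hn hC) _).trans le_self_add
    · rw [if_neg hCF, zero_add]
      refine (mul_le_mul_left (hX.lintegral_deviation_le_two_mul hn hC) _).trans_eq ?_
      rw [mul_assoc, ← Q.setLIntegral_comp_round μ w C]
      congr 1
      refine setLIntegral_congr_fun hC fun x hx => ?_
      exact (Set.indicator_of_mem (s := {x : E d | R < ‖x‖}) (hF C hCF x hx)
        (fun x => w (Q.round x))).symm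
  have hsum : ∑' C : Q.cells, (if C ∈ F then (μ C / n) ^ (1 / 2 : ℝ) * w (Q.center C) else 0) ≤
      (F.card / n * ∫⁻ x, w (Q.round x) ^ 2 ∂μ) ^ (1 / 2 : ℝ) := by
    rw [tsum_eq_sum (s := F) fun C hC => if_neg hC]
    have e₁ : ∀ C ∈ F, (if C ∈ F then (μ C / n) ^ (1 / 2 : ℝ) * w (Q.center C) else 0) =
        ((n : ℝ≥0∞)⁻¹) ^ (1 / 2 : ℝ) * ((μ C) ^ (1 / 2 : ℝ) * w (Q.center C)) := by
      intro C hC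
      rw [if_pos hC, ENNReal.div_eq_inv_mul, ENNReal.mul_rpow_of_nonneg _ _ (by norm_num),
        mul_assoc]
    rw [Finset.sum_congr rfl e₁]
    refine (ENNReal.inner_le_Lp_mul_Lq F _ _ Real.HolderConjugate.two_two).trans ?_
    rw [← ENNReal.mul_rpow_of_nonneg _ _ (by norm_num)]
    refine ENNReal.rpow_le_rpow ?_ (by norm_num)
    refine mul_le_mul' ?_ ?_
    · simp only [Finset.sum_const, nsmul_eq_mul]
      rw [← ENNReal.rpow_mul]
      norm_num [div_eq_mul_inv]
    · calc ∑ C ∈ F, ((μ C) ^ (1 / 2 : ℝ) * w (Q.center C)) ^ (2 : ℝ)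
          = ∑ C ∈ F, μ C * w (Q.center C) ^ 2 := by
            refine Finset.sum_congr rfl fun C _ => ?_
            rw [ENNReal.mul_rpow_of_nonneg _ _ (by norm_num), ← ENNReal.rpow_mul]
            norm_num
        _ ≤ ∑' C : Q.cells, μ C * w (Q.center C) ^ 2 := ENNReal.sum_le_tsum F
        _ = ∫⁻ x, w (Q.round x) ^ 2 ∂μ :=
            (Q.lintegral_comp_round μ fun c => w c ^ 2).symm
  simp only [CenteredPartition.deviation]
  rw [lintegral_tsum]
  · refine (ENNReal.tsum_le_tsum hterm).trans ?_
    rw [ENNReal.tsum_add, ENNReal.tsum_mul_left, ← Q.lintegral_eq_tsum μ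
      fun x => {x | R < ‖x‖}.indicator (fun x => w (Q.round x)) x, lintegral_indicator hRm]
    gcongr
  · intro C
    exact ((hX.measurable_abs_sub (Q.measurableSet C C.2)).mul_const _).aemeasurable

end sample

theorem CenteredPartition.deviation_add_const_le {d : ℕ} (Q : CenteredPartition d)
    (μ μ' : Measure (E d)) [IsProbabilityMeasure μ] [IsProbabilityMeasure μ'] (w : E d → ℝ≥0∞)
    (m : ℝ≥0∞) : Q.deviation μ μ' (fun c => w c + m) ≤ Q.deviation μ μ' w + 2 * m := by
  simp only [deviation, mul_add]
  rw [ENNReal.tsum_add, ENNReal.tsum_mul_right]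
  gcongr
  have h : ∀ μ : Measure (E d), IsProbabilityMeasure μ → ∑' C : Q.cells, μ C = 1 := by
    intro μ _
    have := Q.lintegral_comp_round μ fun _ => 1
    simpa using this.symm
  calc ∑' C : Q.cells, ((μ C - μ' C) + (μ' C - μ C)) ≤ ∑' C : Q.cells, (μ C + μ' C) := by
        gcongr <;> exact tsub_le_self
    _ = 2 := by rw [ENNReal.tsum_add, h μ inferInstance, h μ' inferInstance]; norm_num

end

section

/-! ### Grid partitions -/

variable {d : ℕ}

/-- The position of `x` in the grid with step `r` on the scale `g`. -/
noncomputable def gridIndex (g : ℝ → ℝ) (r : ℝ) (x : E d) : Fin d → ℤ := fun i => ⌊g (x i) / r⌋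

/-- The cells of the grid with step `r` on the scale `g`: the scale is `id` for cubes, and
`truncScale T` for boxes whose size grows with the coordinates. -/
def gridCells (d : ℕ) (g : ℝ → ℝ) (r : ℝ) : Set (Set (E d)) :=
  Set.range fun k : Fin d → ℤ => {x : E d | gridIndex g r x = k}

theorem cubeCells_eq_gridCells {r : ℝ} (hr : 0 < r) : cubeCells d r = gridCells d id r := by
  refine congrArg Set.range (funext fun k => ?_)
  ext x
  simp only [Set.mem_ofPred_eq, gridIndex, funext_iff, id, Int.floor_eq_iff]
  refine forall_congr' fun i => ?_
  rw [le_div_iff₀ hr, div_lt_iff₀ hr, mul_comm r, mul_comm r]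

theorem measurable_gridIndex {g : ℝ → ℝ} (hg : Measurable g) (r : ℝ) :
    Measurable (gridIndex g r : E d → Fin d → ℤ) := by
  unfold gridIndex
  fun_prop

/-- Rounding to the lower corner of the grid cell; `h` is the inverse of the scale `g`. -/
noncomputable def gridCorner (g h : ℝ → ℝ) (r : ℝ) (x : E d) : E d :=
  WithLp.toLp 2 fun i => h (r * gridIndex g r x i)

theorem gridIndex_corner {g h : ℝ → ℝ} (hgh : ∀ u, g (h u) = u) {r : ℝ} (hr : 0 < r)
    (k : Fin d → ℤ) : gridIndex g r (WithLp.toLp 2 fun i => h (r * k i) : E d) = k := by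
  funext i
  simp [gridIndex, hgh, hr.ne']

open Classical in
/-- The grid partition with the lower corners as centers. -/
noncomputable def gridPartition (d : ℕ) {g h : ℝ → ℝ} (hg : Measurable g)
    (hgh : ∀ u, g (h u) = u) {r : ℝ} (hr : 0 < r) : CenteredPartition d where
  cells := gridCells d g r
  isPartition := by
    refine ⟨?_, fun x => ⟨{z | gridIndex g r z = gridIndex g r x}, ⟨⟨_, rfl⟩, rfl⟩, ?_⟩⟩
    · rintro ⟨k, hk⟩
      exact (Set.ext_iff.1 hk _).1 (gridIndex_corner hgh hr k)
    · rintro _ ⟨⟨k, rfl⟩, hx⟩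
      rw [show gridIndex g r x = k from hx]
  countable := Set.countable_range _
  measurableSet := by
    rintro _ ⟨k, rfl⟩
    exact measurable_gridIndex hg r (measurableSet_singleton k)
  center := fun C => if hC : C.Nonempty then gridCorner g h r hC.some else 0
  center_mem := by
    rintro _ ⟨k, rfl⟩
    have hC : {x : E d | gridIndex g r x = k}.Nonempty := ⟨_, gridIndex_corner hgh hr k⟩
    rw [dif_pos hC]
    exact (gridIndex_corner hgh hr _).trans hC.some_mem

theorem gridPartition_round {g h : ℝ → ℝ} (hg : Measurable g) (hgh : ∀ u, g (h u) = u) {r : ℝ}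
    (hr : 0 < r) (x : E d) : (gridPartition d hg hgh hr).round x = gridCorner g h r x := by
  have hC : ({z : E d | gridIndex g r z = gridIndex g r x}).Nonempty := ⟨x, rfl⟩
  have hmem : {z : E d | gridIndex g r z = gridIndex g r x} ∈
      (gridPartition d hg hgh hr).cells := ⟨_, rfl⟩
  rw [CenteredPartition.round_eq_center _ hmem rfl]
  have h₁ : (gridPartition d hg hgh hr).center {z | gridIndex g r z = gridIndex g r x} =
      gridCorner g h r hC.some := dif_pos hC
  rw [h₁, gridCorner, gridCorner, show gridIndex g r hC.some = gridIndex g r x from hC.some_mem]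

theorem gridIndex_round {g : ℝ → ℝ} {r : ℝ} {Q : CenteredPartition d}
    (hQ : Q.cells = gridCells d g r) (x : E d) :
    gridIndex g r (Q.round x) = gridIndex g r x := by
  obtain ⟨k, hk⟩ : Q.cellOf x ∈ gridCells d g r := hQ ▸ Q.cellOf_mem x
  have h₁ : x ∈ {z : E d | gridIndex g r z = k} := by
    simp only at hk; rw [hk]; exact Q.mem_cellOf x
  have h₂ : Q.round x ∈ {z : E d | gridIndex g r z = k} := by
    simp only at hk; rw [hk]; exact Q.round_mem_cellOf x
  exact Eq.trans h₂ (Eq.symm h₁)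

theorem abs_scale_round_sub_le {g : ℝ → ℝ} {r : ℝ} (hr : 0 < r) {Q : CenteredPartition d}
    (hQ : Q.cells = gridCells d g r) (x : E d) (i : Fin d) :
    |g (x i) - g (Q.round x i)| ≤ r := by
  have h := congrFun (gridIndex_round hQ x) i
  have := Int.abs_sub_lt_one_of_floor_eq_floor h.symm
  rw [← sub_div, abs_div, abs_of_pos hr, div_lt_one hr] at this
  exact this.le

/-- At most `(2 m + 1) ^ d` grid cells meet a set on which the scaled coordinates are bounded by
`r m`. -/
theorem exists_finset_cells {g : ℝ → ℝ} {r : ℝ} (hr : 0 < r) {Q : CenteredPartition d}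
    (hQ : Q.cells = gridCells d g r) (m : ℕ) {S : Set (E d)}
    (hS : ∀ x ∈ S, ∀ i, |g (x i)| ≤ r * m) :
    ∃ F : Finset Q.cells, F.card ≤ (2 * m + 1) ^ d ∧
      ∀ C : Q.cells, C ∉ F → ∀ x ∈ (C : Set (E d)), x ∉ S := by
  classical
  set B : Finset (Fin d → ℤ) := Fintype.piFinset fun _ => Finset.Icc (-(m : ℤ)) m with hB
  refine ⟨B.image fun k => ⟨{x | gridIndex g r x = k}, hQ ▸ ⟨k, rfl⟩⟩, ?_, ?_⟩
  · refine Finset.card_image_le.trans_eq ?_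
    rw [hB, Fintype.card_piFinset]
    simp only [Int.card_Icc, Finset.prod_const, Finset.card_univ, Fintype.card_fin]
    congr 1
    omega
  · intro C hC x hx hxS
    refine hC (Finset.mem_image.2 ⟨gridIndex g r x, ?_, ?_⟩)
    · refine Fintype.mem_piFinset.2 fun i => Finset.mem_Icc.2 ?_
      have h := abs_le.1 (hS x hxS i)
      have h' : -(m : ℝ) ≤ g (x i) / r ∧ g (x i) / r ≤ m :=
        ⟨by rw [le_div_iff₀ hr]; linarith [h.1], by rw [div_le_iff₀ hr]; linarith [h.2]⟩
      refine ⟨?_, ?_⟩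
      · rw [gridIndex, Int.le_floor]; push_cast; exact h'.1
      · rw [gridIndex, Int.floor_le_iff]; push_cast; linarith [h'.2]
    · refine Subtype.ext ?_
      obtain ⟨k, hk⟩ : (C : Set (E d)) ∈ gridCells d g r := hQ ▸ C.2
      have h₁ : x ∈ {z : E d | gridIndex g r z = k} := by
        simp only at hk; rw [hk]; exact hx
      simp only at hk ⊢
      rw [← hk, show gridIndex g r x = k from h₁]

theorem norm_le_mul_of_abs_le (x : E d) {a : ℝ} (ha : 0 ≤ a) (h : ∀ i, |x i| ≤ a) :
    ‖x‖ ≤ d * a := by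
  rw [EuclideanSpace.norm_eq]
  refine Real.sqrt_le_iff.2 ⟨by positivity, ?_⟩
  calc ∑ i, ‖x i‖ ^ 2 ≤ ∑ _i : Fin d, a ^ 2 := by
        gcongr with i
        exact h i
    _ = d * a ^ 2 := by simp
    _ ≤ (d : ℝ) ^ 2 * a ^ 2 := by
        gcongr
        exact_mod_cast Nat.le_self_pow two_ne_zero d
    _ = (d * a) ^ 2 := by ring

theorem abs_apply_le_norm (x : E d) (i : Fin d) : |x i| ≤ ‖x‖ := PiLp.norm_apply_le x i

theorem norm_sub_round_le_of_cubes {r : ℝ} (hr : 0 < r) {Q : CenteredPartition d}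
    (hQ : Q.cells = cubeCells d r) (x : E d) : ‖x - Q.round x‖ ≤ d * r := by
  rw [cubeCells_eq_gridCells hr] at hQ
  exact norm_le_mul_of_abs_le _ hr.le fun i => abs_scale_round_sub_le hr hQ x i

theorem abs_sinh_sub_sinh_le {u v r : ℝ} (h : |u - v| ≤ r) (hr : r ≤ 1) :
    |Real.sinh u - Real.sinh v| ≤ 2 * r * (1 + |Real.sinh u|) := by
  have h₁ : |Real.exp u - Real.exp v| ≤ 2 * r * Real.exp u := by
    have e : Real.exp u - Real.exp v = -(Real.exp u * (Real.exp (v - u) - 1)) := by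
      rw [mul_sub, ← Real.exp_add]; ring_nf
    rw [e, abs_neg, abs_mul, abs_of_pos (Real.exp_pos u), mul_comm (2 * r)]
    gcongr
    have := Real.abs_exp_sub_one_le (x := v - u) (by rw [abs_sub_comm]; linarith)
    rw [abs_sub_comm v u] at this
    linarith
  have h₂ : |Real.exp (-u) - Real.exp (-v)| ≤ 2 * r * Real.exp (-u) := by
    have e : Real.exp (-u) - Real.exp (-v) = -(Real.exp (-u) * (Real.exp (u - v) - 1)) := by
      rw [mul_sub, ← Real.exp_add]; ring_nf
    rw [e, abs_neg, abs_mul, abs_of_pos (Real.exp_pos _), mul_comm (2 * r)]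
    gcongr
    have := Real.abs_exp_sub_one_le (x := u - v) (by linarith)
    linarith
  have h₃ : Real.cosh u ≤ 1 + |Real.sinh u| := by
    have := Real.cosh_sq u
    nlinarith [sq_abs (Real.sinh u), abs_nonneg (Real.sinh u), Real.cosh_pos u]
  have hr0 : 0 ≤ r := (abs_nonneg _).trans h
  calc |Real.sinh u - Real.sinh v|
      = |(Real.exp u - Real.exp v) - (Real.exp (-u) - Real.exp (-v))| / 2 := by
        rw [Real.sinh_eq, Real.sinh_eq, ← abs_two (α := ℝ), ← abs_div, abs_two]
        ring_nf
    _ ≤ (2 * r * Real.exp u + 2 * r * Real.exp (-u)) / 2 := by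
        gcongr
        exact (abs_sub _ _).trans (add_le_add h₁ h₂)
    _ = 2 * r * Real.cosh u := by rw [Real.cosh_eq]; ring
    _ ≤ _ := by gcongr

/-- The point of `[-a, a]` closest to `t`. -/
noncomputable def clamp (a t : ℝ) : ℝ := max (-a) (min a t)

theorem clamp_cases {a : ℝ} (ha : 0 ≤ a) (t : ℝ) :
    (t < -a ∧ clamp a t = -a) ∨ (-a ≤ t ∧ t ≤ a ∧ clamp a t = t) ∨ (a < t ∧ clamp a t = a) := by
  unfold clamp
  rcases lt_or_ge t (-a) with h | h
  · left
    rw [min_eq_right (by linarith), max_eq_left h.le]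
    exact ⟨h, rfl⟩
  · rcases le_or_gt t a with h' | h'
    · right; left
      rw [min_eq_right h', max_eq_right h]
      exact ⟨h, h', rfl⟩
    · right; right
      rw [min_eq_left h'.le, max_eq_right (by linarith)]
      exact ⟨h', rfl⟩

theorem clamp_of_abs_le {a t : ℝ} (h : |t| ≤ a) : clamp a t = t := by
  obtain ⟨h₁, h₂⟩ := abs_le.1 h
  rw [clamp, min_eq_right h₂, max_eq_right h₁]

theorem abs_clamp_le {a : ℝ} (ha : 0 ≤ a) (t : ℝ) : |clamp a t| ≤ a := by
  rcases clamp_cases ha t with ⟨_, h⟩ | ⟨h₁, h₂, h⟩ | ⟨_, h⟩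
  · rw [h, abs_neg, abs_of_nonneg ha]
  · rw [h]; exact abs_le.2 ⟨h₁, h₂⟩
  · rw [h, abs_of_nonneg ha]

/-- Clamping and its remainder are both contractions. -/
theorem abs_clamp_sub_le {a : ℝ} (ha : 0 ≤ a) (u v : ℝ) :
    |clamp a u - clamp a v| ≤ |u - v| ∧
      |(u - clamp a u) - (v - clamp a v)| ≤ |u - v| := by
  constructor <;> rcases clamp_cases ha u with ⟨_, h⟩ | ⟨_, _, h⟩ | ⟨_, h⟩ <;>
    rcases clamp_cases ha v with ⟨_, h'⟩ | ⟨_, _, h'⟩ | ⟨_, h'⟩ <;>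
    rw [h, h'] <;> rw [abs_le] <;> constructor <;>
    cases abs_cases (u - v) <;> linarith

/-- A scale that is logarithmic on `[-T, T]` and linear outside: the cells of the grid grow with
the coordinates up to a bounded size. -/
noncomputable def truncScale (T t : ℝ) : ℝ := Real.arsinh (clamp T t) + (t - clamp T t) / T

/-- The inverse of `truncScale`. -/
noncomputable def truncScaleInv (T u : ℝ) : ℝ :=
  Real.sinh (clamp (Real.arsinh T) u) + T * (u - clamp (Real.arsinh T) u)

theorem measurable_truncScale (T : ℝ) : Measurable (truncScale T) := by
  unfold truncScale clamp
  have := Real.continuous_arsinh.measurable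
  fun_prop

section truncScale

variable {T : ℝ}

theorem truncScale_inv (hT : 0 < T) (u : ℝ) : truncScale T (truncScaleInv T u) = u := by
  have hS : 0 ≤ Real.arsinh T := Real.arsinh_nonneg_iff.2 hT.le
  unfold truncScale truncScaleInv
  rcases clamp_cases hS u with ⟨h₁, h⟩ | ⟨h₁, h₂, h⟩ | ⟨h₁, h⟩
  · rw [h, Real.sinh_neg, Real.sinh_arsinh]
    have hlt : -T + T * (u - -Real.arsinh T) < -T := by nlinarith
    rcases clamp_cases hT.le (-T + T * (u - -Real.arsinh T)) with ⟨_, h'⟩ | ⟨_, _, _⟩ | ⟨_, _⟩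
    · rw [h', Real.arsinh_neg]; field_simp; ring
    · linarith
    · linarith
  · rw [h, sub_self, mul_zero, add_zero]
    have h₃ : |Real.sinh u| ≤ T := by
      rw [abs_le, ← Real.sinh_arsinh T, ← Real.sinh_neg, Real.sinh_le_sinh, Real.sinh_le_sinh]
      exact ⟨h₁, h₂⟩
    rw [clamp_of_abs_le h₃, Real.arsinh_sinh]
    simp
  · rw [h, Real.sinh_arsinh]
    have hlt : T < T + T * (u - Real.arsinh T) := by nlinarith
    rcases clamp_cases hT.le (T + T * (u - Real.arsinh T)) with ⟨_, _⟩ | ⟨_, _, _⟩ | ⟨_, h'⟩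
    · linarith
    · linarith
    · rw [h']; field_simp; ring

theorem truncScaleInv_scale (hT : 0 < T) (t : ℝ) : truncScaleInv T (truncScale T t) = t := by
  have hS : 0 ≤ Real.arsinh T := Real.arsinh_nonneg_iff.2 hT.le
  unfold truncScale truncScaleInv
  rcases clamp_cases hT.le t with ⟨h₁, h⟩ | ⟨h₁, h₂, h⟩ | ⟨h₁, h⟩
  · rw [h, Real.arsinh_neg]
    have hneg : (t - -T) / T < 0 := div_neg_of_neg_of_pos (by linarith) hT
    rcases clamp_cases hS (-Real.arsinh T + (t - -T) / T) with ⟨_, h'⟩ | ⟨_, _, _⟩ | ⟨_, _⟩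
    · rw [h', Real.sinh_neg, Real.sinh_arsinh]; field_simp; ring
    · linarith
    · linarith
  · rw [h, sub_self, zero_div, add_zero, clamp_of_abs_le, Real.sinh_arsinh]
    · simp
    · rw [abs_le, ← Real.arsinh_neg, Real.arsinh_le_arsinh, Real.arsinh_le_arsinh]
      exact ⟨h₁, h₂⟩
  · rw [h]
    have hpos : 0 < (t - T) / T := div_pos (by linarith) hT
    rcases clamp_cases hS (Real.arsinh T + (t - T) / T) with ⟨_, _⟩ | ⟨_, _, _⟩ | ⟨_, h'⟩
    · linarith
    · linarith
    · rw [h', Real.sinh_arsinh]; field_simp; ring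

/-- A step `r` on the scale is a relative step of order `r` in space, and an absolute one of order
`r * T`. -/
theorem abs_truncScaleInv_sub_le (hT : 1 ≤ T) {u v r : ℝ} (h : |u - v| ≤ r) (hr : r ≤ 1) :
    |truncScaleInv T u - truncScaleInv T v| ≤ 5 * r * (1 + |truncScaleInv T u|) ∧
      |truncScaleInv T u - truncScaleInv T v| ≤ 5 * r * T := by
  have hT0 : 0 < T := by linarith
  have hr0 : 0 ≤ r := (abs_nonneg _).trans h
  have hS : 0 ≤ Real.arsinh T := Real.arsinh_nonneg_iff.2 hT0.le
  obtain ⟨hc, hc'⟩ := abs_clamp_sub_le hS u v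
  set a := clamp (Real.arsinh T) u with ha
  set b := clamp (Real.arsinh T) v with hb
  have hsinh := abs_sinh_sub_sinh_le (hc.trans h) hr
  have hsplit : |truncScaleInv T u - truncScaleInv T v| ≤
      2 * r * (1 + |Real.sinh a|) + T * |(u - a) - (v - b)| := by
    calc _ = |(Real.sinh a - Real.sinh b) + T * ((u - a) - (v - b))| := by
          simp only [truncScaleInv, ← ha, ← hb]; ring_nf
      _ ≤ |Real.sinh a - Real.sinh b| + |T * ((u - a) - (v - b))| := abs_add_le _ _
      _ ≤ _ := by rw [abs_mul, abs_of_pos hT0]; gcongr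
  have haT : |Real.sinh a| ≤ T := by
    have := abs_le.1 (abs_clamp_le hS u)
    rw [abs_le, ← Real.sinh_arsinh T, ← Real.sinh_neg, Real.sinh_le_sinh, Real.sinh_le_sinh]
    exact this
  -- the value at `u` exceeds its logarithmic part
  have hau : |Real.sinh a| ≤ |truncScaleInv T u| := by
    simp only [truncScaleInv, ← ha]
    rcases clamp_cases hS u with ⟨h₁, h₂⟩ | ⟨_, _, h₂⟩ | ⟨h₁, h₂⟩
    · rw [ha, h₂, Real.sinh_neg, Real.sinh_arsinh, abs_neg, abs_of_pos hT0, abs_of_neg] <;>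
        nlinarith
    · rw [ha, h₂]; simp
    · rw [ha, h₂, Real.sinh_arsinh, abs_of_pos hT0, abs_of_pos] <;> nlinarith
  refine ⟨?_, ?_⟩
  · have hlin : T * |(u - a) - (v - b)| ≤ r * (2 + 3 * |Real.sinh a|) := by
      by_cases hin : (-Real.arsinh T ≤ u ∧ u ≤ Real.arsinh T) ∧
          (-Real.arsinh T ≤ v ∧ v ≤ Real.arsinh T)
      · rw [ha, hb, clamp_of_abs_le (abs_le.2 hin.1), clamp_of_abs_le (abs_le.2 hin.2)]
        simp only [sub_self, abs_zero, mul_zero]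
        positivity
      · have hor : |Real.sinh a| = T ∨ |Real.sinh b| = T := by
          rcases clamp_cases hS u with ⟨_, h₂⟩ | ⟨h₁, h₁', h₂⟩ | ⟨_, h₂⟩
          · left; rw [ha, h₂, Real.sinh_neg, Real.sinh_arsinh, abs_neg, abs_of_pos hT0]
          · right
            rcases clamp_cases hS v with ⟨_, h₃⟩ | ⟨h₄, h₄', h₃⟩ | ⟨_, h₃⟩
            · rw [hb, h₃, Real.sinh_neg, Real.sinh_arsinh, abs_neg, abs_of_pos hT0]
            · exact absurd ⟨⟨h₁, h₁'⟩, h₄, h₄'⟩ hin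
            · rw [hb, h₃, Real.sinh_arsinh, abs_of_pos hT0]
          · left; rw [ha, h₂, Real.sinh_arsinh, abs_of_pos hT0]
        have hTle : T ≤ 2 + 3 * |Real.sinh a| := by
          rcases hor with h₁ | h₁
          · linarith [abs_nonneg (Real.sinh a)]
          · have h₂ : |Real.sinh b| ≤ |Real.sinh a| + |Real.sinh a - Real.sinh b| := by
              have := abs_sub (Real.sinh a) (Real.sinh a - Real.sinh b)
              simpa using this
            have h₃ : 2 * r * (1 + |Real.sinh a|) ≤ 2 * 1 * (1 + |Real.sinh a|) := by gcongr
            linarith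
        calc T * |(u - a) - (v - b)| ≤ (2 + 3 * |Real.sinh a|) * r := by
              gcongr
              exact hc'.trans h
          _ = _ := mul_comm _ _
    have : r * |Real.sinh a| ≤ r * |truncScaleInv T u| := by gcongr
    linarith
  · have h₁ : T * |(u - a) - (v - b)| ≤ T * r := by
      gcongr
      exact hc'.trans h
    have h₂ : r * |Real.sinh a| ≤ r * T := by gcongr
    have h₃ : r * 1 ≤ r * T := by gcongr
    linarith

theorem norm_sub_round_le_of_truncScale (hT : 1 ≤ T) {r : ℝ} (hr : 0 < r) (hr1 : r ≤ 1)
    {Q : CenteredPartition d} (hQ : Q.cells = gridCells d (truncScale T) r) (x : E d) :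
    ‖x - Q.round x‖ ≤ 5 * d * r * (1 + ‖x‖) ∧ ‖x - Q.round x‖ ≤ 5 * d * r * T := by
  have hi : ∀ i, |x i - Q.round x i| ≤ 5 * r * (1 + |x i|) ∧
      |x i - Q.round x i| ≤ 5 * r * T := fun i => by
    have h := abs_truncScaleInv_sub_le hT (abs_scale_round_sub_le hr hQ x i) hr1
    rwa [truncScaleInv_scale (by linarith), truncScaleInv_scale (by linarith)] at h
  constructor
  · have : ‖x - Q.round x‖ ≤ d * (5 * r * (1 + ‖x‖)) := by
      refine norm_le_mul_of_abs_le _ (by positivity) fun i => (hi i).1.trans ?_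
      gcongr
      exact abs_apply_le_norm x i
    linarith
  · have : ‖x - Q.round x‖ ≤ d * (5 * r * T) :=
      norm_le_mul_of_abs_le _ (by positivity) fun i => (hi i).2
    linarith

end truncScale

theorem abs_arsinh_le {t R : ℝ} (h : |t| ≤ R) : |Real.arsinh t| ≤ Real.log (1 + 2 * R) := by
  have key : ∀ t : ℝ, |t| ≤ R → Real.arsinh t ≤ Real.log (1 + 2 * R) := by
    intro t ht
    have hs : √(1 + t ^ 2) ≤ 1 + |t| := by
      refine Real.sqrt_le_iff.2 ⟨by positivity, ?_⟩
      nlinarith [sq_abs t, abs_nonneg t]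
    have hpos : 0 < t + √(1 + t ^ 2) := by
      rw [← Real.exp_arsinh]; exact Real.exp_pos _
    refine Real.log_le_log hpos ?_
    linarith [le_abs_self t]
  refine abs_le.2 ⟨?_, key t h⟩
  have := key (-t) (by rwa [abs_neg])
  rw [Real.arsinh_neg] at this
  linarith

theorem abs_truncScale_le {T t : ℝ} (h : |t| ≤ T) :
    |truncScale T t| ≤ Real.log (1 + 2 * T) := by
  rw [truncScale, clamp_of_abs_le h]
  simpa using abs_arsinh_le h

end

section

/-! ### The statistical rate -/

/-- The rate `n ^ (-1 / (d + 2 p))`, which is also the step of the grids. -/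
noncomputable def rate (d : ℕ) (p : ℝ) (n : ℕ) : ℝ := (n : ℝ) ^ (-(1 / (d + 2 * p)))

section rate

variable {d n : ℕ} {p : ℝ}

theorem rate_pos (hn : 3 ≤ n) : 0 < rate d p n := by
  have : (0 : ℝ) < n := by exact_mod_cast (by omega : 0 < n)
  exact Real.rpow_pos_of_pos this _

theorem rate_le_one (hp : 1 ≤ p) (hn : 3 ≤ n) : rate d p n ≤ 1 := by
  have : (1 : ℝ) ≤ n := by exact_mod_cast (by omega : 1 ≤ n)
  refine Real.rpow_le_one_of_one_le_of_nonpos this ?_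
  have : 0 ≤ 1 / (d + 2 * p) := by positivity
  linarith

/-- The trade-off that determines the rate: `N = rate ^ (-d)` cells have a statistical error
`(N / n) ^ (1 / 2)` of the size of `rate ^ p`. -/
theorem rate_balance (hp : 1 ≤ p) (hn : 3 ≤ n) :
    (1 / rate d p n) ^ d / n = (rate d p n ^ p) ^ 2 := by
  have hn0 : (0 : ℝ) < n := by exact_mod_cast (by omega : 0 < n)
  have hd : (0 : ℝ) < d + 2 * p := by positivity
  rw [one_div, inv_pow, ← Real.rpow_natCast (rate d p n) d, ← Real.rpow_natCast _ 2, rate,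
    ← Real.rpow_mul hn0.le, ← Real.rpow_mul hn0.le, ← Real.rpow_mul hn0.le,
    ← Real.rpow_neg hn0.le]
  nth_rewrite 2 [← Real.rpow_one (n : ℝ)]
  rw [← Real.rpow_sub hn0]
  congr 1
  field_simp
  push_cast
  ring

theorem inv_le_rate_rpow (hp : 1 ≤ p) (hn : 3 ≤ n) : (n : ℝ)⁻¹ ≤ rate d p n ^ p := by
  have hn0 : (1 : ℝ) ≤ n := by exact_mod_cast (by omega : 1 ≤ n)
  rw [rate, ← Real.rpow_mul (by linarith), ← Real.rpow_neg_one]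
  refine Real.rpow_le_rpow_of_exponent_le hn0 ?_
  rw [neg_mul, neg_le_neg_iff, one_div_mul_eq_div, div_le_one (by positivity)]
  linarith [(Nat.cast_nonneg d : (0 : ℝ) ≤ d)]

theorem one_le_log (hn : 3 ≤ n) : 1 ≤ Real.log n := by
  have h3 : (3 : ℝ) ≤ n := by exact_mod_cast hn
  rw [Real.le_log_iff_exp_le (by linarith)]
  linarith [Real.exp_one_lt_d9]

end rate

/-! ### Moments and tails -/

section moments

variable {d : ℕ} {μ : Measure (E d)}

theorem one_add_enorm (x : E d) : 1 + ‖x‖ₑ = ENNReal.ofReal (1 + ‖x‖) := by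
  rw [ENNReal.ofReal_add zero_le_one (norm_nonneg x), ENNReal.ofReal_one, ofReal_norm]

theorem IsSubGaussian.setLIntegral_le (hμ : IsSubGaussian 1 μ) {s R : ℝ} (hs : 0 ≤ s)
    (hR : 0 ≤ R) :
    ∫⁻ x in {x | R < ‖x‖}, (1 + ‖x‖ₑ) ^ s ∂μ ≤
      ENNReal.ofReal (2 * Real.exp (s ^ 2 / 2) * Real.exp (-(R ^ 2 / 2))) := by
  have hRm : MeasurableSet {x : E d | R < ‖x‖} := measurableSet_lt measurable_const measurable_norm
  have hpt : ∀ x ∈ {x : E d | R < ‖x‖}, (1 + ‖x‖ₑ) ^ s ≤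
      ENNReal.ofReal (Real.exp (s ^ 2 / 2) * Real.exp (-(R ^ 2 / 2))) *
        ENNReal.ofReal (Real.exp (‖x‖ ^ 2 / 1)) := by
    intro x hx
    have hx' : R < ‖x‖ := hx
    have hpos : (0 : ℝ) < 1 + ‖x‖ := by positivity
    rw [one_add_enorm, ENNReal.ofReal_rpow_of_pos hpos, ← ENNReal.ofReal_mul (by positivity),
      ← Real.exp_add, ← Real.exp_add]
    refine ENNReal.ofReal_le_ofReal ?_
    calc (1 + ‖x‖) ^ s ≤ (Real.exp ‖x‖) ^ s := by
          gcongr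
          linarith [Real.add_one_le_exp ‖x‖]
      _ = Real.exp (‖x‖ * s) := (Real.exp_mul _ _).symm
      _ ≤ _ := by
          refine Real.exp_le_exp.2 ?_
          nlinarith [sq_nonneg (‖x‖ - s)]
  refine (setLIntegral_mono' hRm hpt).trans ?_
  rw [lintegral_const_mul' _ _ ENNReal.ofReal_ne_top]
  calc _ ≤ ENNReal.ofReal (Real.exp (s ^ 2 / 2) * Real.exp (-(R ^ 2 / 2))) * 2 := by
        gcongr
        exact (setLIntegral_le_lintegral _ _).trans hμ
    _ = _ := by
        rw [mul_comm, mul_assoc, ENNReal.ofReal_mul (p := 2) zero_le_two]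
        simp

theorem IsSubGaussian.lintegral_le [IsProbabilityMeasure μ] (hμ : IsSubGaussian 1 μ) {s : ℝ}
    (hs : 0 ≤ s) :
    ∫⁻ x, (1 + ‖x‖ₑ) ^ s ∂μ ≤ ENNReal.ofReal (1 + 2 * Real.exp (s ^ 2 / 2)) := by
  have hRm : MeasurableSet {x : E d | 0 < ‖x‖} := measurableSet_lt measurable_const measurable_norm
  rw [← lintegral_add_compl _ hRm, add_comm, ENNReal.ofReal_add zero_le_one (by positivity)]
  refine add_le_add ?_ ?_
  · calc ∫⁻ x in {x : E d | 0 < ‖x‖}ᶜ, (1 + ‖x‖ₑ) ^ s ∂μ ≤ ∫⁻ x in {x : E d | 0 < ‖x‖}ᶜ, 1 ∂μ := by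
          refine setLIntegral_mono' hRm.compl fun x hx => ?_
          have : x = 0 := by simpa using hx
          simp [this]
      _ ≤ ENNReal.ofReal 1 := by
          rw [setLIntegral_one, ENNReal.ofReal_one]
          exact prob_le_one
  · refine (hμ.setLIntegral_le hs le_rfl).trans_eq ?_
    simp

theorem HasUnitMoment.lintegral_le [IsProbabilityMeasure μ] {s : ℝ} (hs : 1 ≤ s)
    (hμ : HasUnitMoment s μ) :
    ∫⁻ x, (1 + ‖x‖ₑ) ^ s ∂μ ≤ ENNReal.ofReal (2 ^ s) := by
  have hμ' : ∫⁻ x, ‖x‖ₑ ^ s ∂μ ≤ 1 := by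
    simpa only [HasUnitMoment, ofReal_norm_rpow (by linarith : (0 : ℝ) ≤ s)] using hμ
  calc ∫⁻ x, (1 + ‖x‖ₑ) ^ s ∂μ ≤ ∫⁻ x, 2 ^ (s - 1) * (1 ^ s + ‖x‖ₑ ^ s) ∂μ :=
        lintegral_mono fun x => ENNReal.rpow_add_le_mul_rpow_add_rpow _ _ hs
    _ = 2 ^ (s - 1) * (1 + ∫⁻ x, ‖x‖ₑ ^ s ∂μ) := by
        rw [lintegral_const_mul _ (by fun_prop), lintegral_add_left (by fun_prop)]
        simp
    _ ≤ 2 ^ (s - 1) * (1 + 1) := by gcongr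
    _ = ENNReal.ofReal (2 ^ s) := by
        rw [← ENNReal.ofReal_rpow_of_pos two_pos, ENNReal.ofReal_ofNat, one_add_one_eq_two]
        nth_rewrite 2 [← ENNReal.rpow_one 2]
        rw [← ENNReal.rpow_add _ _ two_ne_zero ENNReal.ofNat_ne_top, sub_add_cancel]

theorem HasUnitMoment.setLIntegral_le {p R : ℝ} (hp : 1 ≤ p) (hR : 1 ≤ R)
    (hμ : HasUnitMoment (2 * p) μ) :
    ∫⁻ x in {x | R < ‖x‖}, (1 + ‖x‖ₑ) ^ p ∂μ ≤ ENNReal.ofReal (2 ^ p * (R ^ p)⁻¹) := by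
  have hRm : MeasurableSet {x : E d | R < ‖x‖} := measurableSet_lt measurable_const measurable_norm
  have hpt : ∀ x ∈ {x : E d | R < ‖x‖}, (1 + ‖x‖ₑ) ^ p ≤
      ENNReal.ofReal (2 ^ p * (R ^ p)⁻¹) * ENNReal.ofReal (‖x‖ ^ (2 * p)) := by
    intro x hx
    have hx' : R < ‖x‖ := hx
    have hpos : (0 : ℝ) < 1 + ‖x‖ := by positivity
    have hx0 : 0 < ‖x‖ := by linarith
    rw [one_add_enorm, ENNReal.ofReal_rpow_of_pos hpos, ← ENNReal.ofReal_mul (by positivity)]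
    refine ENNReal.ofReal_le_ofReal ?_
    calc (1 + ‖x‖) ^ p ≤ (2 * ‖x‖) ^ p := by gcongr; linarith
      _ = 2 ^ p * ((R ^ p)⁻¹ * R ^ p) * ‖x‖ ^ p := by
          rw [inv_mul_cancel₀ (by positivity), Real.mul_rpow zero_le_two hx0.le, mul_one]
      _ ≤ 2 ^ p * ((R ^ p)⁻¹ * ‖x‖ ^ p) * ‖x‖ ^ p := by gcongr
      _ = _ := by rw [two_mul p, Real.rpow_add hx0]; ring
  refine (setLIntegral_mono' hRm hpt).trans ?_
  rw [lintegral_const_mul' _ _ ENNReal.ofReal_ne_top]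
  calc _ ≤ ENNReal.ofReal (2 ^ p * (R ^ p)⁻¹) * 1 := by
        gcongr
        exact (setLIntegral_le_lintegral _ _).trans hμ
    _ = _ := mul_one _

end moments

end

section

/-! ### The risk of the estimator -/

theorem upperExpectation_le {Ω : Type u} [MeasurableSpace Ω] {P : Measure Ω} {f g : Ω → ℝ≥0∞}
    (hg : Measurable g) (h : ∀ ω, f ω ≤ g ω) : upperExpectation P f ≤ ∫⁻ ω, g ω ∂P :=
  iInf_le_of_le g (iInf_le_of_le hg (iInf_le_of_le h le_rfl))

section risk

variable {d n : ℕ} {p : ℝ}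

/-- The weight `‖c‖ ^ p + b ^ p` of a center is controlled by the norms of the points of its
cell. -/
theorem weight_round_le (hp : 1 ≤ p) {r b : ℝ} (hr : r ≤ 1) (hb : 1 ≤ b)
    {Q : CenteredPartition d} (hround : ∀ x, ‖x - Q.round x‖ ≤ 2 * d * r * (1 + ‖x‖)) (x : E d) :
    ‖Q.round x‖ₑ ^ p + ENNReal.ofReal b ^ p ≤
      ENNReal.ofReal ((2 + 2 * d) * b) ^ p * (1 + ‖x‖ₑ) ^ p := by
  have hp0 : 0 ≤ p := by linarith
  refine (ENNReal.add_rpow_le_rpow_add _ _ hp).trans ?_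
  rw [← ENNReal.mul_rpow_of_nonneg _ _ hp0]
  refine ENNReal.rpow_le_rpow ?_ hp0
  rw [one_add_enorm, ← ENNReal.ofReal_mul (by positivity), ← ofReal_norm,
    ← ENNReal.ofReal_add (norm_nonneg _) (by linarith)]
  refine ENNReal.ofReal_le_ofReal ?_
  have h₁ : ‖Q.round x‖ ≤ ‖x‖ + ‖x - Q.round x‖ := by
    have := norm_sub_le x (x - Q.round x)
    simpa using this
  have h₂ := hround x
  have h₃ : 2 * d * r * (1 + ‖x‖) ≤ 2 * d * 1 * (1 + ‖x‖) := by gcongr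
  have h₄ : (1 + 2 * d) * (1 + ‖x‖) * 1 ≤ (1 + 2 * d) * (1 + ‖x‖) * b := by gcongr
  nlinarith [norm_nonneg x]

/-- The expected deviation is of the order `rate ^ p`, up to logarithms. -/
theorem lintegral_deviation_le_rate (hp : 1 ≤ p) (hn : 3 ≤ n) {v e c : ℝ} (hv : 1 ≤ v)
    (he : 0 ≤ e) (hc1 : 1 ≤ c) {Q : CenteredPartition d} {R : ℝ}
    (hround : ∀ x, ‖x - Q.round x‖ ≤ 2 * d * rate d p n * (1 + ‖x‖))
    {F : Finset Q.cells} (hF : (F.card : ℝ) ≤ (c * Real.log n / rate d p n) ^ d)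
    (hFR : ∀ C : Q.cells, C ∉ F → ∀ x ∈ (C : Set (E d)), R < ‖x‖)
    {μ : Measure (E d)} [IsProbabilityMeasure μ]
    (hV : ∫⁻ x, (1 + ‖x‖ₑ) ^ (2 * p) ∂μ ≤ ENNReal.ofReal v)
    (hη : ∫⁻ x in {x | R < ‖x‖}, (1 + ‖x‖ₑ) ^ p ∂μ ≤ ENNReal.ofReal (e * rate d p n ^ p))
    {Ω : Type u} [MeasurableSpace Ω] {P : Measure Ω} [IsProbabilityMeasure P]
    {X : Fin n → Ω → E d} (hX : IsIIDSample X μ P) :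
    ∫⁻ ω, Q.deviation μ (empirical fun i => X i ω)
        (fun c => ‖c‖ₑ ^ p + ENNReal.ofReal (2 * Real.log n) ^ p) ∂P ≤
      ENNReal.ofReal ((4 + 4 * d) ^ p * (c ^ d * v + 2 * e) *
        Real.log n ^ (⌈p⌉₊ + d) * rate d p n ^ p) := by
  have hp0 : 0 ≤ p := by linarith
  have hq : 0 < rate d p n := rate_pos hn
  have hq1 : rate d p n ≤ 1 := rate_le_one hp hn
  have hl : 1 ≤ Real.log n := one_le_log hn
  have hn0 : (0 : ℝ) < n := by exact_mod_cast (by omega : 0 < n)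
  set q := rate d p n
  set l := Real.log n
  set L : ℝ≥0∞ := ENNReal.ofReal ((2 + 2 * d) * (2 * l)) ^ p with hL
  have hw : ∀ x, ‖Q.round x‖ₑ ^ p + ENNReal.ofReal (2 * l) ^ p ≤ L * (1 + ‖x‖ₑ) ^ p :=
    weight_round_le hp hq1 (by linarith) hround
  have hLtop : L ≠ ∞ := ENNReal.rpow_ne_top_of_nonneg hp0 ENNReal.ofReal_ne_top
  refine (hX.lintegral_partition_deviation_le (by omega) Q (by fun_prop) F hFR).trans ?_
  have hsq : ∫⁻ x, (‖Q.round x‖ₑ ^ p + ENNReal.ofReal (2 * l) ^ p) ^ 2 ∂μ ≤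
      L ^ 2 * ENNReal.ofReal v := by
    calc _ ≤ ∫⁻ x, L ^ 2 * (1 + ‖x‖ₑ) ^ (2 * p) ∂μ := by
          refine lintegral_mono fun x => (pow_le_pow_left' (hw x) 2).trans_eq ?_
          rw [mul_pow, ← ENNReal.rpow_natCast ((1 + ‖x‖ₑ) ^ p), ← ENNReal.rpow_mul]
          norm_num [mul_comm]
      _ ≤ _ := by
          rw [lintegral_const_mul' _ _ (ENNReal.pow_ne_top hLtop)]
          gcongr
  have htail : ∫⁻ x in {x | R < ‖x‖}, (‖Q.round x‖ₑ ^ p + ENNReal.ofReal (2 * l) ^ p) ∂μ ≤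
      L * ENNReal.ofReal (e * q ^ p) := by
    calc _ ≤ ∫⁻ x in {x | R < ‖x‖}, L * (1 + ‖x‖ₑ) ^ p ∂μ := lintegral_mono fun x => hw x
      _ ≤ _ := by
          rw [lintegral_const_mul' _ _ hLtop]
          gcongr
  have hmain : (F.card / n * ∫⁻ x, (‖Q.round x‖ₑ ^ p + ENNReal.ofReal (2 * l) ^ p) ^ 2 ∂μ) ^
      (1 / 2 : ℝ) ≤ L * ENNReal.ofReal (c ^ d * v * l ^ d * q ^ p) := by
    have hcard : (F.card : ℝ≥0∞) / n * ENNReal.ofReal v ≤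
        ENNReal.ofReal ((c ^ d * v * l ^ d * q ^ p) ^ 2) := by
      rw [← ENNReal.ofReal_natCast, ← ENNReal.ofReal_natCast n, ← ENNReal.ofReal_div_of_pos hn0,
        ← ENNReal.ofReal_mul (by positivity)]
      refine ENNReal.ofReal_le_ofReal ?_
      have hz : 1 ≤ c ^ d * v * l ^ d := by
        have h9 : (1 : ℝ) ≤ c ^ d := one_le_pow₀ hc1
        exact one_le_mul_of_one_le_of_one_le (one_le_mul_of_one_le_of_one_le h9 hv)
          (one_le_pow₀ hl)
      calc (F.card : ℝ) / n * v ≤ (c * l / q) ^ d / n * v := by gcongr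
        _ = (c ^ d * v * l ^ d) * ((1 / q) ^ d / n) := by
            rw [div_eq_mul_one_div (c * l) q, mul_pow, mul_pow]; ring
        _ = (c ^ d * v * l ^ d) * (q ^ p) ^ 2 := by rw [rate_balance hp hn]
        _ ≤ (c ^ d * v * l ^ d) ^ 2 * (q ^ p) ^ 2 := by
            gcongr
            exact le_self_pow₀ hz two_ne_zero
        _ = _ := by ring
    calc _ ≤ (L ^ 2 * ENNReal.ofReal ((c ^ d * v * l ^ d * q ^ p) ^ 2)) ^ (1 / 2 : ℝ) := by
          refine ENNReal.rpow_le_rpow ?_ (by norm_num)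
          calc _ ≤ (F.card : ℝ≥0∞) / n * (L ^ 2 * ENNReal.ofReal v) := by gcongr
            _ = L ^ 2 * ((F.card : ℝ≥0∞) / n * ENNReal.ofReal v) := by ring
            _ ≤ _ := by gcongr
      _ = _ := by
          rw [ENNReal.ofReal_pow (by positivity), ← mul_pow, ← ENNReal.rpow_natCast,
            ← ENNReal.rpow_mul]
          norm_num
  calc _ ≤ L * ENNReal.ofReal (c ^ d * v * l ^ d * q ^ p) +
        2 * (L * ENNReal.ofReal (e * q ^ p)) := by gcongr
    _ = L * ENNReal.ofReal (c ^ d * v * l ^ d * q ^ p + 2 * (e * q ^ p)) := by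
        rw [ENNReal.ofReal_add (by positivity) (by positivity),
          ENNReal.ofReal_mul (p := 2) zero_le_two, ENNReal.ofReal_ofNat]
        ring
    _ ≤ _ := by
        rw [hL, ENNReal.ofReal_rpow_of_nonneg (by positivity) hp0,
          ← ENNReal.ofReal_mul (by positivity)]
        refine ENNReal.ofReal_le_ofReal ?_
        have e₁ : ((2 + 2 * d) * (2 * l)) ^ p ≤ (4 + 4 * d : ℝ) ^ p * l ^ ⌈p⌉₊ := by
          rw [show (2 + 2 * d) * (2 * l) = (4 + 4 * d) * l by ring,
            Real.mul_rpow (by positivity) (by positivity), ← Real.rpow_natCast]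
          gcongr
          exact Nat.le_ceil p
        have e₂ : e ≤ e * l ^ d := le_mul_of_one_le_right he (one_le_pow₀ hl)
        calc _ ≤ ((4 + 4 * d : ℝ) ^ p * l ^ ⌈p⌉₊) *
              (c ^ d * v * l ^ d * q ^ p + 2 * ((e * l ^ d) * q ^ p)) := by gcongr
          _ = _ := by ring

/-- The `p`-th root of a quantity of the order `rate ^ p`. -/
theorem rpow_one_div_rate_le (hp : 1 ≤ p) {C q l : ℝ} (hC : 1 ≤ C) (hl : 1 ≤ l) (hq : 0 < q)
    (k : ℕ) : (2 ^ (p - 1) * ENNReal.ofReal (C * l ^ k * q ^ p)) ^ (1 / p) ≤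
      ENNReal.ofReal (2 ^ p * C * l ^ k * q) := by
  have hp0 : 0 < p := by linarith
  have h2 : (2 : ℝ≥0∞) ^ (p - 1) ≤ ENNReal.ofReal (2 ^ p) := by
    rw [← ENNReal.ofReal_rpow_of_pos two_pos, ENNReal.ofReal_ofNat]
    exact ENNReal.rpow_le_rpow_of_exponent_le one_le_two (by linarith)
  have h1 : 1 ≤ 2 ^ p * (C * l ^ k) :=
    one_le_mul_of_one_le_of_one_le (Real.one_le_rpow one_le_two hp0.le)
      (one_le_mul_of_one_le_of_one_le hC (one_le_pow₀ hl))
  calc _ ≤ (ENNReal.ofReal (2 ^ p) * ENNReal.ofReal (C * l ^ k * q ^ p)) ^ (1 / p) := by gcongr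
    _ = ENNReal.ofReal ((2 ^ p * (C * l ^ k)) ^ (1 / p) * q) := by
        rw [← ENNReal.ofReal_mul (by positivity),
          ENNReal.ofReal_rpow_of_nonneg (by positivity) (by positivity),
          ← mul_assoc, Real.mul_rpow (by positivity) (by positivity), ← Real.rpow_mul hq.le,
          mul_one_div_cancel hp0.ne', Real.rpow_one]
    _ ≤ _ := by
        refine ENNReal.ofReal_le_ofReal ?_
        rw [← mul_assoc] at h1 ⊢
        gcongr
        refine (Real.rpow_le_rpow_of_exponent_le h1 ?_).trans_eq (Real.rpow_one _)
        rw [div_le_one hp0]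
        exact hp

/-- The step of the grids. The factor `1 / (5 d)` keeps the distance between a point and its
rounding bounded by `1`. -/
noncomputable def gridStep (d : ℕ) (p : ℝ) (n : ℕ) : ℝ := rate d p n / (5 * d)

theorem gridStep_pos (hd : 1 ≤ d) (hn : 3 ≤ n) : 0 < gridStep d p n := by
  have : (0 : ℝ) < d := by exact_mod_cast hd
  have := rate_pos (d := d) (p := p) hn
  unfold gridStep
  positivity

theorem mul_gridStep (hd : 1 ≤ d) : 5 * d * gridStep d p n = rate d p n := by
  have : (0 : ℝ) < d := by exact_mod_cast hd
  unfold gridStep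
  field_simp

theorem gridStep_le_rate (hd : 1 ≤ d) (hn : 3 ≤ n) : gridStep d p n ≤ rate d p n := by
  have h1 : (1 : ℝ) ≤ d := by exact_mod_cast hd
  refine div_le_self (rate_pos hn).le ?_
  linarith

/-- A grid partition has at most `(45 d log n / rate) ^ d` cells near the origin. -/
theorem exists_finset_grid_cells (hd : 1 ≤ d) (hp : 1 ≤ p) (hn : 3 ≤ n)
    {g : ℝ → ℝ} {Q : CenteredPartition d}
    (hQ : Q.cells = gridCells d g (gridStep d p n)) {R : ℝ}
    (hg : ∀ t, |t| ≤ R → |g t| ≤ 2 * Real.log n) :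
    ∃ F : Finset Q.cells, (F.card : ℝ) ≤ (45 * d * Real.log n / rate d p n) ^ d ∧
      ∀ C : Q.cells, C ∉ F → ∀ x ∈ (C : Set (E d)), R < ‖x‖ := by
  have hq : 0 < gridStep d p n := gridStep_pos hd hn
  have hq1 : gridStep d p n ≤ 1 := (gridStep_le_rate hd hn).trans (rate_le_one hp hn)
  have hd0 : (d : ℝ) ≠ 0 := by exact_mod_cast (by omega : d ≠ 0)
  have hqr : 45 * d * Real.log n / rate d p n = 9 * Real.log n / gridStep d p n := by
    rw [← mul_gridStep hd]
    field_simp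
    ring
  rw [hqr]
  have hl : 1 ≤ Real.log n := one_le_log hn
  set q := gridStep d p n
  set l := Real.log n
  have hm := Nat.le_ceil (2 * l / q)
  have hm' := (Nat.ceil_lt_add_one (by positivity : 0 ≤ 2 * l / q)).le
  set m := ⌈2 * l / q⌉₊
  obtain ⟨F, hF, hF'⟩ := exists_finset_cells hq hQ m (S := {x | ‖x‖ ≤ R}) fun x hx i => by
    refine (hg _ ((abs_apply_le_norm x i).trans hx)).trans ?_
    rw [div_le_iff₀ hq] at hm
    linarith
  refine ⟨F, ?_, fun C hC x hx => not_le.1 (hF' C hC x hx)⟩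
  calc (F.card : ℝ) ≤ ((2 * m + 1) ^ d : ℕ) := by exact_mod_cast hF
    _ = (2 * m + 1 : ℝ) ^ d := by push_cast; rfl
    _ ≤ (9 * l / q) ^ d := by
        gcongr
        have : 1 ≤ l / q := by rw [le_div_iff₀ hq]; linarith
        calc (2 * m + 1 : ℝ) ≤ 2 * (2 * l / q + 1) + 1 := by linarith
          _ = 4 * (l / q) + 3 := by ring
          _ ≤ 9 * (l / q) := by linarith
          _ = 9 * l / q := by ring

/-- The rounding error in the `L^p` norm. -/
theorem rounding_error_le (hp : 1 ≤ p) {a v : ℝ} (ha : 0 ≤ a) (hv : 1 ≤ v)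
    {Q : CenteredPartition d} (hround : ∀ x, ‖x - Q.round x‖ ≤ a * (1 + ‖x‖))
    {μ : Measure (E d)} (hV : ∫⁻ x, (1 + ‖x‖ₑ) ^ (2 * p) ∂μ ≤ ENNReal.ofReal v) :
    (∫⁻ x, ‖x - Q.round x‖ₑ ^ p ∂μ) ^ (1 / p) ≤ ENNReal.ofReal (a * v) := by
  have hp0 : 0 < p := by linarith
  have h : ∫⁻ x, ‖x - Q.round x‖ₑ ^ p ∂μ ≤ ENNReal.ofReal a ^ p * ENNReal.ofReal v := by
    calc _ ≤ ∫⁻ x, ENNReal.ofReal a ^ p * (1 + ‖x‖ₑ) ^ (2 * p) ∂μ := by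
          refine lintegral_mono fun x => ?_
          calc ‖x - Q.round x‖ₑ ^ p ≤ (ENNReal.ofReal a * (1 + ‖x‖ₑ)) ^ p := by
                gcongr
                rw [one_add_enorm, ← ENNReal.ofReal_mul ha, ← ofReal_norm]
                exact ENNReal.ofReal_le_ofReal (hround x)
            _ = ENNReal.ofReal a ^ p * (1 + ‖x‖ₑ) ^ p := ENNReal.mul_rpow_of_nonneg _ _ hp0.le
            _ ≤ _ := by
                gcongr
                · exact le_self_add
                · linarith
      _ ≤ _ := by
          rw [lintegral_const_mul' _ _ (ENNReal.rpow_ne_top_of_nonneg hp0.le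
            ENNReal.ofReal_ne_top)]
          gcongr
  calc _ ≤ (ENNReal.ofReal a ^ p * ENNReal.ofReal v) ^ (1 / p) := by gcongr
    _ = ENNReal.ofReal a * ENNReal.ofReal v ^ (1 / p) := by
        rw [ENNReal.mul_rpow_of_nonneg _ _ (by positivity), rpow_rpow_one_div hp0]
    _ ≤ ENNReal.ofReal a * ENNReal.ofReal v := by
        gcongr
        refine (ENNReal.rpow_le_rpow_of_exponent_le ?_ ?_).trans_eq (ENNReal.rpow_one _)
        · rw [← ENNReal.ofReal_one]; exact ENNReal.ofReal_le_ofReal hv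
        · rw [div_le_one hp0]; exact hp
    _ = _ := (ENNReal.ofReal_mul ha).symm

/-- A sub-Gaussian tail beyond `2 log n` is of order `n ^ (-2)`. -/
theorem IsSubGaussian.tail_le {ν : Measure (E d)} (hν : IsSubGaussian 1 ν) (hp : 1 ≤ p)
    (hn : 3 ≤ n) :
    ∫⁻ x in {x | 2 * Real.log n < ‖x‖}, (1 + ‖x‖ₑ) ^ p ∂ν ≤
      ENNReal.ofReal (2 * Real.exp (p ^ 2 / 2) * ((n : ℝ)⁻¹) ^ 2) := by
  have hl : 1 ≤ Real.log n := one_le_log hn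
  have hn0 : (0 : ℝ) < n := by exact_mod_cast (by omega : 0 < n)
  refine (hν.setLIntegral_le (by linarith) (by linarith)).trans (ENNReal.ofReal_le_ofReal ?_)
  have : ((n : ℝ)⁻¹) ^ 2 = Real.exp (-(2 * Real.log n)) := by
    rw [Real.exp_neg, two_mul, Real.exp_add, Real.exp_log hn0]
    field_simp
  rw [this]
  gcongr
  nlinarith

/-- A random maximum of norms is a constant up to the sum of the tails. -/
theorem enorm_rpow_le_truncation (hp : 1 ≤ p) {b : ℝ} (y : Fin n → E d) (j : Fin n) :
    ‖y j‖ₑ ^ p ≤ ENNReal.ofReal b ^ p +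
      ∑ j, {x : E d | b < ‖x‖}.indicator (fun x => (1 + ‖x‖ₑ) ^ p) (y j) := by
  by_cases h : b < ‖y j‖
  · calc ‖y j‖ₑ ^ p ≤ {x : E d | b < ‖x‖}.indicator (fun x => (1 + ‖x‖ₑ) ^ p) (y j) := by
          rw [Set.indicator_of_mem (by exact h)]
          gcongr
          exact le_add_self
      _ ≤ ∑ j, {x : E d | b < ‖x‖}.indicator (fun x => (1 + ‖x‖ₑ) ^ p) (y j) :=
          Finset.single_le_sum (f := fun j => {x : E d | b < ‖x‖}.indicator
            (fun x => (1 + ‖x‖ₑ) ^ p) (y j)) (fun _ _ => zero_le) (Finset.mem_univ j)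
      _ ≤ _ := le_add_self
  · calc ‖y j‖ₑ ^ p ≤ ENNReal.ofReal b ^ p := by
          gcongr
          rw [← ofReal_norm]
          exact ENNReal.ofReal_le_ofReal (not_lt.1 h)
      _ ≤ _ := le_self_add

/-- The risk bound for an arbitrary partition with cells of relative diameter `rate`, few of which
are near the origin. -/
theorem exists_riskAtMost (hd : 1 ≤ d) (hp : 1 ≤ p) {v e : ℝ} (hv : 1 ≤ v) (he : 0 ≤ e) :
    ∃ (A : ℝ) (k : ℕ), ∀ n : ℕ, 3 ≤ n → ∀ (Q : CenteredPartition d) (R : ℝ)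
      (M : Measure (E d) → Prop),
      (∀ x, ‖x - Q.round x‖ ≤ 2 * d * rate d p n * (1 + ‖x‖)) →
      (∃ F : Finset Q.cells, (F.card : ℝ) ≤ (45 * d * Real.log n / rate d p n) ^ d ∧
        ∀ C : Q.cells, C ∉ F → ∀ x ∈ (C : Set (E d)), R < ‖x‖) →
      (∀ μ : Measure (E d), IsProbabilityMeasure μ → M μ →
        ∫⁻ x, (1 + ‖x‖ₑ) ^ (2 * p) ∂μ ≤ ENNReal.ofReal v ∧
        ∫⁻ x in {x | R < ‖x‖}, (1 + ‖x‖ₑ) ^ p ∂μ ≤ ENNReal.ofReal (e * rate d p n ^ p)) →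
      RiskAtMost.{u} n p (rate d p n ^ p) Q M (IsSubGaussian 1)
        (A * Real.log n ^ k * (n : ℝ) ^ (-(1 / (d + 2 * p)))) := by
  have hp0 : 0 < p := by linarith
  have hd45 : (1 : ℝ) ≤ 45 * d := by
    have : (1 : ℝ) ≤ d := by exact_mod_cast hd
    linarith
  set e₂ : ℝ := 2 * Real.exp (p ^ 2 / 2) with he₂
  set v₂ : ℝ := 1 + 2 * Real.exp ((2 * p) ^ 2 / 2) with hv₂
  set C₁ : ℝ := (4 + 4 * d) ^ p * ((45 * d) ^ d * v + 2 * e) + 2 * e₂ with hC₁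
  set C₂ : ℝ := (4 + 4 * d) ^ p * ((45 * d) ^ d * v₂ + 2 * e₂) with hC₂
  have he₂0 : 0 ≤ e₂ := by positivity
  have hv₂1 : 1 ≤ v₂ := by
    have := Real.exp_pos ((2 * p) ^ 2 / 2)
    linarith
  have h49 : ∀ v e : ℝ, 1 ≤ v → 0 ≤ e → 1 ≤ (4 + 4 * d : ℝ) ^ p * ((45 * d) ^ d * v + 2 * e) := by
    intro v e hv he
    have h4 : (1 : ℝ) ≤ (4 + 4 * d) ^ p :=
      Real.one_le_rpow (by linarith [(Nat.cast_nonneg d : (0 : ℝ) ≤ d)]) hp0.le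
    have h9 : (1 : ℝ) ≤ (45 * d) ^ d := one_le_pow₀ hd45
    have : (1 : ℝ) ≤ (45 * d) ^ d * v := one_le_mul_of_one_le_of_one_le h9 hv
    exact one_le_mul_of_one_le_of_one_le h4 (by linarith)
  have hC₁1 : 1 ≤ C₁ := by linarith [h49 v e hv he]
  have hC₂1 : 1 ≤ C₂ := h49 v₂ e₂ hv₂1 he₂0
  refine ⟨4 * d * v + 1 + 3 * (2 ^ p * C₁) + 2 * (2 * d + 2 ^ p * C₂), ⌈p⌉₊ + d, ?_⟩
  intro n hn Q R M hround hcells hM μ ν hμ hν hMμ hNν Ω _ P hP X Y hX hY κ hκ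
  obtain ⟨F, hF, hFR⟩ := hcells
  obtain ⟨hV, hη⟩ := hM μ hμ hMμ
  have hq : 0 < rate d p n := rate_pos hn
  have hq1 : rate d p n ≤ 1 := rate_le_one hp hn
  have hl : 1 ≤ Real.log n := one_le_log hn
  have hn0 : (0 : ℝ) < n := by exact_mod_cast (by omega : 0 < n)
  have hn1 : n ≠ 0 := by omega
  have hnq := inv_le_rate_rpow (d := d) hp hn
  have hdev := lintegral_deviation_le_rate hp hn hv he hd45 hround hF hFR hV hη hX
  change _ ≤ ENNReal.ofReal (_ * _ * rate d p n)
  set q := rate d p n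
  set l := Real.log n
  set k := ⌈p⌉₊ + d
  -- the target is rounded to cubes
  have hr : 0 < gridStep d p n := gridStep_pos hd hn
  set Q₂ : CenteredPartition d := gridPartition d (g := id) (h := id) measurable_id
    (fun _ => rfl) hr
  have hQ₂ : Q₂.cells = gridCells d id (gridStep d p n) := rfl
  have hround₂ : ∀ x, ‖x - Q₂.round x‖ ≤ d * q := fun x =>
    (norm_sub_round_le_of_cubes hr (hQ₂.trans (cubeCells_eq_gridCells hr).symm) x).trans
      (mul_le_mul_of_nonneg_left (gridStep_le_rate hd hn) (Nat.cast_nonneg d))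
  have hround₂' : ∀ x, ‖x - Q₂.round x‖ ≤ 2 * d * q * (1 + ‖x‖) := fun x => by
    refine (hround₂ x).trans ?_
    have h₀ : 0 ≤ d * q := by positivity
    nlinarith [norm_nonneg x, mul_nonneg h₀ (norm_nonneg x)]
  obtain ⟨F₂, hF₂, hFR₂⟩ := exists_finset_grid_cells hd hp hn hQ₂ (R := 2 * l) fun t ht => ht
  have htail := hNν.tail_le hp hn
  have hη₂ : ∫⁻ x in {x | 2 * l < ‖x‖}, (1 + ‖x‖ₑ) ^ p ∂ν ≤ ENNReal.ofReal (e₂ * q ^ p) := by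
    refine htail.trans (ENNReal.ofReal_le_ofReal ?_)
    have : ((n : ℝ)⁻¹) ^ 2 ≤ (n : ℝ)⁻¹ := by
      refine pow_le_of_le_one (by positivity) ?_ two_ne_zero
      exact hnq.trans (Real.rpow_le_one hq.le hq1 hp0.le)
    gcongr
    exact this.trans hnq
  have hdev₂ := lintegral_deviation_le_rate hp hn hv₂1 he₂0 hd45 hround₂' hF₂ hFR₂
    (hNν.lintegral_le (by linarith)) hη₂ hY
  -- measurable bounds for the two deviations
  set w : E d → ℝ≥0∞ := fun c => ‖c‖ₑ ^ p + ENNReal.ofReal (2 * l) ^ p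
  set τ : Ω → ℝ≥0∞ := fun ω => ∑ j, {x : E d | 2 * l < ‖x‖}.indicator
    (fun x => (1 + ‖x‖ₑ) ^ p) (Y j ω) with hτ
  have hRm : MeasurableSet {x : E d | 2 * l < ‖x‖} :=
    measurableSet_lt measurable_const measurable_norm
  have hind : Measurable ({x : E d | 2 * l < ‖x‖}.indicator fun x => (1 + ‖x‖ₑ) ^ p) :=
    Measurable.indicator (by fun_prop) hRm
  have hτj : ∀ j, Measurable fun ω => {x : E d | 2 * l < ‖x‖}.indicator
      (fun x => (1 + ‖x‖ₑ) ^ p) (Y j ω) := fun j => hind.comp (hY.measurable j)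
  have hτm : Measurable τ := Finset.measurable_fun_sum _ fun j _ => hτj j
  set T : Ω → ℝ≥0∞ := fun ω => Q.deviation μ (empirical fun i => X i ω) w + 2 * τ ω with hT
  set S : Ω → ℝ≥0∞ := fun ω => Q₂.deviation ν (empirical fun j => Y j ω) w with hS
  have hTm : Measurable T := (hX.measurable_deviation Q w).add (hτm.const_mul 2)
  have hSm : Measurable S := hY.measurable_deviation Q₂ w
  have hTE : ∫⁻ ω, T ω ∂P ≤ ENNReal.ofReal (C₁ * l ^ k * q ^ p) := by
    have hτE : ∫⁻ ω, τ ω ∂P ≤ ENNReal.ofReal (e₂ * q ^ p) := by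
      calc ∫⁻ ω, τ ω ∂P = ∑ j : Fin n, ∫⁻ x in {x | 2 * l < ‖x‖}, (1 + ‖x‖ₑ) ^ p ∂ν := by
            rw [hτ, lintegral_finsetSum _ fun j _ => hτj j]
            refine Finset.sum_congr rfl fun j _ => ?_
            rw [hY.lintegral_comp hind j, lintegral_indicator hRm]
        _ ≤ ∑ j : Fin n, ENNReal.ofReal (e₂ * ((n : ℝ)⁻¹) ^ 2) :=
            Finset.sum_le_sum fun j _ => htail
        _ = ENNReal.ofReal (n * (e₂ * ((n : ℝ)⁻¹) ^ 2)) := by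
            rw [ENNReal.ofReal_mul hn0.le]
            simp
        _ ≤ _ := by
            refine ENNReal.ofReal_le_ofReal ?_
            calc (n : ℝ) * (e₂ * ((n : ℝ)⁻¹) ^ 2) = e₂ * (n : ℝ)⁻¹ := by field_simp
              _ ≤ _ := by gcongr
    calc ∫⁻ ω, T ω ∂P = ∫⁻ ω, Q.deviation μ (empirical fun i => X i ω) w ∂P +
          2 * ∫⁻ ω, τ ω ∂P := by
          rw [hT, lintegral_add_left (hX.measurable_deviation Q w), lintegral_const_mul _ hτm]
      _ ≤ _ + 2 * ENNReal.ofReal (e₂ * q ^ p) := by gcongr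
      _ ≤ ENNReal.ofReal (((4 + 4 * d) ^ p * ((45 * d) ^ d * v + 2 * e)) * l ^ k * q ^ p) +
          ENNReal.ofReal (2 * e₂ * l ^ k * q ^ p) := by
          gcongr
          rw [← ENNReal.ofReal_ofNat, ← ENNReal.ofReal_mul zero_le_two]
          refine ENNReal.ofReal_le_ofReal ?_
          have : e₂ ≤ e₂ * l ^ k := le_mul_of_one_le_right he₂0 (one_le_pow₀ hl)
          calc 2 * (e₂ * q ^ p) ≤ 2 * ((e₂ * l ^ k) * q ^ p) := by gcongr
            _ = _ := by ring
      _ = _ := by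
          rw [← ENNReal.ofReal_add (by positivity) (by positivity), hC₁]
          congr 1; ring
  -- the error for a given outcome
  have hpoint : ∀ ω, transportError p (κ ω) μ ν ≤
      ENNReal.ofReal (4 * d * v * q + q + 4 * d * q) +
        (3 * (2 ^ (p - 1) * T ω) ^ (1 / p) + 2 * (2 ^ (p - 1) * S ω) ^ (1 / p)) := by
    intro ω
    have := isProbabilityMeasure_empirical hn1 fun i => X i ω
    have := isProbabilityMeasure_empirical hn1 fun j => Y j ω
    have h₁ := transportError_le hp hn1 μ ν (hκ ω)
      (enorm_rpow_le_truncation hp (b := 2 * l) fun j => Y j ω)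
    have h₂ := wasserstein_empirical_le hp hn1 Q₂ ν fun j => Y j ω
    have h₃ : Q.deviation μ (empirical fun i => X i ω)
        (fun c => ‖c‖ₑ ^ p + (ENNReal.ofReal (2 * l) ^ p + τ ω)) ≤ T ω := by
      simp only [← add_assoc]
      exact Q.deviation_add_const_le _ _ w (τ ω)
    have h₄ : Q₂.deviation ν (empirical fun j => Y j ω) (fun c => ‖c‖ₑ ^ p) ≤ S ω :=
      Q₂.deviation_mono _ _ fun c => le_self_add
    have h₅ : (∫⁻ x, ‖x - Q.round x‖ₑ ^ p ∂μ) ^ (1 / p) ≤ ENNReal.ofReal (2 * d * q * v) :=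
      rounding_error_le hp (by positivity) hv hround hV
    have h₆ : ∀ ν : Measure (E d), IsProbabilityMeasure ν →
        (∫⁻ x, ‖x - Q₂.round x‖ₑ ^ p ∂ν) ^ (1 / p) ≤ ENNReal.ofReal (d * q) := by
      intro ν _
      calc _ ≤ (∫⁻ _, ENNReal.ofReal (d * q) ^ p ∂ν) ^ (1 / p) := by
            gcongr with x
            rw [← ofReal_norm]
            exact ENNReal.ofReal_le_ofReal (hround₂ x)
        _ = _ := by simp only [lintegral_const, measure_univ, mul_one, rpow_rpow_one_div hp0]
    have h₇ : ENNReal.ofReal (q ^ p) ^ (1 / p) = ENNReal.ofReal q := by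
      rw [← ENNReal.ofReal_rpow_of_pos hq, rpow_rpow_one_div hp0]
    refine h₁.trans ?_
    calc _ ≤ 2 * ENNReal.ofReal (2 * d * q * v) + ENNReal.ofReal q +
          3 * (2 ^ (p - 1) * T ω) ^ (1 / p) +
          2 * (ENNReal.ofReal (d * q) + ENNReal.ofReal (d * q) +
            (2 ^ (p - 1) * S ω) ^ (1 / p)) := by
          refine add_le_add (add_le_add (add_le_add ?_ h₇.le) ?_) ?_
          · gcongr
          · exact mul_le_mul_right (ENNReal.rpow_le_rpow (mul_le_mul_right h₃ _)
              (by positivity)) _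
          · refine mul_le_mul_right (h₂.trans ?_) _
            refine add_le_add (add_le_add (h₆ _ inferInstance) (h₆ _ hν)) ?_
            exact ENNReal.rpow_le_rpow (mul_le_mul_right h₄ _) (by positivity)
      _ = (2 * ENNReal.ofReal (2 * d * q * v) + ENNReal.ofReal q +
          4 * ENNReal.ofReal (d * q)) + (3 * (2 ^ (p - 1) * T ω) ^ (1 / p) +
            2 * (2 ^ (p - 1) * S ω) ^ (1 / p)) := by ring
      _ = _ := by
          congr 1
          rw [← ENNReal.ofReal_ofNat 2, ← ENNReal.ofReal_ofNat 4,
            ← ENNReal.ofReal_mul zero_le_two, ← ENNReal.ofReal_mul (by norm_num),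
            ← ENNReal.ofReal_add (by positivity) hq.le,
            ← ENNReal.ofReal_add (by positivity) (by positivity)]
          congr 1; ring
  have hroot : ∀ {f : Ω → ℝ≥0∞} {C : ℝ}, Measurable f → 1 ≤ C →
      ∫⁻ ω, f ω ∂P ≤ ENNReal.ofReal (C * l ^ k * q ^ p) →
      ∫⁻ ω, (2 ^ (p - 1) * f ω) ^ (1 / p) ∂P ≤ ENNReal.ofReal (2 ^ p * C * l ^ k * q) := by
    intro f C hf hC hfE
    refine (lintegral_rpow_one_div_le P (hf.const_mul _) hp).trans ?_
    refine le_trans ?_ (rpow_one_div_rate_le hp hC hl hq k)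
    rw [lintegral_const_mul _ hf]
    gcongr
  have hTr := (hTm.const_mul (2 ^ (p - 1))).pow_const (1 / p)
  have hSr := (hSm.const_mul (2 ^ (p - 1))).pow_const (1 / p)
  have hGm : Measurable fun ω => ENNReal.ofReal (4 * d * v * q + q + 4 * d * q) +
      (3 * (2 ^ (p - 1) * T ω) ^ (1 / p) + 2 * (2 ^ (p - 1) * S ω) ^ (1 / p)) :=
    measurable_const.add ((hTr.const_mul 3).add (hSr.const_mul 2))
  refine (upperExpectation_le hGm hpoint).trans ?_
  rw [lintegral_add_left measurable_const, lintegral_add_left (hTr.const_mul 3),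
    lintegral_const_mul _ hTr, lintegral_const_mul _ hSr, lintegral_const, measure_univ, mul_one]
  calc _ ≤ ENNReal.ofReal (4 * d * v * q + q + 4 * d * q) +
        (3 * ENNReal.ofReal (2 ^ p * C₁ * l ^ k * q) +
          2 * ENNReal.ofReal (2 ^ p * C₂ * l ^ k * q)) := by
        gcongr
        · exact hroot hTm hC₁1 hTE
        · exact hroot hSm hC₂1 hdev₂
    _ = ENNReal.ofReal ((4 * d * v + 1 + 4 * d) * q +
          (3 * (2 ^ p * C₁ * l ^ k * q) + 2 * (2 ^ p * C₂ * l ^ k * q))) := by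
        rw [← ENNReal.ofReal_ofNat 3, ← ENNReal.ofReal_ofNat 2, ← ENNReal.ofReal_mul (by norm_num),
          ← ENNReal.ofReal_mul zero_le_two, ← ENNReal.ofReal_add (by positivity) (by positivity),
          ← ENNReal.ofReal_add (by positivity) (by positivity)]
        congr 1; ring
    _ ≤ _ := by
        refine ENNReal.ofReal_le_ofReal ?_
        have h₁ : (4 * d * v + 1 + 4 * d) ≤ (4 * d * v + 1 + 4 * d) * l ^ k :=
          le_mul_of_one_le_right (by positivity) (one_le_pow₀ hl)
        calc _ ≤ ((4 * d * v + 1 + 4 * d) * l ^ k) * q +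
              (3 * (2 ^ p * C₁ * l ^ k * q) + 2 * (2 ^ p * C₂ * l ^ k * q)) := by gcongr
          _ = _ := by ring

end risk

end

section

/-! ### Programs with time bounds -/

/-- Started in the state `s`, the program `c` halts within `T` steps, in a state with property
`post`. -/
def Program.Halts (c : Program) (s : MachineState) (T : ℕ) (post : MachineState → Prop) : Prop :=
  ∃ (t : ℕ) (s' : MachineState), Runs c s t s' ∧ t ≤ T ∧ post s'

/-- The state after writing `v` into the natural cell `a`. -/
def MachineState.setN (s : MachineState) (a v : ℕ) : MachineState :=
  { s with nat := Function.update s.nat a v }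

/-- The state after writing `v` into the real cell `a`. -/
def MachineState.setR (s : MachineState) (a : ℕ) (v : ℝ) : MachineState :=
  { s with real := Function.update s.real a v }

namespace MachineState

variable (s : MachineState) (a b v : ℕ) (x : ℝ)

@[simp] theorem setN_real : (s.setN a v).real = s.real := rfl

@[simp] theorem setR_nat : (s.setR a x).nat = s.nat := rfl

theorem setN_nat : (s.setN a v).nat b = if b = a then v else s.nat b :=
  Function.update_apply ..

theorem setR_real : (s.setR a x).real b = if b = a then x else s.real b :=
  Function.update_apply ..

end MachineState

namespace Program

variable {c c₁ c₂ : Program} {s : MachineState} {T T₁ T₂ : ℕ} {post mid : MachineState → Prop}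

theorem Halts.mono {post' : MachineState → Prop} (h : c.Halts s T₁ post) (hT : T₁ ≤ T₂)
    (hpost : ∀ s', post s' → post' s') : c.Halts s T₂ post' := by
  obtain ⟨t, s', hr, ht, hp⟩ := h
  exact ⟨t, s', hr, ht.trans hT, hpost s' hp⟩

theorem Halts.skip (h : post s) : Program.skip.Halts s 1 post :=
  ⟨_, _, Runs.skip s, le_rfl, h⟩

theorem Halts.setNat {a e : NExpr} (h : post (s.setN (a.eval s) (e.eval s))) :
    (Program.setNat a e).Halts s (a.cost + e.cost + 1) post :=
  ⟨_, _, Runs.setNat a e s, le_rfl, h⟩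

theorem Halts.setReal {a : NExpr} {e : RExpr} (h : post (s.setR (a.eval s) (e.eval s))) :
    (Program.setReal a e).Halts s (a.cost + e.cost + 1) post :=
  ⟨_, _, Runs.setReal a e s, le_rfl, h⟩

theorem Halts.seq (h₁ : c₁.Halts s T₁ mid) (h₂ : ∀ s', mid s' → c₂.Halts s' T₂ post) :
    (Program.seq c₁ c₂).Halts s (T₁ + T₂) post := by
  obtain ⟨t₁, s₁, hr₁, ht₁, hm⟩ := h₁
  obtain ⟨t₂, s₂, hr₂, ht₂, hp⟩ := h₂ s₁ hm
  exact ⟨_, _, Runs.seq hr₁ hr₂, add_le_add ht₁ ht₂, hp⟩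

theorem Halts.ite {b : Test} (h₁ : b.Holds s → c₁.Halts s T post)
    (h₂ : ¬ b.Holds s → c₂.Halts s T post) :
    (Program.ite b c₁ c₂).Halts s (b.cost + T) post := by
  by_cases hb : b.Holds s
  · obtain ⟨t, s', hr, ht, hp⟩ := h₁ hb
    exact ⟨_, _, Runs.iteTrue hb hr, by omega, hp⟩
  · obtain ⟨t, s', hr, ht, hp⟩ := h₂ hb
    exact ⟨_, _, Runs.iteFalse hb hr, by omega, hp⟩

/-- A loop with the variant `N`: every round consumes one unit of fuel. -/
theorem Halts.loop {b : Test} {B : ℕ} (I : ℕ → MachineState → Prop)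
    (hstep : ∀ k s, I k s → b.Holds s → ∃ k', k = k' + 1 ∧ c.Halts s B (I k')) :
    ∀ (N : ℕ) (s : MachineState), I N s →
      (Program.loop b c).Halts s (N * (B + b.cost) + b.cost)
        fun s' => ¬ b.Holds s' ∧ ∃ k, I k s' := by
  intro N
  induction N with
  | zero =>
    intro s hI
    by_cases hb : b.Holds s
    · obtain ⟨k', hk, -⟩ := hstep 0 s hI hb
      omega
    · exact ⟨_, _, Runs.loopDone hb, by omega, hb, 0, hI⟩
  | succ N ih =>
    intro s hI
    by_cases hb : b.Holds s
    · obtain ⟨k', hk, t₁, s₁, hr₁, ht₁, hI₁⟩ := hstep _ s hI hb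
      obtain rfl : N = k' := by omega
      obtain ⟨t₂, s₂, hr₂, ht₂, hp⟩ := ih s₁ hI₁
      refine ⟨_, _, Runs.loopStep hb hr₁ hr₂, ?_, hp⟩
      rw [Nat.succ_mul]
      omega
    · exact ⟨_, _, Runs.loopDone hb, by omega, hb, _, hI⟩

end Program

/-- The content of the natural cell `r`. -/
def NExpr.reg (r : ℕ) : NExpr := .mem (.const r)

/-- The content of the real cell `r`. -/
def RExpr.reg (r : ℕ) : RExpr := .mem (.const r)

@[simp] theorem NExpr.eval_const (s : MachineState) (k : ℕ) : (NExpr.const k).eval s = k := rfl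

@[simp] theorem NExpr.eval_reg (s : MachineState) (r : ℕ) : (NExpr.reg r).eval s = s.nat r := rfl

@[simp] theorem NExpr.eval_mem (s : MachineState) (a : NExpr) :
    (NExpr.mem a).eval s = s.nat (a.eval s) := rfl

@[simp] theorem NExpr.eval_plus (s : MachineState) (a b : NExpr) :
    (NExpr.plus a b).eval s = a.eval s + b.eval s := rfl

@[simp] theorem NExpr.eval_minus (s : MachineState) (a b : NExpr) :
    (NExpr.minus a b).eval s = a.eval s - b.eval s := rfl

@[simp] theorem RExpr.eval_reg (s : MachineState) (r : ℕ) : (RExpr.reg r).eval s = s.real r := rfl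

@[simp] theorem RExpr.eval_mem (s : MachineState) (a : NExpr) :
    (RExpr.mem a).eval s = s.real (a.eval s) := rfl

@[simp] theorem RExpr.eval_ofNat (s : MachineState) (a : NExpr) :
    (RExpr.ofNat a).eval s = (a.eval s : ℝ) := rfl

@[simp] theorem RExpr.eval_plus (s : MachineState) (a b : RExpr) :
    (RExpr.plus a b).eval s = a.eval s + b.eval s := rfl

@[simp] theorem RExpr.eval_minus (s : MachineState) (a b : RExpr) :
    (RExpr.minus a b).eval s = a.eval s - b.eval s := rfl

@[simp] theorem RExpr.eval_times (s : MachineState) (a b : RExpr) :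
    (RExpr.times a b).eval s = a.eval s * b.eval s := rfl

@[simp] theorem RExpr.eval_divide (s : MachineState) (a b : RExpr) :
    (RExpr.divide a b).eval s = a.eval s / b.eval s := rfl

@[simp] theorem RExpr.eval_exp (s : MachineState) (a : RExpr) :
    (RExpr.exp a).eval s = Real.exp (a.eval s) := rfl

@[simp] theorem RExpr.eval_log (s : MachineState) (a : RExpr) :
    (RExpr.log a).eval s = Real.log (a.eval s) := rfl

@[simp] theorem RExpr.eval_floor (s : MachineState) (a : RExpr) :
    (RExpr.floor a).eval s = (⌊a.eval s⌋ : ℝ) := rfl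

@[simp] theorem Test.holds_natLe (s : MachineState) (a b : NExpr) :
    (Test.natLe a b).Holds s ↔ a.eval s ≤ b.eval s := Iff.rfl

@[simp] theorem Test.holds_realLe (s : MachineState) (a b : RExpr) :
    (Test.realLe a b).Holds s ↔ a.eval s ≤ b.eval s := Iff.rfl

/-- Increment of the natural cell `r`. -/
def incr (r : ℕ) : Program := .setNat (.const r) (.plus (.reg r) (.const 1))

/-- The loop `for i = 0, …, N - 1`, with the counter in cell `i` and `N` in cell `b`. -/
def forLoop (i b : ℕ) (body : Program) : Program :=
  .seq (.setNat (.const i) (.const 0))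
    (.loop (.natLe (.plus (.reg i) (.const 1)) (.reg b)) (.seq body (incr i)))

open Program in
theorem Program.Halts.forLoop {i b N B : ℕ} {body : Program} {s : MachineState}
    {post : MachineState → Prop} (I : ℕ → MachineState → Prop)
    (hb : ∀ k s', I k s' → s'.nat b = N) (hi : ∀ k s', I k s' → s'.nat i = k)
    (h₀ : I 0 (s.setN i 0))
    (hstep : ∀ k < N, ∀ s', I k s' →
      body.Halts s' B fun s'' => s''.nat i = k ∧ I (k + 1) (s''.setN i (k + 1)))
    (hend : ∀ s', I N s' → post s') :
    (forLoop i b body).Halts s (N * (B + 13) + 10) post := by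
  have hloop := Halts.loop (c := .seq body (incr i)) (B := B + 6)
    (b := .natLe (.plus (.reg i) (.const 1)) (.reg b))
    (fun f s' => ∃ k, k + f = N ∧ I k s') (by
      rintro f s' ⟨k, hk, hI⟩ ht
      simp only [Test.holds_natLe, NExpr.eval_plus, NExpr.eval_reg, NExpr.eval_const,
        hb k s' hI, hi k s' hI] at ht
      refine ⟨N - (k + 1), by omega, ?_⟩
      refine Halts.seq (T₁ := B) (T₂ := 6) (hstep k (by omega) s' hI) ?_
      rintro s'' ⟨hk'', hI''⟩
      refine Halts.setNat (a := .const i) (e := .plus (.reg i) (.const 1)) ⟨k + 1, by omega, ?_⟩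
      simpa [hk''] using hI'')
  refine (Halts.seq (T₁ := 3) (Halts.setNat (a := .const i) (e := .const 0)
    (post := I 0) h₀) fun s' hI => hloop N s' ⟨0, by omega, hI⟩).mono ?_ ?_
  · simp only [Test.cost, NExpr.cost, NExpr.reg]
    have : N * (B + 6 + (1 + 1 + 1 + 1 + (1 + 1) + 1)) = N * (B + 13) := by ring
    omega
  · rintro s' ⟨ht, f, k, hk, hI⟩
    simp only [Test.holds_natLe, NExpr.eval_plus, NExpr.eval_reg, NExpr.eval_const,
      hb k s' hI, hi k s' hI] at ht
    obtain rfl : k = N := by omega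
    exact hend s' hI

end

section

/-! ### Programs that round the source samples -/

/-- `body` applies `f` to the real cell whose address is in the natural cell `4`, given the step
`r` and the radius `R`; it may use the real cells `5, …, 63`. -/
def RoundsEntry (body : Program) (f : ℝ → ℝ) (r R : ℝ) (B : ℕ) : Prop :=
  ∀ s : MachineState, 64 ≤ s.nat 4 → s.real 3 = r → s.real 4 = R →
    body.Halts s B fun s' => s'.nat = s.nat ∧ s'.real (s.nat 4) = f (s.real (s.nat 4)) ∧
      ∀ a, a ≠ s.nat 4 → a < 5 ∨ 64 ≤ a → s'.real a = s.real a

/-- Runs `body` on all coordinates of the source samples. -/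
def roundLoop (body : Program) : Program :=
  .seq (.setNat (.const 4) (.const 64)) (forLoop 2 0 (forLoop 3 1 (.seq body (incr 4))))

/-- The state in which the first `m` coordinates have been treated. -/
structure RoundProgress (f : ℝ → ℝ) (n d : ℕ) (s₀ : MachineState) (m : ℕ) (s : MachineState) :
    Prop where
  size : s.nat 0 = n
  dim : s.nat 1 = d
  pointer : s.nat 4 = 64 + m
  real : ∀ a, a < 5 ∨ 64 ≤ a →
    s.real a = if 64 ≤ a ∧ a < 64 + m then f (s₀.real a) else s₀.real a

theorem RoundProgress.setN {f : ℝ → ℝ} {n d m : ℕ} {s₀ s : MachineState}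
    (h : RoundProgress f n d s₀ m s) {a : ℕ} (ha : a = 2 ∨ a = 3) (v : ℕ) :
    RoundProgress f n d s₀ m (s.setN a v) := by
  obtain ⟨h₁, h₂, h₃, h₄⟩ := h
  rcases ha with rfl | rfl <;>
    exact ⟨by simpa [MachineState.setN_nat], by simpa [MachineState.setN_nat],
      by simpa [MachineState.setN_nat], h₄⟩

theorem halts_roundLoop {body : Program} {f : ℝ → ℝ} {r R : ℝ} {B n d : ℕ}
    (hbody : RoundsEntry body f r R B) {s₀ : MachineState} (hn : s₀.nat 0 = n)
    (hd : s₀.nat 1 = d) (hr : s₀.real 3 = r) (hR : s₀.real 4 = R) :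
    (roundLoop body).Halts s₀ (3 + (n * (d * (B + 6 + 13) + 10 + 13) + 10))
      (RoundProgress f n d s₀ (n * d)) := by
  refine Program.Halts.seq (Program.Halts.setNat (post := RoundProgress f n d s₀ 0) ?_) ?_
  · refine ⟨by simpa [MachineState.setN_nat], by simpa [MachineState.setN_nat],
      by simp [MachineState.setN_nat], fun a _ => ?_⟩
    rw [if_neg (by omega)]
    rfl
  intro s₁ h₁
  refine Program.Halts.forLoop (fun i s => RoundProgress f n d s₀ (i * d) s ∧ s.nat 2 = i)
    (fun k s h => h.1.size) (fun k s h => h.2) ⟨by simpa using h₁.setN (.inl rfl) 0, by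
      simp [MachineState.setN_nat]⟩ ?_ fun s h => h.1
  rintro i - s₂ ⟨h₂, hi⟩
  refine Program.Halts.forLoop
    (fun k s => RoundProgress f n d s₀ (i * d + k) s ∧ s.nat 2 = i ∧ s.nat 3 = k)
    (fun k s h => h.1.dim) (fun k s h => h.2.2)
    ⟨h₂.setN (.inr rfl) 0, by simpa [MachineState.setN_nat], by simp [MachineState.setN_nat]⟩
    ?_ ?_
  · rintro k - s₃ ⟨h₃, hi₃, hk⟩
    have hptr := h₃.pointer
    have hreal := h₃.real
    refine Program.Halts.seq (hbody s₃ (by omega) ?_ ?_) ?_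
    · rw [hreal 3 (by omega), if_neg (by omega), hr]
    · rw [hreal 4 (by omega), if_neg (by omega), hR]
    rintro s₄ ⟨hnat, hval, hframe⟩
    refine Program.Halts.setNat ⟨?_, ⟨?_, ?_, ?_, ?_⟩, ?_, ?_⟩
    · simp [MachineState.setN_nat, hnat, hk]
    · simp [MachineState.setN_nat, hnat, h₃.size]
    · simp [MachineState.setN_nat, hnat, h₃.dim]
    · simp [MachineState.setN_nat, hnat, hptr, add_assoc]
    · intro a ha
      simp only [MachineState.setN_real]
      by_cases hap : a = s₃.nat 4
      · rw [hap, hval, hreal _ (by omega), if_neg (by omega), if_pos (by omega)]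
      · rw [hframe a hap ha, hreal a ha]
        by_cases hlt : 64 ≤ a ∧ a < 64 + (i * d + k)
        · rw [if_pos hlt, if_pos (by omega)]
        · rw [if_neg hlt, if_neg (by omega)]
    · simp [MachineState.setN_nat, hnat, hi₃]
    · simp [MachineState.setN_nat]
  · rintro s₃ ⟨h₃, hi₃, -⟩
    refine ⟨hi₃, ?_, by simp [MachineState.setN_nat]⟩
    rw [Nat.succ_mul]
    exact h₃.setN (.inl rfl) _

theorem index_lt {n d i k : ℕ} (hi : i < n) (hk : k < d) : i * d + k < n * d := by
  calc i * d + k < i * d + d := by omega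
    _ = (i + 1) * d := by ring
    _ ≤ n * d := Nat.mul_le_mul_right d hi

/-- A partition whose rounding map acts on the coordinates by a short program is handled by the
loop. -/
theorem roundsWithin_roundLoop {d n B : ℕ} (hd : 1 ≤ d) (hn : 3 ≤ n) {p K : ℝ} {θ : Tuning}
    {body : Program} {f : ℝ → ℝ} (hbody : RoundsEntry body f θ.r θ.R B) {Q : CenteredPartition d}
    (hQ : ∀ x i, Q.round x i = f (x i)) (hK : (B : ℝ) + 55 ≤ K) :
    RoundsWithin n p θ Q (roundLoop body) (K * (d * n * Real.log n)) := by
  intro x y s hs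
  obtain ⟨t, s', hrun, ht, h⟩ := halts_roundLoop hbody hs.size hs.dim hs.side hs.radius
  have hlow : ∀ a < 5, s'.real a = s.real a := fun a ha => by
    rw [h.real a (.inl ha), if_neg (by omega)]
  refine ⟨t, s', hrun, ?_, h.size, h.dim, ?_, ?_, ?_, ?_, ?_, ?_, ?_⟩
  · have hl : 1 ≤ Real.log n := one_le_log hn
    have hdn : 1 ≤ d * n := Nat.mul_pos hd (by omega)
    have hn' : n ≤ d * n := Nat.le_mul_of_pos_left n hd
    have ht' : t ≤ (B + 55) * (d * n) := by nlinarith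
    calc (t : ℝ) ≤ ((B + 55) * (d * n) : ℕ) := by exact_mod_cast ht'
      _ = (B + 55) * (d * n * 1) := by push_cast; ring
      _ ≤ K * (d * n * Real.log n) := by
          have : (0 : ℝ) ≤ K := by linarith [(Nat.cast_nonneg B : (0 : ℝ) ≤ B)]
          gcongr
  · rw [hlow 0 (by omega), hs.exponent]
  · rw [hlow 1 (by omega), hs.accuracy]
  · rw [hlow 2 (by omega), hs.temperature]
  · rw [hlow 3 (by omega), hs.side]
  · rw [hlow 4 (by omega), hs.radius]
  · intro i k
    have := index_lt i.2 k.2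
    rw [h.real _ (.inr (by omega)), if_pos (by omega), hs.source i k, hQ]
  · intro j k
    rw [h.real _ (.inr (by omega)), if_neg (by omega), hs.target j k]

/-- The real cell that is being rounded. -/
def entry : RExpr := .mem (.reg 4)

/-- Rounding to the lower end of an interval of length `r`. -/
def roundCubesEntry : Program :=
  .setReal (.reg 4) (.times (.reg 3) (.floor (.divide entry (.reg 3))))

theorem roundsEntry_cubes (r R : ℝ) :
    RoundsEntry roundCubesEntry (fun t => r * ⌊t / r⌋) r R 13 := by
  intro s _ hr _
  refine Program.Halts.setReal ⟨rfl, ?_, fun a ha _ => ?_⟩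
  · simp [MachineState.setR_real, entry, hr]
  · simp [MachineState.setR_real, ha]

/-- The constant `2`. -/
def RExpr.two : RExpr := .ofNat (.const 2)

def RExpr.neg (a : RExpr) : RExpr := .minus (.ofNat (.const 0)) a

/-- Square roots of positive numbers. -/
def RExpr.sqrt (a : RExpr) : RExpr := .exp (.divide (.log a) .two)

def RExpr.arsinh (a : RExpr) : RExpr :=
  .log (.plus a (.sqrt (.plus (.ofNat (.const 1)) (.times a a))))

def RExpr.sinh (a : RExpr) : RExpr := .divide (.minus (.exp a) (.exp a.neg)) .two

@[simp] theorem RExpr.eval_neg (s : MachineState) (a : RExpr) : a.neg.eval s = -a.eval s := by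
  simp [RExpr.neg]

@[simp] theorem RExpr.eval_arsinh (s : MachineState) (a : RExpr) :
    a.arsinh.eval s = Real.arsinh (a.eval s) := by
  have h : 0 < 1 + a.eval s * a.eval s := by nlinarith [mul_self_nonneg (a.eval s)]
  have h₂ : Real.exp (Real.log (1 + a.eval s * a.eval s) / 2) = √(1 + a.eval s ^ 2) := by
    rw [← sq] at h ⊢
    rw [← Real.log_sqrt h.le, Real.exp_log (Real.sqrt_pos.2 h)]
  simp [RExpr.arsinh, RExpr.sqrt, RExpr.two, h₂, Real.arsinh]

@[simp] theorem RExpr.eval_sinh (s : MachineState) (a : RExpr) :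
    a.sinh.eval s = Real.sinh (a.eval s) := by
  simp [RExpr.sinh, RExpr.two, Real.sinh_eq]

/-- Writes into the real cell `i` the value of `a`, clamped to the interval bounded by the real
cell `j` and its negative. -/
def clampInto (i j : ℕ) (a : RExpr) : Program :=
  .seq (.setReal (.const i) a)
    (.seq (.ite (.realLe (.reg j) (.reg i)) (.setReal (.const i) (.reg j)) .skip)
      (.ite (.realLe (.reg i) (RExpr.neg (.reg j)))
        (.setReal (.const i) (RExpr.neg (.reg j))) .skip))

theorem halts_clampInto {i j : ℕ} (hij : i ≠ j) (a : RExpr) (s : MachineState)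
    {post : MachineState → Prop} (h : post (s.setR i (clamp (s.real j) (a.eval s)))) :
    (clampInto i j a).Halts s (a.cost + 28) post := by
  set x := a.eval s
  set y := s.real j
  have hji : j ≠ i := hij.symm
  refine (Program.Halts.seq (mid := fun s' => s' = s.setR i x) (T₁ := a.cost + 2) (T₂ := 26) ?_
    ?_).mono (by omega) fun _ h => h
  · exact (Program.Halts.setReal (post := fun s' => s' = s.setR i x) rfl).mono
      (by simp [NExpr.cost]; omega) fun _ h => h
  rintro _ rfl
  refine Program.Halts.seq (mid := fun s' => s' = s.setR i (min y x)) (T₁ := 5 + 6) (T₂ := 9 + 6)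
    ?_ ?_
  · refine Program.Halts.ite (b := .realLe (.reg j) (.reg i)) (fun hb => ?_) fun hb => ?_
    · have hb' : y ≤ x := by simpa [MachineState.setR_real, hji] using hb
      refine (Program.Halts.setReal ?_).mono (by simp [NExpr.cost, RExpr.cost, RExpr.reg])
        fun _ h => h
      simp [MachineState.setR, hji, min_eq_left hb', y]
    · have hb' : x < y := by simpa [MachineState.setR_real, hji] using hb
      refine (Program.Halts.skip ?_).mono (by omega) fun _ h => h
      rw [min_eq_right hb'.le]
  rintro _ rfl
  refine (Program.Halts.ite (b := .realLe (.reg i) (RExpr.neg (.reg j))) (T := 7) (fun hb => ?_)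
    fun hb => ?_).mono (by simp [Test.cost, RExpr.cost, RExpr.reg, RExpr.neg, NExpr.cost])
      fun _ h => h
  · have hb' : min y x ≤ -y := by
      have := hb
      simp only [Test.holds_realLe, RExpr.eval_reg, RExpr.eval_neg, MachineState.setR_real,
        if_true, if_neg hji] at this
      exact this
    refine (Program.Halts.setReal ?_).mono
      (by simp [NExpr.cost, RExpr.cost, RExpr.reg, RExpr.neg]) fun _ h => h
    simpa [MachineState.setR, hji, clamp, max_eq_left hb', y] using h
  · have hb' : -y < min y x := by
      have := hb
      simp only [Test.holds_realLe, RExpr.eval_reg, RExpr.eval_neg, MachineState.setR_real,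
        if_true, if_neg hji, not_le] at this
      exact this
    refine (Program.Halts.skip ?_).mono (by omega) fun _ h => h
    rwa [clamp, max_eq_right hb'.le] at h

/-- Rounding to the lower end of an interval of length `r` on the scale `truncScale R`. -/
def roundCellsEntry : Program :=
  .seq (clampInto 5 4 entry)
    (.seq (.setReal (.const 6) (.times (.reg 3) (.floor (.divide
        (.plus (RExpr.arsinh (.reg 5)) (.divide (.minus entry (.reg 5)) (.reg 4))) (.reg 3)))))
      (.seq (.setReal (.const 7) (RExpr.arsinh (.reg 4)))
        (.seq (clampInto 5 7 (.reg 6))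
          (.setReal (.reg 4) (.plus (RExpr.sinh (.reg 5))
            (.times (.reg 4) (.minus (.reg 6) (.reg 5))))))))

theorem roundsEntry_cells (r R : ℝ) :
    RoundsEntry roundCellsEntry (fun t => truncScaleInv R (r * ⌊truncScale R t / r⌋)) r R 250 := by
  intro s h4 hr hR
  have hne' : ∀ k < 64, s.nat 4 ≠ k := fun k hk => by omega
  refine (Program.Halts.seq (halts_clampInto (by norm_num) _ s rfl) ?_).mono
    (T₁ := 3 + 28 + (60 + (30 + (30 + 50)))) (by norm_num) fun _ h => h
  rintro _ rfl
  refine Program.Halts.seq ((Program.Halts.setReal rfl).mono ?_ fun _ h => h) ?_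
  · simp [NExpr.cost, RExpr.cost, RExpr.reg, RExpr.arsinh, RExpr.sqrt, RExpr.two, entry,
      NExpr.reg]
  rintro _ rfl
  refine Program.Halts.seq ((Program.Halts.setReal rfl).mono ?_ fun _ h => h) ?_
  · simp [NExpr.cost, RExpr.cost, RExpr.reg, RExpr.arsinh, RExpr.sqrt, RExpr.two]
  rintro _ rfl
  refine Program.Halts.seq ((halts_clampInto (by norm_num) _ _ rfl).mono ?_ fun _ h => h) ?_
  · simp [NExpr.cost, RExpr.cost, RExpr.reg]
  rintro _ rfl
  refine (Program.Halts.setReal ?_).mono ?_ fun _ h => h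
  · refine ⟨rfl, ?_, fun a ha ha' => ?_⟩
    · simp [MachineState.setR_real, hr, hR, entry, hne', truncScale, truncScaleInv]
    · have : a ≠ 5 ∧ a ≠ 6 ∧ a ≠ 7 := by omega
      simp [MachineState.setR_real, ha, this]
  · simp [NExpr.cost, RExpr.cost, RExpr.reg, RExpr.sinh, RExpr.neg, RExpr.two, NExpr.reg]

end

section

/-! ### The auction algorithm -/

/-- The invariant of the auction for the costs `c` with bid increment `e`. The sources
`0, …, m - 1` have entered the auction, and each of them owns a target except the bidder `cur`;
`owner j` is the owner of the target `j` and `bids j` the number of bids it has received, so that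
its price is `e * bids j`. The auction is over when `cur = n`. -/
structure AuctionState {n : ℕ} (c : Fin n → Fin n → ℝ) (e : ℝ) (N m cur : ℕ)
    (owner : Fin n → Option (Fin n)) (bids : Fin n → ℕ) : Prop where
  cur_lt : cur < m
  cur_le : cur ≤ n
  entered : cur < n → m ≤ n
  owns : ∀ i : Fin n, (∃ j, owner j = some i) ↔ (i : ℕ) < m ∧ (i : ℕ) ≠ cur
  unique : ∀ j j' i, owner j = some i → owner j' = some i → j = j'
  /-- Each owner is content up to the increment `e`. -/
  content : ∀ j i, owner j = some i → ∀ j', c i j + e * bids j ≤ c i j' + e * bids j' + e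
  free : ∀ j, owner j = none → bids j = 0
  bids_le : ∀ j, bids j ≤ N

namespace AuctionState

variable {n N m cur : ℕ} {c : Fin n → Fin n → ℝ} {e : ℝ} {owner : Fin n → Option (Fin n)}
  {bids : Fin n → ℕ}

theorem init (hn : 0 < n) : AuctionState c e N 1 0 (fun _ => none) (fun _ => 0) where
  cur_lt := Nat.zero_lt_one
  cur_le := Nat.zero_le n
  entered _ := hn
  owns i := by simp
  unique := by simp
  content := by simp
  free := by simp
  bids_le := by simp

theorem exists_free (h : AuctionState c e N m cur owner bids) (hcur : cur < n) :
    ∃ j, owner j = none := by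
  by_contra! hall
  choose f hf using fun j => Option.ne_none_iff_exists'.1 (hall j)
  have hinj : Function.Injective f := fun j j' hjj' =>
    h.unique j j' (f j) (hf j) (hjj' ▸ hf j')
  obtain ⟨j, hj⟩ := (Finite.injective_iff_surjective.1 hinj) ⟨cur, hcur⟩
  exact ((h.owns ⟨cur, hcur⟩).1 ⟨j, hj ▸ hf j⟩).2 rfl

/-- One bid: the bidder takes its best target `j`, raises the price by `e`, and the previous owner
(or the next source to enter) becomes the bidder. As long as there is a free target, whose price
is zero, the prices of the targets that receive a bid are bounded by the largest cost. -/
theorem bid (h : AuctionState c e N m cur owner bids) (hcur : cur < n) (he : 0 < e)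
    (hc0 : ∀ i j, 0 ≤ c i j) (hcN : ∀ i j, c i j < e * N) {j : Fin n}
    (hj : ∀ j', c ⟨cur, hcur⟩ j + e * bids j ≤ c ⟨cur, hcur⟩ j' + e * bids j') :
    AuctionState c e N (if owner j = none then m + 1 else m)
      ((owner j).elim m fun i => (i : ℕ))
      (Function.update owner j (some ⟨cur, hcur⟩)) (Function.update bids j (bids j + 1)) := by
  have hmn := h.entered hcur
  have hbid : bids j + 1 ≤ N := by
    obtain ⟨j', hj'⟩ := h.exists_free hcur
    have h₁ := hj j'
    rw [h.free j' hj'] at h₁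
    have h₂ := hcN ⟨cur, hcur⟩ j'
    have h₃ := hc0 ⟨cur, hcur⟩ j
    have h₄ : e * bids j < e * N := by simp only [Nat.cast_zero, mul_zero, add_zero] at h₁; linarith
    have h₅ : (bids j : ℝ) < N := lt_of_mul_lt_mul_left h₄ he.le
    exact_mod_cast h₅
  have hown : ∀ j i, owner j = some i → (i : ℕ) < m ∧ (i : ℕ) ≠ cur :=
    fun j i hji => (h.owns i).1 ⟨j, hji⟩
  have hupd : ∀ j' i, Function.update owner j (some ⟨cur, hcur⟩) j' = some i ↔
      (j' = j ∧ (i : ℕ) = cur) ∨ (j' ≠ j ∧ owner j' = some i) := by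
    intro j' i
    by_cases hjj : j' = j
    · subst hjj
      simp [Fin.ext_iff, eq_comm]
    · simp [hjj]
  have hmono : ∀ j', (bids j' : ℝ) ≤ (Function.update bids j (bids j + 1) j' : ℕ) := by
    intro j'
    by_cases hjj : j' = j
    · subst hjj; simp
    · simp [hjj]
  refine ⟨?_, ?_, ?_, ?_, ?_, ?_, ?_, ?_⟩
  · rcases ho : owner j with _ | i
    · simp
    · simpa using (hown j i ho).1
  · rcases ho : owner j with _ | i
    · simpa using hmn
    · simp
  · rcases ho : owner j with _ | i
    · simp
    · simpa using hmn
  · intro i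
    simp only [hupd]
    rcases ho : owner j with _ | i₀
    · simp only [if_true, Option.elim_none]
      constructor
      · rintro ⟨j', ⟨-, hi⟩ | ⟨-, hi⟩⟩
        · have := h.cur_lt; omega
        · have := hown j' i hi; omega
      · rintro ⟨hi, hi'⟩
        by_cases hic : (i : ℕ) = cur
        · exact ⟨j, .inl ⟨rfl, hic⟩⟩
        · obtain ⟨j', hj'⟩ := (h.owns i).2 ⟨by omega, hic⟩
          exact ⟨j', .inr ⟨fun hjj => by rw [hjj, ho] at hj'; exact absurd hj' (by simp), hj'⟩⟩
    · simp only [reduceCtorEq, if_false, Option.elim_some]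
      have hi₀ := hown j i₀ ho
      constructor
      · rintro ⟨j', ⟨-, hi⟩ | ⟨hjj, hi⟩⟩
        · have := h.cur_lt; omega
        · refine ⟨(hown j' i hi).1, fun hii => hjj (h.unique j' j i hi ?_)⟩
          rw [ho, Fin.ext hii]
      · rintro ⟨hi, hi'⟩
        by_cases hic : (i : ℕ) = cur
        · exact ⟨j, .inl ⟨rfl, hic⟩⟩
        · obtain ⟨j', hj'⟩ := (h.owns i).2 ⟨hi, hic⟩
          refine ⟨j', .inr ⟨fun hjj => hi' ?_, hj'⟩⟩
          rw [hjj, ho] at hj'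
          rw [Option.some.inj hj']
  · intro j₁ j₂ i h₁ h₂
    rw [hupd] at h₁ h₂
    rcases h₁ with ⟨rfl, h₁⟩ | ⟨_, h₁⟩ <;> rcases h₂ with ⟨rfl, h₂⟩ | ⟨_, h₂⟩
    · rfl
    · exact absurd h₁ (hown j₂ i h₂).2
    · exact absurd h₂ (hown j₁ i h₁).2
    · exact h.unique _ _ i h₁ h₂
  · intro j₁ i h₁ j'
    have hj'm := mul_le_mul_of_nonneg_left (hmono j') he.le
    rcases (hupd j₁ i).1 h₁ with ⟨rfl, hi⟩ | ⟨hne, hi⟩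
    · obtain rfl : i = ⟨cur, hcur⟩ := Fin.ext hi
      have := hj j'
      rw [Function.update_self]
      push_cast
      linarith
    · rw [Function.update_of_ne hne]
      have := h.content j₁ i hi j'
      linarith
  · intro j' hj'
    by_cases hjj : j' = j
    · subst hjj; simp at hj'
    · rw [Function.update_of_ne hjj] at hj' ⊢
      exact h.free j' hj'
  · intro j'
    by_cases hjj : j' = j
    · subst hjj; simpa using hbid
    · rw [Function.update_of_ne hjj]; exact h.bids_le j'

theorem sum_update_bids (bids : Fin n → ℕ) (j : Fin n) :
    ∑ j', Function.update bids j (bids j + 1) j' = ∑ j', bids j' + 1 := by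
  rw [Finset.sum_update_of_mem (Finset.mem_univ j),
    ← Finset.add_sum_erase _ bids (Finset.mem_univ j), Finset.sdiff_singleton_eq_erase]
  omega

theorem sum_bids_le (h : AuctionState c e N m cur owner bids) : ∑ j, bids j ≤ n * N := by
  calc ∑ j, bids j ≤ ∑ _j : Fin n, N := Finset.sum_le_sum fun j _ => h.bids_le j
    _ = n * N := by simp

/-- A finished auction assigns the targets to the sources bijectively. -/
theorem exists_equiv (h : AuctionState c e N m n owner bids) :
    ∃ σ : Fin n ≃ Fin n, ∀ i j, owner j = some i ↔ σ i = j := by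
  choose f hf using fun i : Fin n => (h.owns i).2 ⟨by have := h.cur_lt; omega, i.2.ne⟩
  have hinj : Function.Injective f := fun i i' hii' => by
    have := hf i
    rw [hii', hf i'] at this
    exact (Option.some.inj this).symm
  refine ⟨Equiv.ofBijective f (Finite.injective_iff_bijective.1 hinj), fun i j => ?_⟩
  simp only [Equiv.ofBijective_apply]
  exact ⟨fun hj => h.unique _ _ i (hf i) hj, fun hj => hj ▸ hf i⟩

end AuctionState

end

section

/-! ### Assignments as near-optimal couplings -/

theorem wasserstein_rpow_eq {d : ℕ} {p : ℝ} (hp : 0 < p) (μ ν : Measure (E d)) :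
    wasserstein p μ ν ^ p = ⨅ π ∈ couplings μ ν, couplingCost p π := by
  rw [wasserstein, ← ENNReal.rpow_mul, one_div_mul_cancel hp.ne', ENNReal.rpow_one]

/-- A density bounded by `c` bounds the Kullback-Leibler divergence by `log c`. -/
theorem klDiv_le_log {α : Type*} [MeasurableSpace α] {μ ν : Measure α} [IsProbabilityMeasure μ]
    [IsProbabilityMeasure ν] {c : ℝ} (hc : 1 ≤ c) (h : μ ≤ ENNReal.ofReal c • ν) :
    InformationTheory.klDiv μ ν ≤ ENNReal.ofReal (Real.log c) := by
  have hc0 : 0 < c := by linarith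
  have hac : μ ≪ ν := Measure.absolutelyContinuous_of_le_smul h
  have hle : ∀ᵐ x ∂ν, (μ.rnDeriv ν x).toReal ≤ c := by
    have h₁ : ∀ᵐ x ∂ν, μ.rnDeriv ν x ≤ ENNReal.ofReal c := by
      refine ae_le_of_forall_setLIntegral_le_of_sigmaFinite (Measure.measurable_rnDeriv μ ν)
        fun s hs _ => ?_
      rw [setLIntegral_const]
      exact (Measure.setLIntegral_rnDeriv_le s).trans (h s)
    filter_upwards [h₁] with x hx
    exact ENNReal.toReal_le_of_le_ofReal hc0.le hx
  set f : α → ℝ := fun x => (μ.rnDeriv ν x).toReal * Real.log c + (1 - (μ.rnDeriv ν x).toReal)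
    with hf
  have hint : Integrable (fun x => (μ.rnDeriv ν x).toReal) ν := Measure.integrable_toReal_rnDeriv
  have hkl : ∀ᵐ x ∂ν, InformationTheory.klFun (μ.rnDeriv ν x).toReal ≤ f x := by
    filter_upwards [hle] with x hx
    simp only [InformationTheory.klFun, hf]
    rcases (ENNReal.toReal_nonneg (a := μ.rnDeriv ν x)).eq_or_lt with h0 | h0
    · rw [← h0]; simp
    · have := mul_le_mul_of_nonneg_left (Real.log_le_log h0 hx) h0.le
      linarith
  have hnn : 0 ≤ᵐ[ν] f := by
    filter_upwards [hkl] with x hx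
    exact (InformationTheory.klFun_nonneg ENNReal.toReal_nonneg).trans hx
  rw [InformationTheory.klDiv_eq_lintegral_klFun_of_ac hac]
  calc _ ≤ ∫⁻ x, ENNReal.ofReal (f x) ∂ν := by
        refine lintegral_mono_ae ?_
        filter_upwards [hkl] with x hx
        exact ENNReal.ofReal_le_ofReal hx
    _ = ENNReal.ofReal (∫ x, f x ∂ν) := by
        refine (ofReal_integral_eq_lintegral_ofReal ?_ hnn).symm
        exact (hint.mul_const _).add ((integrable_const 1).sub hint)
    _ = ENNReal.ofReal (Real.log c) := by
        have h₁ : ∫ x, f x ∂ν = ∫ x, (μ.rnDeriv ν x).toReal * Real.log c ∂ν +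
            ∫ x, (1 - (μ.rnDeriv ν x).toReal) ∂ν :=
          integral_add (hint.mul_const _) ((integrable_const 1).sub hint)
        rw [h₁, integral_sub (integrable_const 1) hint, integral_mul_const,
          Measure.integral_toReal_rnDeriv hac]
        simp

theorem map_empirical {d n : ℕ} (x : Fin n → E d) {f : E d → E d} (hf : Measurable f) :
    (empirical x).map f = empirical fun i => f (x i) := by
  refine Measure.ext_of_lintegral _ fun g hg => ?_
  rw [lintegral_map hg hf, lintegral_empirical, lintegral_empirical]

section assignment

variable {d n : ℕ} {p e : ℝ} {z y : Fin n → E d} {σ : Fin n ≃ Fin n} {v : Fin n → ℝ}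

/-- The coupling that sends `z i` to `y (σ i)`. -/
noncomputable def assignment (z y : Fin n → E d) (σ : Fin n ≃ Fin n) : Measure (E d × E d) :=
  (n : ℝ≥0∞)⁻¹ • ∑ i, Measure.dirac (z i, y (σ i))

theorem matrixMeasure_eq_assignment (hn : n ≠ 0) (z y : Fin n → E d) (σ : Fin n ≃ Fin n) :
    matrixMeasure (fun i j => if σ i = j then (1 : ℝ) / n else 0) z y = assignment z y σ := by
  have hn0 : (0 : ℝ) < n := by positivity
  have h : ENNReal.ofReal (1 / (n : ℝ)) = (n : ℝ≥0∞)⁻¹ := by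
    rw [one_div, ENNReal.ofReal_inv_of_pos hn0, ENNReal.ofReal_natCast]
  unfold matrixMeasure assignment
  rw [Finset.smul_sum]
  refine Finset.sum_congr rfl fun i _ => ?_
  rw [Finset.sum_eq_single (σ i)]
  · simp only [if_true, h]
  · intro j _ hj
    simp only [if_neg (Ne.symm hj), ENNReal.ofReal_zero, zero_smul]
  · simp

theorem lintegral_assignment (f : E d × E d → ℝ≥0∞) :
    ∫⁻ w, f w ∂(assignment z y σ) = (n : ℝ≥0∞)⁻¹ * ∑ i, f (z i, y (σ i)) := by
  simp [assignment]

theorem assignment_mem_couplings : assignment z y σ ∈ couplings (empirical z) (empirical y) := by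
  constructor <;> refine Measure.ext_of_lintegral _ fun f hf => ?_
  · rw [Measure.fst, lintegral_map hf measurable_fst, lintegral_assignment, lintegral_empirical]
  · rw [Measure.snd, lintegral_map hf measurable_snd, lintegral_assignment, lintegral_empirical]
    congr 1
    exact Equiv.sum_comp σ fun j => f (y j)

theorem couplingCost_assignment (hp : 0 ≤ p) :
    couplingCost p (assignment z y σ) = (n : ℝ≥0∞)⁻¹ * ∑ i, ‖z i - y (σ i)‖ₑ ^ p := by
  rw [couplingCost_eq hp, lintegral_assignment]

/-- Prices at which every source is content with its target up to `e` certify that the assignment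
is optimal up to `e`: they give a dual solution of the transport problem. -/
theorem couplingCost_assignment_le (hp : 0 < p) (hn : n ≠ 0) (hv : ∀ j, 0 ≤ v j)
    (hcontent : ∀ i j, ‖z i - y (σ i)‖ ^ p + v (σ i) ≤ ‖z i - y j‖ ^ p + v j + e)
    (he : 0 ≤ e) {π : Measure (E d × E d)} (hπ : π ∈ couplings (empirical z) (empirical y)) :
    couplingCost p (assignment z y σ) ≤ couplingCost p π + ENNReal.ofReal e := by
  set V : Fin n → ℝ≥0∞ := fun j => ENNReal.ofReal (v j)
  set φ : E d → ℝ≥0∞ := fun a => ⨅ j, (‖a - y j‖ₑ ^ p + V j) with hφ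
  set ψ : E d → ℝ≥0∞ := fun b => ⨆ i, (φ (z i) - ‖z i - b‖ₑ ^ p) with hψ
  have hφm : Measurable φ := Measurable.iInf fun j => by fun_prop
  have hψm : Measurable ψ := Measurable.iSup fun i => by fun_prop
  have hφle : ∀ i, ‖z i - y (σ i)‖ₑ ^ p + V (σ i) ≤ φ (z i) + ENNReal.ofReal e := by
    intro i
    rw [hφ, ENNReal.iInf_add]
    refine le_iInf fun j => ?_
    simp only [← ofReal_norm_rpow hp.le, V]
    rw [← ENNReal.ofReal_add (by positivity) (hv _), ← ENNReal.ofReal_add (by positivity) (hv _),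
      ← ENNReal.ofReal_add (add_nonneg (by positivity) (hv _)) he]
    exact ENNReal.ofReal_le_ofReal (hcontent i j)
  have hψle : ∀ j, ψ (y j) ≤ V j := fun j => iSup_le fun i => by
    rw [tsub_le_iff_left]
    exact iInf_le _ j
  have hae : ∀ᵐ w ∂π, φ w.1 ≤ ‖w.1 - w.2‖ₑ ^ p + ψ w.2 := by
    have h₁ : ∀ᵐ a ∂(π.map Prod.fst), a ∈ Set.range z := by
      change ∀ᵐ a ∂π.fst, a ∈ Set.range z
      rw [hπ.1, ae_iff]
      simp [empirical]
    filter_upwards [ae_of_ae_map measurable_fst.aemeasurable h₁] with w hw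
    obtain ⟨i, hi⟩ := hw
    rw [← hi]
    refine le_add_tsub.trans (add_le_add le_rfl ?_)
    exact le_iSup (fun i => φ (z i) - ‖z i - w.2‖ₑ ^ p) i
  have hdual : (n : ℝ≥0∞)⁻¹ * ∑ i, φ (z i) ≤
      couplingCost p π + (n : ℝ≥0∞)⁻¹ * ∑ j, V j := by
    calc (n : ℝ≥0∞)⁻¹ * ∑ i, φ (z i) = ∫⁻ w, φ w.1 ∂π := by
          rw [← lintegral_empirical, ← hπ.1, Measure.fst, lintegral_map hφm measurable_fst]
      _ ≤ ∫⁻ w, (‖w.1 - w.2‖ₑ ^ p + ψ w.2) ∂π := lintegral_mono_ae hae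
      _ = couplingCost p π + (n : ℝ≥0∞)⁻¹ * ∑ j, ψ (y j) := by
          rw [lintegral_add_left (measurable_cost p), couplingCost_eq hp.le,
            ← lintegral_empirical, ← hπ.2, Measure.snd, lintegral_map hψm measurable_snd]
      _ ≤ _ := by gcongr with j; exact hψle j
  have hninv : (n : ℝ≥0∞)⁻¹ ≠ ∞ := by simpa using hn
  have hfin : (n : ℝ≥0∞)⁻¹ * ∑ j, V j ≠ ∞ :=
    ENNReal.mul_ne_top hninv (ENNReal.sum_ne_top.2 fun j _ => ENNReal.ofReal_ne_top)
  rw [couplingCost_assignment hp.le, ← ENNReal.add_le_add_iff_right hfin]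
  calc (n : ℝ≥0∞)⁻¹ * ∑ i, ‖z i - y (σ i)‖ₑ ^ p + (n : ℝ≥0∞)⁻¹ * ∑ j, V j
      = (n : ℝ≥0∞)⁻¹ * ∑ i, (‖z i - y (σ i)‖ₑ ^ p + V (σ i)) := by
        rw [Finset.sum_add_distrib, mul_add, Equiv.sum_comp σ V]
    _ ≤ (n : ℝ≥0∞)⁻¹ * ∑ i, (φ (z i) + ENNReal.ofReal e) := by
        exact mul_le_mul_right (Finset.sum_le_sum fun i _ => hφle i) _
    _ = (n : ℝ≥0∞)⁻¹ * ∑ i, φ (z i) + ENNReal.ofReal e := by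
        rw [Finset.sum_add_distrib, mul_add]
        simp only [Finset.sum_const, Finset.card_univ, Fintype.card_fin, nsmul_eq_mul]
        rw [← mul_assoc, ENNReal.inv_mul_cancel (by simpa using hn) (by simp), one_mul]
    _ ≤ couplingCost p π + (n : ℝ≥0∞)⁻¹ * ∑ j, V j + ENNReal.ofReal e := by gcongr
    _ = _ := by ring

theorem assignment_le_smul_prod (hn : n ≠ 0) :
    assignment z y σ ≤ ENNReal.ofReal n • (empirical z).prod (empirical y) := by
  have := isProbabilityMeasure_empirical hn y
  have hnn : (n : ℝ≥0∞) * (n : ℝ≥0∞)⁻¹ = 1 := ENNReal.mul_inv_cancel (by simpa using hn) (by simp)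
  refine Measure.le_iff.2 fun s hs => ?_
  have hm : Measurable (s.indicator (1 : E d × E d → ℝ≥0∞)) := measurable_one.indicator hs
  rw [Measure.smul_apply, ← lintegral_indicator_one hs, ← lintegral_indicator_one hs,
    lintegral_assignment, lintegral_prod _ hm.aemeasurable, lintegral_empirical]
  simp only [lintegral_empirical, ENNReal.ofReal_natCast, smul_eq_mul]
  rw [← mul_assoc, hnn, one_mul, ← Finset.mul_sum]
  gcongr with i
  exact Finset.single_le_sum (f := fun j => s.indicator (1 : E d × E d → ℝ≥0∞) (z i, y j))
    (fun _ _ => zero_le) (Finset.mem_univ (σ i))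

/-- The conditional kernel of an assignment, with values supported on the targets. -/
theorem exists_kernel_assignment (hn : n ≠ 0) :
    ∃ κ : Kernel (E d) (E d), IsMarkovKernel κ ∧ (∀ c, κ c (Set.range y)ᶜ = 0) ∧
      empirical z ⊗ₘ κ = assignment z y σ := by
  classical
  have := isProbabilityMeasure_empirical hn z
  have hfst : (assignment z y σ).fst = empirical z := assignment_mem_couplings.1
  have : IsFiniteMeasure (assignment z y σ) := ⟨by
    rw [← Measure.fst_univ, hfst]; exact measure_lt_top _ _⟩
  have hdis : empirical z ⊗ₘ (assignment z y σ).condKernel = assignment z y σ := by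
    rw [← hfst]; exact (assignment z y σ).disintegrate _
  have hz : MeasurableSet (Set.range z) := (Set.finite_range z).measurableSet
  have hy : MeasurableSet (Set.range y)ᶜ := (Set.finite_range y).measurableSet.compl
  have hsupp : ∀ i, (assignment z y σ).condKernel (z i) (Set.range y)ᶜ = 0 := by
    have h₀ : assignment z y σ (Set.univ ×ˢ (Set.range y)ᶜ) = 0 := by
      simp [assignment]
    rw [← hdis, Measure.compProd_apply_prod .univ hy, Measure.restrict_univ,
      lintegral_empirical] at h₀
    have h₁ := (mul_eq_zero.1 h₀).resolve_left (by simp)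
    exact fun i => (Finset.sum_eq_zero_iff.1 h₁) i (Finset.mem_univ i)
  obtain ⟨j₀⟩ : Nonempty (Fin n) := ⟨⟨0, Nat.pos_of_ne_zero hn⟩⟩
  set κ : Kernel (E d) (E d) :=
    Kernel.piecewise hz (assignment z y σ).condKernel (Kernel.const _ (Measure.dirac (y j₀)))
  have hκ : ∀ i, κ (z i) = (assignment z y σ).condKernel (z i) := fun i => by
    rw [Kernel.piecewise_apply, if_pos ⟨i, rfl⟩]
  refine ⟨κ, inferInstance, fun c => ?_, ?_⟩
  · rw [Kernel.piecewise_apply]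
    split_ifs with hc
    · obtain ⟨i, rfl⟩ := hc
      exact hsupp i
    · rw [Kernel.const_apply, Measure.dirac_apply' _ hy]
      simp
  · rw [← hdis]
    refine Measure.compProd_congr ?_
    have h₁ : ∀ᵐ a ∂(empirical z), a ∈ Set.range z := by
      rw [ae_iff]
      simp [empirical]
    filter_upwards [h₁]
    rintro _ ⟨i, rfl⟩
    exact hκ i

/-- An assignment supported by prices solves the entropic problem, and its conditional kernel is an
admissible preliminary kernel. The entropy of an assignment relative to the independent coupling
is at most `log n`, so that a small temperature does not matter. -/
theorem assignment_solves (hp : 1 ≤ p) (hn : 3 ≤ n) {δ τ : ℝ} (Q : CenteredPartition d)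
    (x y : Fin n → E d) {σ : Fin n ≃ Fin n} (hv : ∀ j, 0 ≤ v j) (hτ : 0 ≤ τ)
    (hcontent : ∀ i j, ‖Q.round (x i) - y (σ i)‖ ^ p + v (σ i) ≤
      ‖Q.round (x i) - y j‖ ^ p + v j + e)
    (he : 0 ≤ e) (hδ : e + τ * Real.log n ≤ δ) :
    let π : Fin n → Fin n → ℝ := fun i j => if σ i = j then 1 / n else 0
    matrixMeasure π (fun i => Q.round (x i)) y ∈
      couplings ((empirical x).map Q.round) (empirical y) ∧
    entropicCost p τ ((empirical x).map Q.round) (empirical y)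
        (matrixMeasure π (fun i => Q.round (x i)) y) ≤
      entropicValue p τ ((empirical x).map Q.round) (empirical y) + ENNReal.ofReal δ ∧
    ∃ κ : Kernel (E d) (E d), IsPreliminaryKernel p δ Q x y κ ∧
      (empirical x).map Q.round ⊗ₘ κ = matrixMeasure π (fun i => Q.round (x i)) y := by
  have hp0 : 0 < p := by linarith
  have hn0 : n ≠ 0 := by omega
  have hl : 1 ≤ Real.log n := one_le_log hn
  intro π
  set z : Fin n → E d := fun i => Q.round (x i)
  have hz : (empirical x).map Q.round = empirical z := map_empirical x Q.measurable_round
  have hπ : matrixMeasure π z y = assignment z y σ := matrixMeasure_eq_assignment hn0 z y σ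
  have := isProbabilityMeasure_empirical hn0 z
  have := isProbabilityMeasure_empirical hn0 y
  rw [hz, hπ]
  have hmem : assignment z y σ ∈ couplings (empirical z) (empirical y) := assignment_mem_couplings
  have : IsProbabilityMeasure (assignment z y σ) := ⟨by
    rw [← Measure.fst_univ, hmem.1]; exact measure_univ⟩
  have hopt : couplingCost p (assignment z y σ) ≤
      wasserstein p (empirical z) (empirical y) ^ p + ENNReal.ofReal e := by
    rw [wasserstein_rpow_eq hp0]
    simp only [ENNReal.iInf_add]
    exact le_iInf₂ fun π hπ => couplingCost_assignment_le hp0 hn0 hv hcontent he hπ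
  have hτl : 0 ≤ τ * Real.log n := by positivity
  refine ⟨hmem, ?_, ?_⟩
  · have hkl : InformationTheory.klDiv (assignment z y σ) ((empirical z).prod (empirical y)) ≤
        ENNReal.ofReal (Real.log n) := by
      refine klDiv_le_log ?_ (assignment_le_smul_prod hn0)
      exact_mod_cast (by omega : 1 ≤ n)
    have hval : wasserstein p (empirical z) (empirical y) ^ p ≤
        entropicValue p τ (empirical z) (empirical y) := by
      rw [wasserstein_rpow_eq hp0]
      exact iInf₂_mono fun π _ => le_self_add
    calc entropicCost p τ (empirical z) (empirical y) (assignment z y σ)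
        ≤ (wasserstein p (empirical z) (empirical y) ^ p + ENNReal.ofReal e) +
          ENNReal.ofReal τ * ENNReal.ofReal (Real.log n) := by
          unfold entropicCost
          gcongr
      _ = wasserstein p (empirical z) (empirical y) ^ p +
          ENNReal.ofReal (e + τ * Real.log n) := by
          rw [← ENNReal.ofReal_mul hτ, add_assoc, ENNReal.ofReal_add he hτl]
      _ ≤ _ := by gcongr
  · obtain ⟨κ, hκ, hsupp, hcomp⟩ := exists_kernel_assignment (z := z) (y := y) (σ := σ) hn0
    refine ⟨κ, ⟨hκ, fun c _ => hsupp c, ?_, ?_⟩, hcomp⟩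
    · rw [hz, ← Measure.snd_compProd, hcomp]
      exact hmem.2
    · rw [hz]
      have : kernelCost p κ (empirical z) = couplingCost p (assignment z y σ) := by
        rw [← hcomp, kernelCost_eq hp0.le, couplingCost_eq hp0.le,
          Measure.lintegral_compProd (measurable_cost p)]
      rw [this]
      refine hopt.trans ?_
      gcongr
      linarith

end assignment

end

section

/-! ### The solver: addresses and costs -/

open Program

/-- The base addresses of the target samples, of the matrix and of the price table are in the
natural cells `10`, `11`, `12`. -/
structure Ready (n d : ℕ) (s : MachineState) : Prop where
  size : s.nat 0 = n
  dim : s.nat 1 = d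
  target : s.nat 10 = 64 + n * d
  matrix : s.nat 11 = 64 + 2 * (n * d)
  price : s.nat 12 = 64 + 2 * (n * d) + n * n

theorem Ready.congr {n d : ℕ} {s s' : MachineState} (h : Ready n d s)
    (hs : ∀ a, a = 0 ∨ a = 1 ∨ a = 10 ∨ a = 11 ∨ a = 12 → s'.nat a = s.nat a) :
    Ready n d s' := by
  constructor
  · rw [hs 0 (by simp), h.size]
  · rw [hs 1 (by simp), h.dim]
  · rw [hs 10 (by simp), h.target]
  · rw [hs 11 (by simp), h.matrix]
  · rw [hs 12 (by simp), h.price]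

theorem Ready.setN {n d : ℕ} {s : MachineState} (h : Ready n d s) {a : ℕ}
    (ha : a ≠ 0 ∧ a ≠ 1 ∧ a ≠ 10 ∧ a ≠ 11 ∧ a ≠ 12) (v : ℕ) : Ready n d (s.setN a v) :=
  h.congr fun b hb => by
    rw [MachineState.setN_nat, if_neg (by omega)]

theorem Ready.setR {n d : ℕ} {s : MachineState} (h : Ready n d s) (a : ℕ) (v : ℝ) :
    Ready n d (s.setR a v) := h.congr fun _ _ => rfl

/-- Adds the content of the natural cell `j` to the natural cell `i`. -/
def addTo (i j : ℕ) : Program := .setNat (.const i) (.plus (.reg i) (.reg j))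

theorem halts_addTo {i j : ℕ} {s : MachineState} {post : MachineState → Prop}
    (h : post (s.setN i (s.nat i + s.nat j))) : (addTo i j).Halts s 7 post :=
  Halts.setNat h

/-- Adds `n` times the content of the natural cell `j` to the cell `i`. -/
theorem halts_addTo_loop {n i j : ℕ} {s : MachineState} (hn : s.nat 0 = n) (hi : i ≠ 0 ∧ i ≠ 2)
    (hj : j ≠ 2 ∧ j ≠ i) {post : MachineState → Prop}
    (h : ∀ s', (∀ a, a ≠ 2 → s'.nat a = if a = i then s.nat i + n * s.nat j else s.nat a) →
      s'.real = s.real → post s') :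
    (forLoop 2 0 (addTo i j)).Halts s (n * 20 + 10) post := by
  refine Halts.forLoop (B := 7) (N := n) (fun k s' =>
    (∀ a, a ≠ 2 → s'.nat a = if a = i then s.nat i + k * s.nat j else s.nat a) ∧
      s'.nat 2 = k ∧ s'.real = s.real) ?_ (fun k s' h => h.2.1) ?_ ?_ 
    fun s' hs' => h s' hs'.1 hs'.2.2
  · intro k s' hs'
    rw [hs'.1 0 (by omega), if_neg (by omega), hn]
  · refine ⟨fun a ha => ?_, by simp [MachineState.setN_nat], rfl⟩
    rw [MachineState.setN_nat, if_neg ha, zero_mul, add_zero]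
    split_ifs with hai
    · rw [hai]
    · rfl
  · rintro k - s' ⟨h₁, h₂, h₃⟩
    refine halts_addTo ⟨?_, fun a ha => ?_, by simp [MachineState.setN_nat], h₃⟩
    · rw [MachineState.setN_nat, if_neg (by omega), h₂]
    · rw [MachineState.setN_nat, if_neg ha, MachineState.setN_nat]
      by_cases hai : a = i
      · rw [if_pos hai, if_pos hai, h₁ i (by omega), h₁ j (by omega), if_pos rfl,
          if_neg (by omega)]
        ring
      · rw [if_neg hai, if_neg hai, h₁ a ha, if_neg hai]

/-- Stores the base addresses by repeated addition, as the machine cannot multiply natural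
numbers. -/
def computeAddresses : Program :=
  .seq (.setNat (.const 10) (.const 64)) (.seq (forLoop 2 0 (addTo 10 1))
    (.seq (.setNat (.const 11) (.plus (.reg 10) (.minus (.reg 10) (.const 64))))
      (.seq (.setNat (.const 12) (.reg 11)) (forLoop 2 0 (addTo 12 0)))))

theorem halts_computeAddresses {n d : ℕ} {s : MachineState} (hn : s.nat 0 = n)
    (hd : s.nat 1 = d) :
    computeAddresses.Halts s (n * 40 + 40) fun s' => Ready n d s' ∧ s'.real = s.real := by
  refine (Halts.seq (T₁ := 3) (T₂ := n * 20 + 10 + (9 + (4 + (n * 20 + 10))))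
    (Halts.setNat rfl) ?_).mono (by omega) fun _ h => h
  rintro _ rfl
  refine Halts.seq (halts_addTo_loop (n := n) (by simp [MachineState.setN_nat, hn]) (by simp)
    (by simp) fun s' h₁ h₂ => And.intro h₁ h₂) ?_
  rintro s₁ ⟨h₁, hr₁⟩
  refine Halts.seq (Halts.setNat rfl) ?_
  rintro _ rfl
  refine Halts.seq (Halts.setNat rfl) ?_
  rintro _ rfl
  have h0 : s₁.nat 0 = n := by rw [h₁ 0 (by simp)]; simp [MachineState.setN_nat, hn]
  have h1 : s₁.nat 1 = d := by rw [h₁ 1 (by simp)]; simp [MachineState.setN_nat, hd]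
  have h10 : s₁.nat 10 = 64 + n * d := by
    rw [h₁ 10 (by simp)]; simp [MachineState.setN_nat, hd]
  refine halts_addTo_loop (n := n) (by simp [MachineState.setN_nat, h0]) (by simp) (by simp) ?_
  intro s₂ h₂ hr₂
  refine ⟨⟨?_, ?_, ?_, ?_, ?_⟩, ?_⟩
  · rw [h₂ 0 (by simp)]; simp [MachineState.setN_nat, h0]
  · rw [h₂ 1 (by simp)]; simp [MachineState.setN_nat, h1]
  · rw [h₂ 10 (by simp)]; simp [MachineState.setN_nat, h10]
  · rw [h₂ 11 (by simp)]; simp [MachineState.setN_nat, h10]; ring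
  · rw [h₂ 12 (by simp)]; simp [MachineState.setN_nat, h10, h0]; ring
  · rw [hr₂]
    simp only [MachineState.setN_real]
    rw [hr₁, MachineState.setN_real]

/-- The squared distance of the `i`-th source and the `j`-th target in memory, as far as the first
`k` coordinates are concerned. -/
noncomputable def memSqDist (n d : ℕ) (s : MachineState) (i j k : ℕ) : ℝ :=
  ∑ l ∈ Finset.range k, (s.real (64 + i * d + l) - s.real (64 + n * d + j * d + l)) ^ 2

open Classical in
/-- The cost of the pair of the `i`-th source and the `j`-th target, as computed from the data in
memory. As `log 0 = 0`, equal points need a case of their own. -/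
noncomputable def memCost (n d : ℕ) (s : MachineState) (i j : ℕ) : ℝ :=
  if memSqDist n d s i j d ≤ 0 then 0
  else Real.exp (s.real 0 * Real.log (memSqDist n d s i j d) / 2)

/-- The difference of the current coordinates of source and target. -/
def coordinateDiff : RExpr := .minus (.mem (.plus (.reg 6) (.reg 4))) (.mem (.reg 7))

/-- Computes the cost matrix; the cells `5`, `6`, `7` hold the address of the current matrix entry,
of the current source and of the current coordinate of the target. -/
def computeCosts : Program :=
  .seq (.setNat (.const 5) (.reg 11)) (.seq (.setNat (.const 6) (.const 64))
    (forLoop 2 0 (.seq (.setNat (.const 7) (.reg 10)) (.seq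
      (forLoop 3 0 (.seq (.setReal (.const 5) (.ofNat (.const 0)))
        (.seq (forLoop 4 1 (.seq
            (.setReal (.const 5) (.plus (.reg 5) (.times coordinateDiff coordinateDiff)))
            (incr 7)))
          (.seq (.ite (.realLe (.reg 5) (.ofNat (.const 0)))
              (.setReal (.reg 5) (.ofNat (.const 0)))
              (.setReal (.reg 5) (.exp (.divide (.times (.reg 0) (.log (.reg 5))) .two))))
            (incr 5)))))
      (addTo 6 1)))))

/-- The state in which the first `m` entries of the cost matrix are computed, and the current
source is `i`. -/
structure CostProgress (n d : ℕ) (s₀ : MachineState) (m i : ℕ) (s : MachineState) : Prop where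
  ready : Ready n d s
  pointer : s.nat 5 = 64 + 2 * (n * d) + m
  source : s.nat 6 = 64 + i * d
  low : ∀ a < 64 + 2 * (n * d), a ≠ 5 → s.real a = s₀.real a
  done : ∀ l < m, s.real (64 + 2 * (n * d) + l) = memCost n d s₀ (l / n) (l % n)

theorem CostProgress.setN {n d m i : ℕ} {s₀ s : MachineState} (h : CostProgress n d s₀ m i s)
    {a : ℕ} (ha : a = 2 ∨ a = 3 ∨ a = 4 ∨ a = 7) (v : ℕ) :
    CostProgress n d s₀ m i (s.setN a v) where
  ready := h.ready.setN (by omega) v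
  pointer := by rw [MachineState.setN_nat, if_neg (by omega), h.pointer]
  source := by rw [MachineState.setN_nat, if_neg (by omega), h.source]
  low := h.low
  done := h.done

theorem CostProgress.setR {n d m i : ℕ} {s₀ s : MachineState} (h : CostProgress n d s₀ m i s)
    (v : ℝ) : CostProgress n d s₀ m i (s.setR 5 v) where
  ready := h.ready.setR _ v
  pointer := h.pointer
  source := h.source
  low a ha h5 := by rw [MachineState.setR_real, if_neg h5, h.low a ha h5]
  done l hl := by rw [MachineState.setR_real, if_neg (by omega), h.done l hl]

theorem index_div {n i j : ℕ} (hj : j < n) : (i * n + j) / n = i := by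
  rw [Nat.add_comm, Nat.add_mul_div_right _ _ (by omega), Nat.div_eq_of_lt hj, zero_add]

theorem index_mod {n i j : ℕ} (hj : j < n) : (i * n + j) % n = j := by
  rw [Nat.add_comm, Nat.add_mul_mod_self_right, Nat.mod_eq_of_lt hj]

theorem index_inj {n i i' j j' : ℕ} (hj : j < n) (hj' : j' < n) (h : i * n + j = i' * n + j') :
    i = i' ∧ j = j' :=
  ⟨by rw [← index_div (i := i) hj, h, index_div hj'],
    by rw [← index_mod (i := i) hj, h, index_mod hj']⟩

theorem halts_computeCosts {n d : ℕ} {s₀ : MachineState} (h₀ : Ready n d s₀) :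
    computeCosts.Halts s₀ (n * (n * (d * 50 + 80) + 40) + 30) fun s =>
      Ready n d s ∧ (∀ a < 64 + 2 * (n * d), a ≠ 5 → s.real a = s₀.real a) ∧
      ∀ i < n, ∀ j < n, s.real (64 + 2 * (n * d) + i * n + j) = memCost n d s₀ i j := by
  refine (Halts.seq (T₁ := 4) (T₂ := 3 + (n * ((4 + (n * (d * 50 + 67 + 13) + 10) + 7) + 13) + 10))
    (Halts.setNat rfl) ?_).mono (by ring_nf; omega) fun _ h => h
  rintro _ rfl
  refine Halts.seq (Halts.setNat rfl) ?_
  rintro _ rfl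
  refine Halts.forLoop (fun i s => CostProgress n d s₀ (i * n) i s ∧ s.nat 2 = i)
    (fun k s h => h.1.ready.size) (fun k s h => h.2) ?_ ?_ ?_
  · refine ⟨⟨?_, ?_, ?_, fun a _ _ => rfl, fun l hl => by omega⟩, by
      simp [MachineState.setN_nat]⟩
    · exact ((h₀.setN (by simp) _).setN (by simp) _).setN (by simp) _
    · simp [MachineState.setN_nat, h₀.matrix]
    · simp [MachineState.setN_nat]
  · rintro i hi s₁ ⟨h₁, hi₁⟩
    rw [add_assoc 4]
    refine Halts.seq (Halts.setNat rfl) ?_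
    rintro _ rfl
    refine Halts.seq (mid := fun s => CostProgress n d s₀ ((i + 1) * n) i s ∧ s.nat 2 = i) ?_ ?_
    · refine Halts.forLoop (fun j s => CostProgress n d s₀ (i * n + j) i s ∧ s.nat 2 = i ∧
        s.nat 3 = j ∧ s.nat 7 = 64 + n * d + j * d) (fun k s h => h.1.ready.size)
        (fun k s h => h.2.2.1) ?_ ?_ ?_
      · exact ⟨(h₁.setN (by simp) _).setN (by simp) _, by simp [MachineState.setN_nat, hi₁],
          by simp [MachineState.setN_nat], by simp [MachineState.setN_nat, h₁.ready.target]⟩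
      · rintro j hj s₂ ⟨h₂, hi₂, hj₂, hy₂⟩
        refine (Halts.seq (T₁ := 4) (T₂ := d * (32 + 13) + 10 + (23 + 6)) (Halts.setReal rfl)
          ?_).mono (by omega) fun _ h => h
        rintro _ rfl
        refine Halts.seq (mid := fun s => CostProgress n d s₀ (i * n + j) i s ∧ s.nat 2 = i ∧
          s.nat 3 = j ∧ s.nat 7 = 64 + n * d + (j + 1) * d ∧
          s.real 5 = memSqDist n d s₀ i j d) ?_ ?_
        · refine Halts.forLoop (fun k s => CostProgress n d s₀ (i * n + j) i s ∧ s.nat 2 = i ∧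
            s.nat 3 = j ∧ s.nat 4 = k ∧ s.nat 7 = 64 + n * d + j * d + k ∧
            s.real 5 = memSqDist n d s₀ i j k) (fun k s h => h.1.ready.dim)
            (fun k s h => h.2.2.2.1) ?_ ?_ ?_
          · exact ⟨(h₂.setR _).setN (by simp) _, by simp [MachineState.setN_nat, hi₂],
              by simp [MachineState.setN_nat, hj₂], by simp [MachineState.setN_nat],
              by simp [MachineState.setN_nat, hy₂],
              by simp [MachineState.setR_real, memSqDist]⟩
          · rintro k hk s₃ ⟨h₃, hi₃, hj₃, hk₃, hy₃, hacc⟩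
            refine (Halts.seq (T₁ := 26) (T₂ := 6) ((Halts.setReal rfl).mono ?_ fun _ h => h)
              ?_).mono (by omega) fun _ h => h
            · simp [NExpr.cost, RExpr.cost, RExpr.reg, NExpr.reg, coordinateDiff]
            rintro _ rfl
            refine Halts.setNat ⟨by simp [MachineState.setN_nat, hk₃],
              ((h₃.setR _).setN (by simp) _).setN (by simp) _,
              by simp [MachineState.setN_nat, hi₃], by simp [MachineState.setN_nat, hj₃],
              by simp [MachineState.setN_nat], by simp [MachineState.setN_nat, hy₃, add_assoc],
              ?_⟩
            have hx : s₃.real (64 + i * d + k) = s₀.real (64 + i * d + k) := by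
              have := index_lt hi hk
              exact h₃.low _ (by omega) (by omega)
            have hy : s₃.real (64 + n * d + j * d + k) = s₀.real (64 + n * d + j * d + k) := by
              have := index_lt hj hk
              exact h₃.low _ (by omega) (by omega)
            rw [memSqDist, Finset.sum_range_succ, ← memSqDist, ← hacc, ← hx, ← hy]
            simp [MachineState.setR_real, coordinateDiff, h₃.source, hk₃, hy₃, sq]
          · rintro s₃ ⟨h₃, hi₃, hj₃, -, hy₃, hacc⟩
            exact ⟨h₃, hi₃, hj₃, by rw [hy₃]; ring, hacc⟩
        rintro s₃ ⟨h₃, hi₃, hj₃, hy₃, hacc⟩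
        have hp₃ : s₃.real 0 = s₀.real 0 := h₃.low 0 (by omega) (by omega)
        have h5 : s₃.nat 5 ≠ 5 := by rw [h₃.pointer]; omega
        refine Halts.seq (mid := fun s => s = s₃.setR (s₃.nat 5) (memCost n d s₀ i j)) ?_ ?_
        · refine (Halts.ite (b := .realLe (.reg 5) (.ofNat (.const 0))) (T := 18) (fun hb => ?_)
            fun hb => ?_).mono (by simp [Test.cost, RExpr.cost, RExpr.reg, NExpr.cost])
            fun _ h => h
          · refine (Halts.setReal ?_).mono (by simp [NExpr.cost, RExpr.cost, NExpr.reg])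
              fun _ h => h
            have hb' : memSqDist n d s₀ i j d ≤ 0 := by simpa [hacc] using hb
            simp [memCost, hb']
          · refine (Halts.setReal ?_).mono (by
              simp [NExpr.cost, RExpr.cost, NExpr.reg, RExpr.reg, RExpr.two]) fun _ h => h
            have hb' : ¬ memSqDist n d s₀ i j d ≤ 0 := by simpa [hacc] using hb
            simp [memCost, hb', RExpr.two, hacc, hp₃]
        rintro _ rfl
        refine Halts.setNat ⟨?_, ⟨?_, ?_, ?_, ?_, ?_⟩, ?_, ?_, ?_⟩
        · simp [MachineState.setN_nat, hj₃]
        · exact ((h₃.ready.setR _ _).setN (by simp) _).setN (by simp) _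
        · simp [MachineState.setN_nat, h₃.pointer, add_assoc]
        · simp [MachineState.setN_nat, h₃.source]
        · intro a ha ha5
          simp only [MachineState.setN_real, MachineState.setR_real]
          rw [if_neg (by rw [h₃.pointer]; omega), h₃.low a ha ha5]
        · intro l hl
          simp only [MachineState.setN_real, MachineState.setR_real]
          rw [h₃.pointer]
          by_cases hlm : l = i * n + j
          · rw [if_pos (by omega), hlm, index_div hj, index_mod hj]
          · rw [if_neg (by omega), h₃.done l (by omega)]
        · simp [MachineState.setN_nat, hi₃]
        · simp [MachineState.setN_nat]
        · simp [MachineState.setN_nat, hy₃]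
      · rintro s₂ ⟨h₂, hi₂, -, -⟩
        rw [Nat.succ_mul]
        exact ⟨h₂, hi₂⟩
    rintro s₂ ⟨h₂, hi₂⟩
    refine halts_addTo ⟨by simp [MachineState.setN_nat, hi₂], ⟨?_, ?_, ?_, h₂.low, h₂.done⟩, ?_⟩
    · exact (h₂.ready.setN (by simp) _).setN (by simp) _
    · simp [MachineState.setN_nat, h₂.pointer]
    · simp [MachineState.setN_nat, h₂.source, h₂.ready.dim, Nat.succ_mul, add_assoc]
    · simp [MachineState.setN_nat]
  · rintro s ⟨h, -⟩
    refine ⟨h.ready, h.low, fun i hi j hj => ?_⟩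
    rw [add_assoc, h.done _ (index_lt hi hj), index_div hj, index_mod hj]

end

section

/-! ### The solver: the auction in memory -/

open Program

/-- The state `s` holds the state of the auction: the addresses of the matrix rows of the bidder
and of the next source to enter are in the natural cells `13` and `14`, the table of owners (as
addresses of their matrix rows, `0` for a free target) starts at the natural cell `64`, and the
prices are behind the cost matrix. -/
structure HoldsAuction {n : ℕ} (d : ℕ) (c : Fin n → Fin n → ℝ) (e : ℝ) (m cur : ℕ)
    (owner : Fin n → Option (Fin n)) (bids : Fin n → ℕ) (s : MachineState) : Prop where
  ready : Ready n d s
  increment : s.real 6 = e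
  cost : ∀ i j : Fin n, s.real (64 + 2 * (n * d) + i * n + j) = c i j
  bidder : s.nat 13 = 64 + 2 * (n * d) + cur * n
  next : s.nat 14 = 64 + 2 * (n * d) + m * n
  owns : ∀ j : Fin n, s.nat (64 + j) = (owner j).elim 0 fun i => 64 + 2 * (n * d) + i * n
  price : ∀ j : Fin n, s.real (64 + 2 * (n * d) + n * n + j) = e * bids j

/-- Initially all targets are free at price zero, and the first source bids. -/
def startAuction : Program :=
  .seq (.setReal (.const 6) (.divide (.reg 1) .two)) (.seq (.setNat (.const 13) (.reg 11))
    (.seq (.setNat (.const 14) (.plus (.reg 11) (.reg 0))) (forLoop 2 0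
      (.seq (.setReal (.plus (.reg 12) (.reg 2)) (.ofNat (.const 0)))
        (.setNat (.plus (.const 64) (.reg 2)) (.const 0))))))

theorem halts_startAuction {n d : ℕ} {c : Fin n → Fin n → ℝ} {s₀ : MachineState}
    (h₀ : Ready n d s₀) (hc : ∀ i j : Fin n, s₀.real (64 + 2 * (n * d) + i * n + j) = c i j) :
    startAuction.Halts s₀ (n * 30 + 40) (HoldsAuction d c (s₀.real 1 / 2) 1 0
      (fun _ => none) fun _ => 0) := by
  refine (Halts.seq (T₁ := 7) (T₂ := 4 + (7 + (n * ((8 + 6) + 13) + 10)))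
    ((Halts.setReal rfl).mono (by simp [NExpr.cost, RExpr.cost, RExpr.reg, RExpr.two])
      fun _ h => h) ?_).mono (by omega) fun _ h => h
  rintro _ rfl
  refine Halts.seq (Halts.setNat rfl) ?_
  rintro _ rfl
  refine Halts.seq (Halts.setNat rfl) ?_
  rintro _ rfl
  refine Halts.forLoop (fun k s => (Ready n d s ∧ s.real 6 = s₀.real 1 / 2 ∧
    s.nat 13 = 64 + 2 * (n * d) ∧ s.nat 14 = 64 + 2 * (n * d) + n ∧
    (∀ a < n * n, s.real (64 + 2 * (n * d) + a) = s₀.real (64 + 2 * (n * d) + a)) ∧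
    ∀ j < k, s.nat (64 + j) = 0 ∧ s.real (64 + 2 * (n * d) + n * n + j) = 0) ∧ s.nat 2 = k)
    (fun k s h => h.1.1.size) (fun k s h => h.2) ?_ ?_ ?_
  · refine ⟨⟨(((h₀.setR _ _).setN (by simp) _).setN (by simp) _).setN (by simp) _, ?_, ?_, ?_,
      fun a ha => ?_, fun j hj => by omega⟩, by simp [MachineState.setN_nat]⟩
    · simp [MachineState.setR_real, RExpr.two]
    · simp [MachineState.setN_nat, h₀.matrix]
    · simp [MachineState.setN_nat, h₀.matrix, h₀.size]
    · simp only [MachineState.setN_real, MachineState.setR_real, NExpr.eval_const]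
      rw [if_neg (by omega)]
  · rintro k hk s ⟨⟨hr, h6, h13, h14, hM, hdone⟩, hk₂⟩
    refine Halts.seq (Halts.setReal rfl) ?_
    rintro _ rfl
    refine Halts.setNat ?_
    simp only [NExpr.eval_plus, NExpr.eval_reg, NExpr.eval_const, RExpr.eval_ofNat, Nat.cast_zero,
      MachineState.setR_nat, hk₂, hr.price]
    refine ⟨?_, ⟨((hr.setR _ _).setN (by omega) _).setN (by simp) _, ?_, ?_, ?_, fun a ha => ?_,
      fun j hj => ⟨?_, ?_⟩⟩, by simp [MachineState.setN_nat]⟩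
    · rw [MachineState.setN_nat, if_neg (by omega), MachineState.setR_nat, hk₂]
    · rw [MachineState.setN_real, MachineState.setN_real, MachineState.setR_real,
        if_neg (by omega), h6]
    · rw [MachineState.setN_nat, if_neg (by omega), MachineState.setN_nat, if_neg (by omega),
        MachineState.setR_nat, h13]
    · rw [MachineState.setN_nat, if_neg (by omega), MachineState.setN_nat, if_neg (by omega),
        MachineState.setR_nat, h14]
    · rw [MachineState.setN_real, MachineState.setN_real, MachineState.setR_real,
        if_neg (by omega), hM a ha]
    · rw [MachineState.setN_nat, if_neg (by omega), MachineState.setN_nat, MachineState.setR_nat]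
      split_ifs with h
      · rfl
      · exact (hdone j (by omega)).1
    · rw [MachineState.setN_real, MachineState.setN_real, MachineState.setR_real]
      split_ifs with h
      · rfl
      · exact (hdone j (by omega)).2
  · rintro s ⟨⟨hr, h6, h13, h14, hM, hdone⟩, -⟩
    refine ⟨hr, h6, fun i j => ?_, by rw [h13]; ring, by rw [h14]; ring,
      fun j => (hdone j j.2).1, fun j => by rw [(hdone j j.2).2]; simp⟩
    rw [← hc, add_assoc, hM _ (index_lt i.2 j.2)]

/-- What the bidder pays for the target in cell `3`: cost plus price. -/
def payment : RExpr := .plus (.mem (.plus (.reg 13) (.reg 3))) (.mem (.plus (.reg 12) (.reg 3)))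

/-- Finds the cheapest target for the bidder and stores it in the natural cell `15`. -/
def findBest : Program :=
  .seq (.setNat (.const 15) (.const 0))
    (.seq (.setReal (.const 7) (.plus (.mem (.reg 13)) (.mem (.reg 12))))
      (forLoop 3 0 (.ite (.realLe payment (.reg 7))
        (.seq (.setNat (.const 15) (.reg 3)) (.setReal (.const 7) payment)) .skip)))

theorem halts_findBest {n : ℕ} (hn : 0 < n) {s₀ : MachineState} (h₀ : s₀.nat 0 = n)
    (h₁₃ : 64 ≤ s₀.nat 13) (h₁₂ : 64 ≤ s₀.nat 12) :
    findBest.Halts s₀ (n * 48 + 22) fun s => (∀ a, a ≠ 3 → a ≠ 15 → s.nat a = s₀.nat a) ∧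
      (∀ a, a ≠ 7 → s.real a = s₀.real a) ∧ s.nat 15 < n ∧ ∀ j < n,
        s₀.real (s₀.nat 13 + s.nat 15) + s₀.real (s₀.nat 12 + s.nat 15) ≤
          s₀.real (s₀.nat 13 + j) + s₀.real (s₀.nat 12 + j) := by
  refine (Halts.seq (T₁ := 3) (T₂ := 9 + (n * (35 + 13) + 10)) (Halts.setNat rfl) ?_).mono
    (by omega) fun _ h => h
  rintro _ rfl
  refine Halts.seq (Halts.setReal rfl) ?_
  rintro _ rfl
  refine Halts.forLoop (fun k s => ((∀ a, a ≠ 3 → a ≠ 15 → s.nat a = s₀.nat a) ∧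
      (∀ a, a ≠ 7 → s.real a = s₀.real a) ∧ s.nat 15 < n ∧
      s.real 7 = s₀.real (s₀.nat 13 + s.nat 15) + s₀.real (s₀.nat 12 + s.nat 15) ∧
      ∀ j < k, s.real 7 ≤ s₀.real (s₀.nat 13 + j) + s₀.real (s₀.nat 12 + j)) ∧ s.nat 3 = k)
    (fun k s h => by rw [h.1.1 0 (by simp) (by simp), h₀]) (fun k s h => h.2) ?_ ?_ ?_
  · refine ⟨⟨fun a h3 h15 => ?_, fun a h7 => ?_, ?_, ?_, fun j hj => by omega⟩, ?_⟩
    · simp [MachineState.setN_nat, h3, h15]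
    · simp [MachineState.setR_real, h7]
    · simpa [MachineState.setN_nat]
    · simp [MachineState.setN_nat, MachineState.setR_real]
    · simp [MachineState.setN_nat]
  · rintro k hk s ⟨⟨hnat, hreal, hlt, hval, hmin⟩, hk₃⟩
    have hpay : payment.eval s = s₀.real (s₀.nat 13 + k) + s₀.real (s₀.nat 12 + k) := by
      simp only [payment, RExpr.eval_plus, RExpr.eval_mem, NExpr.eval_plus, NExpr.eval_reg, hk₃]
      rw [hnat 13 (by simp) (by simp), hnat 12 (by simp) (by simp), hreal _ (by omega),
        hreal _ (by omega)]
    refine (Halts.ite (T := 19) (fun hb => ?_) fun hb => ?_).mono (by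
      simp [Test.cost, NExpr.cost, RExpr.cost, NExpr.reg, RExpr.reg, payment]) fun _ h => h
    · rw [Test.holds_realLe, RExpr.eval_reg, hpay] at hb
      refine Halts.seq (T₁ := 4) (T₂ := 15) (Halts.setNat rfl) ?_
      rintro _ rfl
      refine Halts.setReal ?_
      have hpay' : payment.eval (s.setN ((NExpr.const 15).eval s) ((NExpr.reg 3).eval s)) =
          s₀.real (s₀.nat 13 + k) + s₀.real (s₀.nat 12 + k) := by
        rw [← hpay]
        simp [payment, MachineState.setN_nat]
      rw [hpay']
      refine ⟨by simp [MachineState.setN_nat, hk₃], ⟨fun a h3 h15 => ?_, fun a h7 => ?_, ?_, ?_,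
        fun j hj => ?_⟩, by simp [MachineState.setN_nat]⟩
      · simp [MachineState.setN_nat, h3, h15, hnat a h3 h15]
      · simp [MachineState.setR_real, h7, hreal a h7]
      · simpa [MachineState.setN_nat, hk₃]
      · simp [MachineState.setN_nat, MachineState.setR_real, hk₃]
      · simp only [MachineState.setN_real, MachineState.setR_real, NExpr.eval_const, if_true]
        rcases Nat.lt_succ_iff_lt_or_eq.1 hj with hj | rfl
        · exact hb.trans (hmin j hj)
        · exact le_rfl
    · rw [Test.holds_realLe, RExpr.eval_reg, hpay, not_le] at hb
      refine (Halts.skip ?_).mono (by omega) fun _ h => h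
      refine ⟨hk₃, ⟨fun a h3 h15 => ?_, hreal, by simpa [MachineState.setN_nat], ?_,
        fun j hj => ?_⟩, by simp [MachineState.setN_nat]⟩
      · simp [MachineState.setN_nat, h3, hnat a h3 h15]
      · simp [MachineState.setN_nat, hval]
      rcases Nat.lt_succ_iff_lt_or_eq.1 hj with hj | rfl
      · exact hmin j hj
      · exact hb.le
  · rintro s ⟨⟨hnat, hreal, hlt, hval, hmin⟩, -⟩
    exact ⟨hnat, hreal, hlt, fun j hj => hval ▸ hmin j hj⟩

/-- The bidder raises the price of the target in cell `15` and becomes its owner; the previous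
owner, or the next source if there was none, becomes the bidder. -/
def placeBid : Program :=
  .seq (.setReal (.plus (.reg 12) (.reg 15))
      (.plus (.mem (.plus (.reg 12) (.reg 15))) (.reg 6)))
    (.seq (.setNat (.const 16) (.mem (.plus (.const 64) (.reg 15))))
      (.seq (.setNat (.plus (.const 64) (.reg 15)) (.reg 13))
        (.ite (.natLe (.reg 16) (.const 0))
          (.seq (.setNat (.const 13) (.reg 14)) (addTo 14 0))
          (.setNat (.const 13) (.reg 16)))))

theorem halts_placeBid {n d m cur : ℕ} {c : Fin n → Fin n → ℝ} {e : ℝ}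
    {owner : Fin n → Option (Fin n)} {bids : Fin n → ℕ} {s₀ : MachineState}
    (h : HoldsAuction d c e m cur owner bids s₀) (hcur : cur < n) {j : Fin n}
    (hj : s₀.nat 15 = j) :
    placeBid.Halts s₀ 44 (HoldsAuction d c e (if owner j = none then m + 1 else m)
      ((owner j).elim m fun i => (i : ℕ)) (Function.update owner j (some ⟨cur, hcur⟩))
      (Function.update bids j (bids j + 1))) := by
  refine Halts.seq (T₁ := 15) (T₂ := 7 + (7 + (4 + 11))) (Halts.setReal rfl) ?_
  rintro _ rfl
  refine Halts.seq (Halts.setNat rfl) ?_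
  rintro _ rfl
  refine Halts.seq (Halts.setNat rfl) ?_
  rintro _ rfl
  simp only [NExpr.eval_plus, NExpr.eval_reg, NExpr.eval_const, NExpr.eval_mem, RExpr.eval_plus,
    RExpr.eval_mem, RExpr.eval_reg, MachineState.setR_nat]
  have h15 : ((s₀.setR (s₀.nat 12 + s₀.nat 15)
      (s₀.real (s₀.nat 12 + s₀.nat 15) + s₀.real 6)).setN 16 (s₀.nat (64 + s₀.nat 15))).nat 15 =
      j := by rw [MachineState.setN_nat, if_neg (by omega), MachineState.setR_nat, hj]
  have h13 : ((s₀.setR (s₀.nat 12 + s₀.nat 15)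
      (s₀.real (s₀.nat 12 + s₀.nat 15) + s₀.real 6)).setN 16 (s₀.nat (64 + s₀.nat 15))).nat 13 =
      64 + 2 * (n * d) + cur * n := by
    rw [MachineState.setN_nat, if_neg (by omega), MachineState.setR_nat, h.bidder]
  rw [h15, h13, hj]
  set s : MachineState := ((s₀.setR (s₀.nat 12 + j) (s₀.real (s₀.nat 12 + j) + s₀.real 6)).setN 16
    (s₀.nat (64 + j))).setN (64 + j) (64 + 2 * (n * d) + cur * n) with hs
  have hready : Ready n d s := ((h.ready.setR _ _).setN (by omega) _).setN (by omega) _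
  have hreal : ∀ a, s.real a = if a = 64 + 2 * (n * d) + n * n + j then e * bids j + e
      else s₀.real a := by
    intro a
    rw [hs, MachineState.setN_real, MachineState.setN_real, MachineState.setR_real, h.ready.price,
      h.price, h.increment]
  have hcost : ∀ i j : Fin n, s.real (64 + 2 * (n * d) + i * n + j) = c i j := by
    intro i j
    have := index_lt i.2 j.2
    rw [hreal, if_neg (by omega), h.cost]
  have hincr : s.real 6 = e := by rw [hreal, if_neg (by omega), h.increment]
  have hprice : ∀ j' : Fin n, s.real (64 + 2 * (n * d) + n * n + j') =
      e * (Function.update bids j (bids j + 1) j' : ℕ) := by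
    intro j'
    rw [hreal]
    by_cases hjj : j' = j
    · subst hjj
      rw [if_pos rfl, Function.update_self]
      push_cast
      ring
    · have := Fin.val_ne_of_ne hjj
      rw [if_neg (by omega), Function.update_of_ne hjj, h.price]
  have howns : ∀ j' : Fin n, s.nat (64 + j') =
      (Function.update owner j (some ⟨cur, hcur⟩) j').elim 0
        fun i => 64 + 2 * (n * d) + i * n := by
    intro j'
    rw [hs, MachineState.setN_nat]
    by_cases hjj : j' = j
    · subst hjj
      rw [if_pos rfl, Function.update_self]
      rfl
    · have := Fin.val_ne_of_ne hjj
      rw [if_neg (by omega), Function.update_of_ne hjj, MachineState.setN_nat, if_neg (by omega),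
        MachineState.setR_nat, h.owns]
  have h16 : s.nat 16 = (owner j).elim 0 fun i => 64 + 2 * (n * d) + i * n := by
    rw [hs, MachineState.setN_nat, if_neg (by omega), MachineState.setN_nat, if_pos rfl, h.owns]
  have h14 : s.nat 14 = 64 + 2 * (n * d) + m * n := by
    rw [hs, MachineState.setN_nat, if_neg (by omega), MachineState.setN_nat, if_neg (by omega),
      MachineState.setR_nat, h.next]
  refine Halts.ite (fun hb => ?_) fun hb => ?_
  · simp only [Test.holds_natLe, NExpr.eval_reg, NExpr.eval_const, h16] at hb
    have ho : owner j = none := by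
      rcases ho : owner j with _ | i
      · rfl
      · rw [ho, Option.elim_some] at hb
        omega
    simp only [ho, if_true, Option.elim_none]
    refine Halts.seq (T₁ := 4) (T₂ := 7) (Halts.setNat rfl) ?_
    rintro _ rfl
    refine halts_addTo ⟨(hready.setN (by simp) _).setN (by simp) _, hincr, hcost, ?_, ?_,
      fun j' => ?_, hprice⟩
    · simp [MachineState.setN_nat, h14]
    · simp [MachineState.setN_nat, h14, hready.size]
      ring
    · rw [MachineState.setN_nat, if_neg (by omega), MachineState.setN_nat,
        if_neg (by rw [NExpr.eval_const]; omega), howns]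
  · simp only [Test.holds_natLe, NExpr.eval_reg, NExpr.eval_const, h16] at hb
    rcases ho : owner j with _ | i
    · exact absurd (by simp [ho]) hb
    rw [ho, Option.elim_some] at h16
    simp only [reduceCtorEq, if_false, Option.elim_some]
    refine (Halts.setNat (a := .const 13) (e := .reg 16) ?_).mono (by
      simp [NExpr.cost, NExpr.reg]) fun _ h => h
    refine ⟨hready.setN (by simp) _, hincr, hcost, ?_, ?_, fun j' => ?_, hprice⟩
    · simp [MachineState.setN_nat, h16]
    · simp [MachineState.setN_nat, h14]
    · rw [MachineState.setN_nat, if_neg (by rw [NExpr.eval_const]; omega), howns]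

theorem HoldsAuction.congr {n d m cur : ℕ} {c : Fin n → Fin n → ℝ} {e : ℝ}
    {owner : Fin n → Option (Fin n)} {bids : Fin n → ℕ} {s s' : MachineState}
    (h : HoldsAuction d c e m cur owner bids s)
    (hnat : ∀ a, a ≠ 3 → a ≠ 15 → s'.nat a = s.nat a) (hreal : ∀ a, a ≠ 7 → s'.real a = s.real a) :
    HoldsAuction d c e m cur owner bids s' where
  ready := h.ready.congr fun a ha => hnat a (by omega) (by omega)
  increment := by rw [hreal 6 (by omega), h.increment]
  cost i j := by rw [hreal _ (by omega), h.cost]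
  bidder := by rw [hnat 13 (by omega) (by omega), h.bidder]
  next := by rw [hnat 14 (by omega) (by omega), h.next]
  owns j := by rw [hnat _ (by omega) (by omega), h.owns]
  price j := by rw [hreal _ (by omega), h.price]

/-- Bids are placed until the bidder would be the source `n`, that is, as long as the row of the
bidder is in front of the price table. -/
def auction : Program :=
  .seq startAuction
    (.loop (.natLe (.plus (.reg 13) (.const 1)) (.reg 12)) (.seq findBest placeBid))

/-- Every bid raises the number of bids, which is at most `n * N`. -/
theorem halts_auction {n d N : ℕ} {c : Fin n → Fin n → ℝ} {s₀ : MachineState} (hn : 0 < n)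
    (h₀ : Ready n d s₀) (hc : ∀ i j : Fin n, s₀.real (64 + 2 * (n * d) + i * n + j) = c i j)
    (he : 0 < s₀.real 1) (hc0 : ∀ i j, 0 ≤ c i j) (hcN : ∀ i j, c i j < s₀.real 1 / 2 * N) :
    auction.Halts s₀ (n * 30 + n * N * (n * 48 + 73) + 50) fun s => ∃ m owner bids,
      AuctionState c (s₀.real 1 / 2) N m n owner bids ∧
        HoldsAuction d c (s₀.real 1 / 2) m n owner bids s := by
  refine (Halts.seq (T₂ := n * N * (n * 48 + 66 + 7) + 7) (halts_startAuction h₀ hc)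
    fun s hs => ?_).mono (by ring_nf; omega) fun _ h => h
  have htest : ∀ m cur owner bids s, HoldsAuction d c (s₀.real 1 / 2) m cur owner bids s →
      ((Test.natLe (.plus (.reg 13) (.const 1)) (.reg 12)).Holds s ↔ cur < n) := by
    intro m cur owner bids s hs
    simp only [Test.holds_natLe, NExpr.eval_plus, NExpr.eval_reg, NExpr.eval_const, hs.bidder,
      hs.ready.price, ← Nat.mul_lt_mul_right (a := n) (b := cur) hn]
    omega
  refine (Halts.loop (B := n * 48 + 66) (fun k s => ∃ m cur owner bids,
    AuctionState c (s₀.real 1 / 2) N m cur owner bids ∧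
      HoldsAuction d c (s₀.real 1 / 2) m cur owner bids s ∧ k + ∑ j, bids j = n * N)
    ?_ (n * N) s ⟨1, 0, _, _, AuctionState.init hn, hs, by simp⟩).mono ?_ ?_
  · rintro k s ⟨m, cur, owner, bids, hA, hH, hk⟩ hb
    rw [htest _ _ _ _ _ hH] at hb
    obtain ⟨i₀, hi₀⟩ : ∃ i : Fin n, (i : ℕ) = cur := ⟨⟨cur, hb⟩, rfl⟩
    have hbest := halts_findBest hn hH.ready.size (by rw [hH.bidder]; omega)
      (by rw [hH.ready.price]; omega)
    obtain ⟨t₁, s₁, hr₁, ht₁, hnat, hreal, hlt, hmin⟩ := hbest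
    obtain ⟨j, hj⟩ : ∃ j : Fin n, s₁.nat 15 = j := ⟨⟨_, hlt⟩, rfl⟩
    have hH₁ := hH.congr hnat hreal
    have hA' := hA.bid hb (by linarith) hc0 hcN (j := j) fun j' => by
      have := hmin j' j'.2
      rw [hj, hH.bidder, hH.ready.price, hH.price, hH.price] at this
      have h₁ := hH.cost ⟨cur, hb⟩ j
      have h₂ := hH.cost ⟨cur, hb⟩ j'
      simp only at h₁ h₂
      rwa [h₁, h₂] at this
    have hk' := hA'.sum_bids_le
    rw [AuctionState.sum_update_bids] at hk'
    obtain ⟨t₂, s₂, hr₂, ht₂, hH₂⟩ := halts_placeBid hH₁ hb hj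
    refine ⟨k - 1, by omega, t₁ + t₂, s₂, Runs.seq hr₁ hr₂, by omega, _, _, _, _, hA', hH₂, ?_⟩
    rw [AuctionState.sum_update_bids]
    omega
  · simp [Test.cost, NExpr.cost, NExpr.reg]
  · rintro s' ⟨hb, k, m, cur, owner, bids, hA, hH, -⟩
    rw [htest _ _ _ _ _ hH] at hb
    obtain rfl : cur = n := le_antisymm hA.cur_le (not_lt.1 hb)
    exact ⟨m, owner, bids, hA, hH⟩

/-- Replaces the cost matrix by zeros, and then writes `1 / n` for every pair of a target and its
owner. -/
def writeAssignment : Program :=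
  .seq (.setNat (.const 5) (.reg 11)) (.seq
    (forLoop 2 0 (forLoop 3 0 (.seq (.setReal (.reg 5) (.ofNat (.const 0))) (incr 5))))
    (forLoop 2 0 (.setReal (.plus (.mem (.plus (.const 64) (.reg 2))) (.reg 2))
      (.divide (.ofNat (.const 1)) (.ofNat (.reg 0))))))

theorem halts_writeAssignment {n d : ℕ} {σ : Fin n ≃ Fin n} {s₀ : MachineState}
    (h₀ : Ready n d s₀)
    (hσ : ∀ i j : Fin n, σ i = j → s₀.nat (64 + j) = 64 + 2 * (n * d) + i * n) :
    writeAssignment.Halts s₀ (n * (n * 30 + 60) + 30)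
      (HoldsMatrix d fun i j => if σ i = j then 1 / (n : ℝ) else 0) := by
  refine (Halts.seq (T₁ := 4) (T₂ := n * ((n * ((5 + 6) + 13) + 10) + 13) + 10 +
    (n * (15 + 13) + 10)) (Halts.setNat rfl) ?_).mono (by ring_nf; omega) fun _ h => h
  rintro _ rfl
  refine Halts.seq (mid := fun s => (∀ a, a ≠ 2 → a ≠ 3 → a ≠ 5 → s.nat a = s₀.nat a) ∧
    ∀ l < n * n, s.real (64 + 2 * (n * d) + l) = 0) ?_ ?_
  · refine Halts.forLoop (fun i s => ((∀ a, a ≠ 2 → a ≠ 3 → a ≠ 5 → s.nat a = s₀.nat a) ∧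
      s.nat 5 = 64 + 2 * (n * d) + i * n ∧ ∀ l < i * n, s.real (64 + 2 * (n * d) + l) = 0) ∧
      s.nat 2 = i) (fun k s h => by rw [h.1.1 0 (by simp) (by simp) (by simp), h₀.size])
      (fun k s h => h.2) ?_ ?_ fun s h => ⟨h.1.1, h.1.2.2⟩
    · refine ⟨⟨fun a h2 h3 h5 => ?_, ?_, fun l hl => by omega⟩, ?_⟩
      · simp [MachineState.setN_nat, h2, h5]
      · simp [MachineState.setN_nat, h₀.matrix]
      · simp [MachineState.setN_nat]
    · rintro i hi s ⟨⟨hnat, hptr, hzero⟩, hi₂⟩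
      refine Halts.forLoop (fun j s => (∀ a, a ≠ 2 → a ≠ 3 → a ≠ 5 → s.nat a = s₀.nat a) ∧
        s.nat 5 = 64 + 2 * (n * d) + (i * n + j) ∧
        (∀ l < i * n + j, s.real (64 + 2 * (n * d) + l) = 0) ∧ s.nat 2 = i ∧ s.nat 3 = j)
        (fun k s h => by rw [h.1 0 (by simp) (by simp) (by simp), h₀.size])
        (fun k s h => h.2.2.2.2) ?_ ?_ ?_
      · refine ⟨fun a h2 h3 h5 => ?_, ?_, hzero, ?_, ?_⟩
        · simp [MachineState.setN_nat, h3, hnat a h2 h3 h5]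
        · simp [MachineState.setN_nat, hptr]
        · simp [MachineState.setN_nat, hi₂]
        · simp [MachineState.setN_nat]
      · rintro j hj s₁ ⟨hnat, hptr, hzero, hi₂, hj₃⟩
        refine Halts.seq (T₁ := 5) (T₂ := 6) (Halts.setReal rfl) ?_
        rintro _ rfl
        refine Halts.setNat ⟨?_, fun a h2 h3 h5 => ?_, ?_, fun l hl => ?_, ?_, ?_⟩
        · simp [MachineState.setN_nat, hj₃]
        · simp [MachineState.setN_nat, h3, h5, hnat a h2 h3 h5]
        · simp [MachineState.setN_nat, hptr, add_assoc]
        · simp only [MachineState.setN_real, MachineState.setR_real, NExpr.eval_reg, hptr]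
          split_ifs with h
          · simp
          · exact hzero l (by omega)
        · simp [MachineState.setN_nat, hi₂]
        · simp [MachineState.setN_nat]
      · rintro s₁ ⟨hnat, hptr, hzero, hi₂, -⟩
        refine ⟨hi₂, ⟨fun a h2 h3 h5 => ?_, ?_, fun l hl => hzero l ?_⟩, ?_⟩
        · simp [MachineState.setN_nat, h2, hnat a h2 h3 h5]
        · simp [MachineState.setN_nat, hptr, Nat.succ_mul]
        · rwa [Nat.succ_mul] at hl
        · simp [MachineState.setN_nat]
  rintro s ⟨hnat, hzero⟩
  refine Halts.forLoop (fun k s => (∀ a, a ≠ 2 → a ≠ 3 → a ≠ 5 → s.nat a = s₀.nat a) ∧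
    (∀ i j : Fin n, s.real (64 + 2 * (n * d) + i * n + j) =
      if σ i = j ∧ (j : ℕ) < k then 1 / (n : ℝ) else 0) ∧ s.nat 2 = k)
    (fun k s h => by rw [h.1 0 (by simp) (by simp) (by simp), h₀.size])
    (fun k s h => h.2.2) ?_ ?_ ?_
  · refine ⟨fun a h2 h3 h5 => ?_, fun i j => ?_, by simp [MachineState.setN_nat]⟩
    · simp [MachineState.setN_nat, h2, hnat a h2 h3 h5]
    · rw [if_neg (by omega), MachineState.setN_real, add_assoc, hzero _ (index_lt i.2 j.2)]
  · rintro k hk s₁ ⟨hnat, hreal, hk₂⟩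
    obtain ⟨i₀, hi₀⟩ : ∃ i₀, σ i₀ = ⟨k, hk⟩ := ⟨σ.symm ⟨k, hk⟩, σ.apply_symm_apply _⟩
    have hown := hσ i₀ ⟨k, hk⟩ hi₀
    simp only at hown
    refine (Halts.setReal ?_).mono (by simp [NExpr.cost, RExpr.cost, NExpr.reg]) fun _ h => h
    simp only [NExpr.eval_plus, NExpr.eval_mem, NExpr.eval_reg, NExpr.eval_const,
      RExpr.eval_divide, RExpr.eval_ofNat, hk₂]
    rw [hnat (64 + k) (by omega) (by omega) (by omega), hown, hnat 0 (by simp) (by simp) (by simp),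
      h₀.size]
    refine ⟨hk₂, fun a h2 h3 h5 => ?_, fun i j => ?_, by simp [MachineState.setN_nat]⟩
    · simp [MachineState.setN_nat, h2, hnat a h2 h3 h5]
    · rw [MachineState.setN_real, MachineState.setR_real, Nat.cast_one]
      by_cases hij : σ i = j ∧ (j : ℕ) = k
      · obtain rfl : i = i₀ := σ.injective (by rw [hi₀, hij.1]; exact Fin.ext hij.2)
        rw [if_pos (by omega), if_pos ⟨hij.1, by omega⟩]
      · rw [if_neg, hreal]
        · refine if_congr (and_congr_right fun h => ?_) rfl rfl
          have : (j : ℕ) ≠ k := fun hjk => hij ⟨h, hjk⟩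
          omega
        · intro h
          obtain ⟨h₁, h₂⟩ := index_inj (i := i) (i' := i₀) j.2 hk (by omega)
          exact hij ⟨by rw [Fin.ext h₁, hi₀]; exact Fin.ext h₂.symm, h₂⟩
  · rintro s₁ ⟨-, hreal, -⟩ i j
    rw [hreal]
    simp only [j.2, and_true]

end

section

/-! ### The solver: correctness and running time -/

open Program

/-- Solves the assignment problem for the rounded source samples and the target samples by an
auction with increment `δ / 2`. -/
def solver : Program :=
  .seq computeAddresses (.seq computeCosts (.seq auction writeAssignment))

theorem solver_floorFree : solver.FloorFree := by
  simp [solver, computeAddresses, computeCosts, auction, writeAssignment, startAuction, findBest,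
    placeBid, forLoop, addTo, incr, payment, coordinateDiff, Program.FloorFree, Test.FloorFree,
    RExpr.FloorFree, RExpr.reg, RExpr.two]

theorem memCost_eq {d n : ℕ} {p : ℝ} (hp : 0 < p) {θ : Tuning} {z y : Fin n → E d}
    {s : MachineState} (hs : HoldsData p θ z y s) (i j : Fin n) :
    memCost n d s i j = ‖z i - y j‖ ^ p := by
  have hsq : memSqDist n d s i j d = ‖z i - y j‖ ^ 2 := by
    rw [memSqDist, Finset.sum_range, EuclideanSpace.norm_sq_eq]
    refine Finset.sum_congr rfl fun l _ => ?_
    rw [hs.source i l, hs.target j l, Real.norm_eq_abs, sq_abs]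
    rfl
  rw [memCost, hsq, hs.exponent]
  split_ifs with h
  · have h0 : ‖z i - y j‖ = 0 := by
      have := sq_nonneg ‖z i - y j‖
      exact pow_eq_zero_iff two_ne_zero |>.1 (le_antisymm h this)
    rw [h0, Real.zero_rpow hp.ne']
  · have h0 : 0 < ‖z i - y j‖ := by
      refine (norm_nonneg _).lt_of_ne fun h0 => h ?_
      rw [← h0]
      simp
    rw [Real.rpow_def_of_pos h0, Real.log_pow]
    congr 1
    push_cast
    ring

theorem halts_solver {d n N : ℕ} (hn : 0 < n) {p : ℝ} (hp : 0 < p) {θ : Tuning}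
    (hδ : 0 < θ.δ) {z y : Fin n → E d} {s : MachineState} (hs : HoldsData p θ z y s)
    (hN : ∀ i j, ‖z i - y j‖ ^ p < θ.δ / 2 * N) :
    solver.Halts s (n * 40 + 40 + (n * (n * (d * 50 + 80) + 40) + 30 +
      (n * 30 + n * N * (n * 48 + 73) + 50 + (n * (n * 30 + 60) + 30)))) fun s' =>
      ∃ (σ : Fin n ≃ Fin n) (v : Fin n → ℝ),
        HoldsMatrix d (fun i j => if σ i = j then 1 / (n : ℝ) else 0) s' ∧ (∀ j, 0 ≤ v j) ∧
        ∀ i j, ‖z i - y (σ i)‖ ^ p + v (σ i) ≤ ‖z i - y j‖ ^ p + v j + θ.δ / 2 := by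
  refine Halts.seq (halts_computeAddresses hs.size hs.dim) ?_
  rintro s₁ ⟨h₁, hr₁⟩
  have hs₁ : HoldsData p θ z y s₁ := by
    constructor
    · exact h₁.size
    · exact h₁.dim
    all_goals rw [hr₁]
    exacts [hs.exponent, hs.accuracy, hs.temperature, hs.side, hs.radius, hs.source, hs.target]
  refine Halts.seq (halts_computeCosts h₁) ?_
  rintro s₂ ⟨h₂, hlow, hcost⟩
  have h1 : s₂.real 1 = θ.δ := by rw [hlow 1 (by omega) (by omega), hs₁.accuracy]
  refine Halts.seq (halts_auction (N := N) (c := fun i j => ‖z i - y j‖ ^ p) hn h₂ (fun i j => by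
    rw [hcost i i.2 j j.2, memCost_eq hp hs₁]) (by rwa [h1])
    (fun i j => Real.rpow_nonneg (norm_nonneg _) _) (by rwa [h1])) ?_
  rintro s₃ ⟨m, owner, bids, hA, hH⟩
  obtain ⟨σ, hσ⟩ := hA.exists_equiv
  refine (halts_writeAssignment (σ := σ) hH.ready fun i j hij => ?_).mono le_rfl fun s' hs' =>
    ⟨σ, fun j => s₂.real 1 / 2 * bids j, hs', fun j => ?_, fun i j => ?_⟩
  · rw [hH.owns, (hσ i j).2 hij]
    rfl
  · rw [h1]
    positivity
  · have := hA.content (σ i) i ((hσ i _).2 rfl) j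
    rw [h1] at this ⊢
    exact this

theorem rate_rpow {d n : ℕ} {p : ℝ} : rate d p n ^ p = ((n : ℝ) ^ (p / (d + 2 * p)))⁻¹ := by
  rw [rate, ← Real.rpow_mul (Nat.cast_nonneg n), ← Real.rpow_neg (Nat.cast_nonneg n)]
  congr 1
  ring

theorem cost_le_maxCost {d n : ℕ} {p : ℝ} (x y : Fin n → E d) (i j : Fin n) :
    ‖x i - y j‖ ^ p ≤ maxCost p x y :=
  le_ciSup (f := fun ij : Fin n × Fin n => ‖x ij.1 - y ij.2‖ ^ p) (Set.finite_range _).bddAbove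
    (i, j)

theorem rpow_le_of_le_add_one {p a b : ℝ} (hp : 0 ≤ p) (ha : 0 ≤ a) (hb : 0 ≤ b)
    (hab : a ≤ b + 1) : a ^ p ≤ 2 ^ p * (b ^ p + 1) := by
  have hb' : 0 ≤ b ^ p := Real.rpow_nonneg hb p
  have h2 : (0 : ℝ) ≤ 2 ^ p := by positivity
  rcases le_total b 1 with h | h
  · calc a ^ p ≤ 2 ^ p := Real.rpow_le_rpow ha (by linarith) hp
      _ ≤ 2 ^ p * (b ^ p + 1) := le_mul_of_one_le_right h2 (by linarith)
  · calc a ^ p ≤ (2 * b) ^ p := Real.rpow_le_rpow ha (by linarith) hp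
      _ = 2 ^ p * b ^ p := Real.mul_rpow (by norm_num) hb
      _ ≤ 2 ^ p * (b ^ p + 1) := mul_le_mul_of_nonneg_left (by linarith) h2

/-- The auction takes time proportional to the largest cost over the accuracy. Rounding moves the
samples by a bounded distance, so that the largest cost is governed by that of the samples. -/
theorem solvesWithin_solver {d n : ℕ} (hd : 1 ≤ d) (hn : 3 ≤ n) {p K : ℝ} (hp : 1 ≤ p)
    (hK : 480 + 121 * (2 * 2 ^ p + 1) ≤ K) {θ : Tuning} (hδ : θ.δ = rate d p n ^ p)
    (hτ : θ.τ = rate d p n ^ p / (2 * Real.log n)) {Q : CenteredPartition d}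
    (hQ : ∀ x, ‖x - Q.round x‖ ≤ 1) :
    SolvesWithin n p θ Q solver
      (fun x y => K * (maxCost p x y + d) * (n : ℝ) ^ (2 + p / (d + 2 * p))) := by
  intro x y s hs
  have hp0 : 0 < p := by linarith
  have hn1 : (1 : ℝ) ≤ n := by exact_mod_cast (by omega : 1 ≤ n)
  have hd1 : (1 : ℝ) ≤ d := by exact_mod_cast hd
  have hl : 1 ≤ Real.log n := one_le_log hn
  set D : ℝ := (n : ℝ) ^ (p / (d + 2 * p)) with hD
  have hD1 : 1 ≤ D := Real.one_le_rpow hn1 (by positivity)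
  have hδD : θ.δ = D⁻¹ := by rw [hδ, rate_rpow]
  have hδ0 : 0 < θ.δ := by rw [hδD]; positivity
  set M : ℝ := maxCost p x y with hM
  have hM0 : 0 ≤ M := by
    have i₀ : Fin n := ⟨0, by omega⟩
    exact (Real.rpow_nonneg (norm_nonneg _) p).trans (cost_le_maxCost x y i₀ i₀)
  have hcost : ∀ i j, ‖Q.round (x i) - y j‖ ^ p ≤ 2 ^ p * (M + 1) := by
    intro i j
    refine (rpow_le_of_le_add_one hp0.le (norm_nonneg _) (norm_nonneg (x i - y j)) ?_).trans ?_
    · calc ‖Q.round (x i) - y j‖ = ‖(x i - y j) - (x i - Q.round (x i))‖ := by congr 1; abel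
        _ ≤ ‖x i - y j‖ + ‖x i - Q.round (x i)‖ := norm_sub_le _ _
        _ ≤ ‖x i - y j‖ + 1 := by linarith [hQ (x i)]
    · gcongr
      exact cost_le_maxCost x y i j
  set N : ℕ := ⌊2 * (2 ^ p * (M + 1)) * D⌋₊ + 1 with hN
  have hNlt : 2 * (2 ^ p * (M + 1)) * D < N := by
    rw [hN]
    push_cast
    exact Nat.lt_floor_add_one _
  have hNle : (N : ℝ) ≤ (2 * 2 ^ p + 1) * ((M + d) * D) := by
    have h₁ : (⌊2 * (2 ^ p * (M + 1)) * D⌋₊ : ℝ) ≤ 2 * (2 ^ p * (M + 1)) * D :=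
      Nat.floor_le (by positivity)
    have h₂ : 2 * (2 ^ p * (M + 1)) * D ≤ 2 * (2 ^ p * (M + d)) * D := by gcongr
    have h₃ : 1 ≤ (M + d) * D := one_le_mul_of_one_le_of_one_le (by linarith) hD1
    rw [hN]
    push_cast
    linarith
  obtain ⟨t, s', hrun, ht, σ, v, hmat, hv, hcontent⟩ := halts_solver (N := N) (by omega) hp0 hδ0 hs
    fun i j => by
      refine (hcost i j).trans_lt ?_
      rw [hδD]
      have : 2 ^ p * (M + 1) = D⁻¹ / 2 * (2 * (2 ^ p * (M + 1)) * D) := by field_simp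
      rw [this]
      gcongr
  refine ⟨t, s', _, hrun, ?_, hmat, fun i j => ?_, ?_⟩
  · have ht' : t ≤ n ^ 2 * (480 * d + 121 * N) := by
      have hN1 : 1 ≤ N := by omega
      have h₁ : n ≤ n ^ 2 := Nat.le_self_pow two_ne_zero n
      have h₂ : n * N ≤ n ^ 2 * N := Nat.mul_le_mul_right N h₁
      have h₃ : n ^ 2 ≤ n ^ 2 * d := Nat.le_mul_of_pos_right _ hd
      nlinarith
    have hpow : (n : ℝ) ^ (2 + p / (d + 2 * p)) = (n : ℝ) ^ 2 * D := by
      rw [Real.rpow_add (by linarith)]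
      norm_cast
    calc (t : ℝ) ≤ (n : ℝ) ^ 2 * (480 * d + 121 * N) := by exact_mod_cast ht'
      _ ≤ (n : ℝ) ^ 2 * (480 * ((M + d) * D) + 121 * ((2 * 2 ^ p + 1) * ((M + d) * D))) := by
          have : (d : ℝ) ≤ (M + d) * D := by nlinarith
          gcongr
      _ = (480 + 121 * (2 * 2 ^ p + 1)) * (M + d) * ((n : ℝ) ^ 2 * D) := by ring
      _ ≤ K * (M + d) * ((n : ℝ) ^ 2 * D) := by gcongr
      _ = _ := by rw [hpow]
  · split_ifs
    · positivity
    · exact le_rfl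
  · refine assignment_solves hp hn Q x y hv ?_ hcontent (by positivity) (le_of_eq ?_)
    · rw [hτ, ← hδ]
      positivity
    · rw [hτ, ← hδ]
      field_simp
      ring

end

section

/-! ### The two partitions -/

section tuning

variable {d n : ℕ} {p : ℝ}

/-- The tuning of the estimator: the accuracy is the `p`-th power of the rate, and the temperature
is so small that the entropy of a coupling costs at most half of the accuracy. -/
noncomputable def tuning (d : ℕ) (p : ℝ) (n : ℕ) : Tuning where
  R := 1 / rate d p n
  r := gridStep d p n
  δ := rate d p n ^ p
  τ := rate d p n ^ p / (2 * Real.log n)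

theorem tuning_valid (hd : 1 ≤ d) (hn : 3 ≤ n) : (tuning d p n).Valid := by
  have hq : 0 < rate d p n := rate_pos hn
  have hl : 1 ≤ Real.log n := one_le_log hn
  exact ⟨one_div_pos.2 hq, gridStep_pos hd hn, Real.rpow_nonneg hq.le p,
    div_pos (Real.rpow_pos_of_pos hq p) (by linarith)⟩

theorem norm_sub_round_le_of_gridStep_cubes (hd : 1 ≤ d) (hn : 3 ≤ n) {Q : CenteredPartition d}
    (hQ : Q.cells = cubeCells d (gridStep d p n)) (x : E d) :
    ‖x - Q.round x‖ ≤ rate d p n := by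
  have h₁ := norm_sub_round_le_of_cubes (gridStep_pos hd hn) hQ x
  have h₂ := mul_gridStep (p := p) (n := n) hd
  have h₃ : 0 < gridStep d p n := gridStep_pos hd hn
  have h₄ : 0 ≤ d * gridStep d p n := by positivity
  linarith

/-- The tail of a sub-Gaussian measure beyond `2 log n` is negligible. -/
theorem exists_riskAtMost_cubes (hd : 1 ≤ d) (hp : 1 ≤ p) :
    ∃ (A : ℝ) (k : ℕ), ∀ n : ℕ, 3 ≤ n → ∀ Q : CenteredPartition d,
      Q.cells = cubeCells d (gridStep d p n) →
      RiskAtMost.{u} n p (rate d p n ^ p) Q (IsSubGaussian 1) (IsSubGaussian 1)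
        (A * Real.log n ^ k * (n : ℝ) ^ (-(1 / (d + 2 * p)))) := by
  obtain ⟨A, k, h⟩ := exists_riskAtMost.{u} hd hp
    (v := 1 + 2 * Real.exp ((2 * p) ^ 2 / 2)) (e := 2 * Real.exp (p ^ 2 / 2))
    (by linarith [Real.exp_pos ((2 * p) ^ 2 / 2)]) (by positivity)
  refine ⟨A, k, fun n hn Q hQ => h n hn Q (2 * Real.log n) _ (fun x => ?_) ?_ fun μ _ hμ =>
    ⟨hμ.lintegral_le (by linarith), (hμ.tail_le hp hn).trans (ENNReal.ofReal_le_ofReal ?_)⟩⟩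
  · have h₁ := norm_sub_round_le_of_gridStep_cubes hd hn hQ x
    have hq : 0 < rate d p n := rate_pos hn
    have hd1 : (1 : ℝ) ≤ d := by exact_mod_cast hd
    calc ‖x - Q.round x‖ ≤ 1 * rate d p n * 1 := by linarith
      _ ≤ 2 * d * rate d p n * (1 + ‖x‖) := by
          gcongr
          · linarith
          · linarith [norm_nonneg x]
  · exact exists_finset_grid_cells hd hp hn
      (hQ.trans (cubeCells_eq_gridCells (gridStep_pos hd hn))) fun t ht => ht
  · have hn1 : (1 : ℝ) ≤ n := by exact_mod_cast (by omega : 1 ≤ n)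
    have hinv : (n : ℝ)⁻¹ ≤ 1 := inv_le_one_of_one_le₀ hn1
    have hinv0 : 0 ≤ (n : ℝ)⁻¹ := by positivity
    gcongr
    exact (pow_le_of_le_one hinv0 hinv two_ne_zero).trans (inv_le_rate_rpow hp hn)

/-- The regular partition, with the lower corners as centers. -/
noncomputable def cubePartition (hd : 1 ≤ d) (hn : 3 ≤ n) : CenteredPartition d :=
  gridPartition d (g := id) (h := id) measurable_id (fun _ => rfl) (gridStep_pos (p := p) hd hn)

/-- The partition whose cells grow in proportion to the norm, up to the radius `1 / rate`. -/
noncomputable def growingPartition (hd : 1 ≤ d) (hn : 3 ≤ n) : CenteredPartition d :=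
  gridPartition d (measurable_truncScale (1 / rate d p n))
    (truncScale_inv (one_div_pos.2 (rate_pos hn))) (gridStep_pos (p := p) hd hn)

theorem cells_cubePartition (hd : 1 ≤ d) (hn : 3 ≤ n) :
    (cubePartition (p := p) hd hn).cells = cubeCells d (gridStep d p n) :=
  (cubeCells_eq_gridCells (gridStep_pos hd hn)).symm

theorem roundsWithin_cubePartition (hd : 1 ≤ d) (hn : 3 ≤ n) {K : ℝ} (hK : 305 ≤ K) :
    RoundsWithin n p (tuning d p n) (cubePartition (p := p) hd hn) (roundLoop roundCubesEntry)
      (K * (d * n * Real.log n)) := by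
  refine roundsWithin_roundLoop hd hn (roundsEntry_cubes _ _) (fun x i => ?_) (by
    norm_num; linarith)
  rw [cubePartition, gridPartition_round]
  rfl

theorem roundsWithin_growingPartition (hd : 1 ≤ d) (hn : 3 ≤ n) {K : ℝ} (hK : 305 ≤ K) :
    RoundsWithin n p (tuning d p n) (growingPartition (p := p) hd hn) (roundLoop roundCellsEntry)
      (K * (d * n * Real.log n)) := by
  refine roundsWithin_roundLoop hd hn (roundsEntry_cells _ _) (fun x i => ?_) (by
    norm_num; linarith)
  rw [growingPartition, gridPartition_round]
  rfl

theorem norm_sub_round_growingPartition_le (hd : 1 ≤ d) (hp : 1 ≤ p) (hn : 3 ≤ n) (x : E d) :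
    ‖x - (growingPartition (p := p) hd hn).round x‖ ≤ rate d p n * (1 + ‖x‖) ∧
      ‖x - (growingPartition (p := p) hd hn).round x‖ ≤ 1 := by
  have hq : 0 < rate d p n := rate_pos hn
  have hq1 : rate d p n ≤ 1 := rate_le_one hp hn
  have h := norm_sub_round_le_of_truncScale (T := 1 / rate d p n) (one_le_one_div hq hq1)
    (gridStep_pos hd hn) ((gridStep_le_rate hd hn).trans hq1)
    (Q := growingPartition (p := p) hd hn) rfl x
  rwa [mul_gridStep hd, mul_one_div_cancel hq.ne'] at h

theorem one_div_rate_le (hp : 1 ≤ p) (hn : 3 ≤ n) : 1 / rate d p n ≤ n := by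
  have hn1 : (1 : ℝ) ≤ n := by exact_mod_cast (by omega : 1 ≤ n)
  rw [rate, Real.rpow_neg (by linarith), one_div, inv_inv]
  refine (Real.rpow_le_rpow_of_exponent_le hn1 ?_).trans_eq (Real.rpow_one _)
  rw [div_le_one (by positivity)]
  linarith [(Nat.cast_nonneg d : (0 : ℝ) ≤ d)]

/-- By Markov's inequality, the moment of order `2 p` bounds the tail of order `p` beyond `1 / rate`
by a multiple of `rate ^ p`. On the scale of the partition the radius `1 / rate ≤ n` is at most
`2 log n`. -/
theorem exists_riskAtMost_growingPartition (hd : 1 ≤ d) (hp : 1 ≤ p) :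
    ∃ (A : ℝ) (k : ℕ), ∀ (n : ℕ) (hn : 3 ≤ n),
      RiskAtMost.{u} n p (rate d p n ^ p) (growingPartition (p := p) hd hn)
        (HasUnitMoment (2 * p)) (IsSubGaussian 1)
        (A * Real.log n ^ k * (n : ℝ) ^ (-(1 / (d + 2 * p)))) := by
  obtain ⟨A, k, h⟩ := exists_riskAtMost.{u} hd hp (v := 2 ^ (2 * p)) (e := 2 ^ p)
    (Real.one_le_rpow one_le_two (by linarith)) (by positivity)
  refine ⟨A, k, fun n hn => ?_⟩
  have hq : 0 < rate d p n := rate_pos hn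
  have hq1 : rate d p n ≤ 1 := rate_le_one hp hn
  have hd1 : (1 : ℝ) ≤ d := by exact_mod_cast hd
  refine h n hn _ (1 / rate d p n) _ (fun x => ?_) ?_ fun μ _ hμ =>
    ⟨hμ.lintegral_le (by linarith),
      (hμ.setLIntegral_le hp (one_le_one_div hq hq1)).trans_eq ?_⟩
  · refine (norm_sub_round_growingPartition_le hd hp hn x).1.trans ?_
    have : 1 * rate d p n ≤ 2 * d * rate d p n := by gcongr; linarith
    gcongr
    linarith
  · refine exists_finset_grid_cells hd hp hn (g := truncScale (1 / rate d p n)) rfl fun t ht =>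
      (abs_truncScale_le ht).trans ?_
    have hn3 : (3 : ℝ) ≤ n := by exact_mod_cast hn
    have h₁ : 1 / rate d p n ≤ n := one_div_rate_le hp hn
    have h₂ : 0 < 1 / rate d p n := one_div_pos.2 hq
    calc Real.log (1 + 2 * (1 / rate d p n)) ≤ Real.log ((n : ℝ) ^ 2) :=
          Real.log_le_log (by linarith) (by nlinarith)
      _ = 2 * Real.log n := by rw [Real.log_pow]; norm_num
  · rw [one_div, Real.inv_rpow hq.le, inv_inv]

theorem RiskAtMost.mono {δ B B' : ℝ} {Q : CenteredPartition d} {M N : Measure (E d) → Prop}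
    (h : RiskAtMost.{u} n p δ Q M N B) (hB : B ≤ B') : RiskAtMost.{u} n p δ Q M N B' :=
  fun μ ν hμ hν hM hN Ω _ P hP X Y hX hY κ hκ =>
    (h μ ν hμ hν hM hN Ω _ P hP X Y hX hY κ hκ).trans (ENNReal.ofReal_le_ofReal hB)

theorem bound_mono {A A' : ℝ} {k k' : ℕ} (hA : A ≤ A') (hA' : 0 ≤ A') (hk : k ≤ k') (hn : 3 ≤ n) :
    A * Real.log n ^ k * (n : ℝ) ^ (-(1 / (d + 2 * p))) ≤
      A' * Real.log n ^ k' * (n : ℝ) ^ (-(1 / (d + 2 * p))) := by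
  have hl : 1 ≤ Real.log n := one_le_log hn
  have : 0 ≤ Real.log n := by linarith
  gcongr

theorem tendsto_exponent (p : ℝ) :
    Tendsto (fun d : ℕ => p / (d + 2 * p)) atTop (𝓝 0) :=
  tendsto_const_nhds.div_atTop (tendsto_atTop_add_const_right _ _ tendsto_natCast_atTop_atTop)

end tuning

end

end RoundingOT

open RoundingOT in
theorem theorem2 (p : ℝ) (hp : 1 ≤ p) :
    ∃ (K : ℝ) (ε : ℕ → ℝ) (solver roundCubes roundCells : Program),
      Tendsto ε atTop (𝓝 0) ∧ solver.FloorFree ∧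
      ∀ d : ℕ, 1 ≤ d →
        ∃ (A : ℝ) (k : ℕ),
          -- regular partition into cubes, `μ` and `ν` sub-Gaussian
          (∀ n : ℕ, 3 ≤ n → ∃ θ : Tuning, θ.Valid ∧
            (∀ Q : CenteredPartition d, Q.cells = cubeCells d θ.r →
              RiskAtMost.{u} n p θ.δ Q (IsSubGaussian 1) (IsSubGaussian 1)
                (A * Real.log n ^ k * (n : ℝ) ^ (-(1 / (d + 2 * p)))) ∧
              SolvesWithin n p θ Q solver
                (fun x y => K * (maxCost p x y + d) * (n : ℝ) ^ (2 + ε d))) ∧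
            ∃ Q : CenteredPartition d, Q.cells = cubeCells d θ.r ∧
              RoundsWithin n p θ Q roundCubes (K * (d * n * Real.log n))) ∧
          -- another partition, `μ` with bounded moment of order `2p` and `ν` sub-Gaussian
          (∀ n : ℕ, 3 ≤ n → ∃ (θ : Tuning) (Q : CenteredPartition d), θ.Valid ∧
            RiskAtMost.{u} n p θ.δ Q (HasUnitMoment (2 * p)) (IsSubGaussian 1)
              (A * Real.log n ^ k * (n : ℝ) ^ (-(1 / (d + 2 * p)))) ∧
            SolvesWithin n p θ Q solver
              (fun x y => K * (maxCost p x y + d) * (n : ℝ) ^ (2 + ε d)) ∧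
            RoundsWithin n p θ Q roundCells (K * (d * n * Real.log n))) := by
  set K : ℝ := max (480 + 121 * (2 * 2 ^ p + 1)) 305
  have hK₁ : 480 + 121 * (2 * 2 ^ p + 1) ≤ K := le_max_left _ _
  have hK₂ : 305 ≤ K := le_max_right _ _
  refine ⟨K, fun d => p / (d + 2 * p), solver, roundLoop roundCubesEntry,
    roundLoop roundCellsEntry, tendsto_exponent p, solver_floorFree, fun d hd => ?_⟩
  obtain ⟨A₁, k₁, h₁⟩ := exists_riskAtMost_cubes.{u} hd hp
  obtain ⟨A₂, k₂, h₂⟩ := exists_riskAtMost_growingPartition.{u} hd hp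
  have hA : 0 ≤ max 0 (max A₁ A₂) := le_max_left _ _
  have hA₁ : A₁ ≤ max 0 (max A₁ A₂) := (le_max_left _ _).trans (le_max_right _ _)
  have hA₂ : A₂ ≤ max 0 (max A₁ A₂) := (le_max_right _ _).trans (le_max_right _ _)
  refine ⟨max 0 (max A₁ A₂), max k₁ k₂, fun n hn => ⟨tuning d p n, tuning_valid hd hn,
    fun Q hQ => ⟨?_, ?_⟩, cubePartition hd hn, cells_cubePartition hd hn,
    roundsWithin_cubePartition hd hn hK₂⟩, fun n hn => ⟨tuning d p n, growingPartition hd hn,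
    tuning_valid hd hn, ?_, ?_, roundsWithin_growingPartition hd hn hK₂⟩⟩
  · exact (h₁ n hn Q hQ).mono (bound_mono hA₁ hA (le_max_left _ _) hn)
  · exact solvesWithin_solver hd hn hp hK₁ rfl rfl fun x =>
      (norm_sub_round_le_of_gridStep_cubes hd hn hQ x).trans (rate_le_one hp hn)
  · exact (h₂ n hn).mono (bound_mono hA₂ hA (le_max_right _ _) hn)
  · exact solvesWithin_solver hd hn hp hK₁ rfl rfl fun x =>
      (norm_sub_round_growingPartition_le hd hp hn x).2
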